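/- Let $M$ be a smooth Riemannian manifold (without boundary, Hausdorff, second countable, not necessarily connected, oriented or complete) of dimension $n\ge 1$. For an open set $U\subset M$ and $k\ge 0$, let $L^{n/k}(U,\Lambda^k)$ be the space of (almost everywhere classes of) measurable $k$-forms $\omega$ on $U$ with $|\omega|\in L^{n/k}(U)$ for the Riemannian volume (where $n/0=\infty$), with its norm. A form $\theta\in L^1_{loc}(U,\Lambda^{k+1})$ is the weak exterior differential on $U$ of $\varphi\in L^1_{loc}(U,\Lambda^k)$, written $d\varphi=\theta$, if $\int_V\theta\wedge\omega=(-1)^{k+1}\int_V\varphi\wedge d\omega$ for all oriented open sets $V\subset U$ and all smooth $(n-k-1)$-forms $\omega$ with compact support in $V$. Set $$Z^k(U)=\{\omega\in L^{n/k}(U,\Lambda^k): d\omega=0\},\qquad B^k(U)=\{\omega\in L^{n/k}(U,\Lambda^k): \omega=d\theta\text{ for some }\theta\in L^{n/(k-1)}(U,\Lambda^{k-1})\}$$ (with $B^0(U)=0$), and let $\overline B^k(U)$ be the closure of $B^k(U)$ in $L^{n/k}(U,\Lambda^k)$. The conformal cohomology, the reduced conformal cohomology and the torsion of $U$ are $$H^k_{conf}(U)=Z^k(U)/B^k(U),\qquad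 \overline H^k_{conf}(U)=Z^k(U)/\overline B^k(U),\qquad T^k_{conf}(U)=\overline B^k(U)/B^k(U);$$ $\overline H^k_{conf}(U)$ carries the quotient norm. Let $\Omega^0_{conf}(U)$ be the space of $u\in L^\infty(U)$ with $du\in L^n(U,\Lambda^1)$, with the norm $\|u\|_{L^\infty}+\|du\|_{L^n}$, and let $\mathcal R^n_0(U)$ be the closure in it of the set of those of its elements which are continuous functions with compact support in $U$. For $F\subset U$, the conformal capacity $\mathrm{Cap}(F,U)\in[0,\infty]$ is the infimum of $\int_U|du|^n\,d\mathrm{vol}$ over all $u\in\mathcal R^n_0(U)$ with $u\ge 0$ almost everywhere and $u\ge 1$ on a neighbourhood of $F$. A set $S\subset M$ is conformally polar if $\mathrm{Cap}(S\cap U_1,U_2)=0$ for all relatively compact open sets $U_1\subset U_2\subset M$ with $\mathrm{dist}(U_1,M\setminus U_2)>0$, where $\mathrm{dist}$ is the Riemannian distance and $\mathrm{dist}(A,\emptyset)=\infty$. **Theorem.** If $S\subset M$ is closed and conformally polar, then $M\setminus S$ and $M$ have the same conformal cohomology, reduced conformal cohomology and torsion: for every $k\ge 0$, restriction of forms from $M$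 to $M\setminus S$ induces linear isomorphisms $$H^k_{conf}(M)\cong H^k_{conf}(M\setminus S),\qquad \overline H^k_{conf}(M)\cong\overline H^k_{conf}(M\setminus S),\qquad T^k_{conf}(M)\cong T^k_{conf}(M\setminus S),$$ the second of which is isometric. -/

import Mathlib

open MeasureTheory Set Filter Topology Bundle TopologicalSpace
open scoped Manifold ContDiff ENNReal

namespace ConfDeRham

noncomputable section

set_option linter.unusedSectionVars false

/-! ### Linear algebra on one tangent space -/

section Pointwise

/-- The exterior product of two alternating forms, in the convention
`(α ∧ β)(v₁, …) = ∑ over shuffles σ of sign σ * α(v_σ) * β(v_σ)`. -/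
def wedge {V : Type*} [AddCommGroup V] [Module ℝ V] [TopologicalSpace V] {k m : ℕ}
    (α : V [⋀^Fin k]→L[ℝ] ℝ) (β : V [⋀^Fin m]→L[ℝ] ℝ) : V [⋀^Fin (k + m)]→ₗ[ℝ] ℝ :=
  ((LinearMap.mul' ℝ ℝ).compAlternatingMap
    (α.toAlternatingMap.domCoprod β.toAlternatingMap)).domDomCongr finSumFinEquiv

theorem wedge_add_left {V : Type*} [AddCommGroup V] [Module ℝ V] [TopologicalSpace V] {k m : ℕ}
    (α α' : V [⋀^Fin k]→L[ℝ] ℝ) (β : V [⋀^Fin m]→L[ℝ] ℝ) :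
    wedge (α + α') β = wedge α β + wedge α' β := by
  have h : (α + α').toAlternatingMap.domCoprod β.toAlternatingMap
      = α.toAlternatingMap.domCoprod β.toAlternatingMap
        + α'.toAlternatingMap.domCoprod β.toAlternatingMap := by
    have := (AlternatingMap.domCoprod' (R' := ℝ) (Mᵢ := V) (N₁ := ℝ) (N₂ := ℝ) (ιa := Fin k)
      (ιb := Fin m)).map_add (α.toAlternatingMap ⊗ₜ[ℝ] β.toAlternatingMap)
        (α'.toAlternatingMap ⊗ₜ[ℝ] β.toAlternatingMap)
    rw [← TensorProduct.add_tmul] at this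
    exact this
  unfold wedge
  rw [h]
  ext v
  simp

theorem wedge_smul_left {V : Type*} [AddCommGroup V] [Module ℝ V] [TopologicalSpace V] {k m : ℕ}
    (c : ℝ) (α : V [⋀^Fin k]→L[ℝ] ℝ) (β : V [⋀^Fin m]→L[ℝ] ℝ) :
    wedge (c • α) β = c • wedge α β := by
  have h : (c • α).toAlternatingMap.domCoprod β.toAlternatingMap
      = c • α.toAlternatingMap.domCoprod β.toAlternatingMap := by
    have := (AlternatingMap.domCoprod' (R' := ℝ) (Mᵢ := V) (N₁ := ℝ) (N₂ := ℝ) (ιa := Fin k)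
      (ιb := Fin m)).map_smul c (α.toAlternatingMap ⊗ₜ[ℝ] β.toAlternatingMap)
    rw [TensorProduct.smul_tmul'] at this
    exact this
  unfold wedge
  rw [h]
  ext v
  simp

theorem wedge_zero_left {V : Type*} [AddCommGroup V] [Module ℝ V] [TopologicalSpace V] {k m : ℕ}
    (β : V [⋀^Fin m]→L[ℝ] ℝ) : wedge (0 : V [⋀^Fin k]→L[ℝ] ℝ) β = 0 := by
  simpa using wedge_smul_left (0 : ℝ) (0 : V [⋀^Fin k]→L[ℝ] ℝ) β

/-- Squared coefficients in an orthonormal basis, through the inverse Gram matrix of a basis. -/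
theorem sum_sq_onb {V : Type*} [NormedAddCommGroup V] [InnerProductSpace ℝ V] {n k : ℕ}
    (b : OrthonormalBasis (Fin n) ℝ V) (v : Fin n → V) (C : Matrix (Fin n) (Fin n) ℝ)
    (hC : ∀ l, b l = ∑ i, C l i • v i) (α : V [⋀^Fin k]→L[ℝ] ℝ) :
    ∑ I : Fin k → Fin n, (α fun a => b (I a)) ^ 2 =
      ∑ I : Fin k → Fin n, ∑ J : Fin k → Fin n,
        (∏ a, (Matrix.of fun i j => inner ℝ (v i) (v j))⁻¹ (I a) (J a)) *
          ((α fun a => v (I a)) * (α fun a => v (J a))) := by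
  set G : Matrix (Fin n) (Fin n) ℝ := Matrix.of fun i j => inner ℝ (v i) (v j) with hG
  have h1 : C * G * C.transpose = 1 := by
    ext l m
    have : inner ℝ (b l) (b m) = (1 : Matrix (Fin n) (Fin n) ℝ) l m := by
      rw [b.inner_eq_ite, Matrix.one_apply]
    rw [← this, hC l, hC m, sum_inner]
    simp only [inner_sum, inner_smul_left, inner_smul_right, Matrix.mul_apply, hG,
      Matrix.of_apply, Matrix.transpose_apply, Finset.sum_mul]
    rw [Finset.sum_comm]
    refine Finset.sum_congr rfl fun i _ => Finset.sum_congr rfl fun j _ => ?_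
    simp; ring
  have h2 : G⁻¹ = C.transpose * C := by
    apply Matrix.inv_eq_right_inv
    rw [← Matrix.mul_assoc]
    rw [Matrix.mul_assoc] at h1
    exact mul_eq_one_comm.1 h1
  have h3 : ∀ h : Fin k → Fin n, (α fun a => b (h a)) =
      ∑ I : Fin k → Fin n, (∏ a, C (h a) (I a)) * α fun a => v (I a) := by
    intro h
    simp only [hC]
    have := (α.toMultilinearMap).map_sum (fun (a : Fin k) (i : Fin n) => C (h a) i • v i)
    refine this.trans (Finset.sum_congr rfl fun I _ => ?_)
    exact (α.toMultilinearMap).map_smul_univ _ _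
  simp only [h3, sq, Finset.sum_mul_sum]
  rw [Finset.sum_comm]
  refine Finset.sum_congr rfl fun I _ => ?_
  rw [Finset.sum_comm]
  refine Finset.sum_congr rfl fun J _ => ?_
  rw [h2]
  simp only [Matrix.mul_apply, Matrix.transpose_apply]
  rw [Finset.prod_univ_sum, Finset.sum_mul, Fintype.piFinset_univ]
  refine Finset.sum_congr rfl fun h _ => ?_
  rw [Finset.prod_mul_distrib]; ring

end Pointwise

/-! ### Differential forms on a manifold, read in charts -/

section Forms

variable (n : ℕ) {M : Type*} [TopologicalSpace M] [ChartedSpace (EuclideanSpace ℝ (Fin n)) M]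

variable (M) in
/-- Differential forms of degree `k` on `M`, without any regularity. -/
abbrev FormField (k : ℕ) : Type _ := ∀ x : M, (TangentSpace (𝓡 n) x) [⋀^Fin k]→L[ℝ] ℝ

/-- The differential at `y` of the inverse of the chart around `x`. -/
def dchartSymm (x : M) (y : EuclideanSpace ℝ (Fin n)) :
    EuclideanSpace ℝ (Fin n) →L[ℝ]
      TangentSpace (𝓡 n) ((chartAt (EuclideanSpace ℝ (Fin n)) x).symm y) :=
  mfderiv (𝓡 n) (𝓡 n) (chartAt (EuclideanSpace ℝ (Fin n)) x).symm y

/-- The differential at `x` of the chart around `x`. -/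
def dchart (x : M) : TangentSpace (𝓡 n) x →L[ℝ] EuclideanSpace ℝ (Fin n) :=
  mfderiv (𝓡 n) (𝓡 n) (chartAt (EuclideanSpace ℝ (Fin n)) x) x

variable {n}

/-- The form `α` read in the chart around `x`, i.e. its pull-back by the inverse of the chart. -/
def chartForm {k : ℕ} (α : FormField n M k) (x : M) (y : EuclideanSpace ℝ (Fin n)) :
    (EuclideanSpace ℝ (Fin n)) [⋀^Fin k]→L[ℝ] ℝ :=
  (α ((chartAt (EuclideanSpace ℝ (Fin n)) x).symm y)).compContinuousLinearMap (dchartSymm n x y)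

/-- The coefficients of `α` on the coordinate vector fields of the chart around `x`. -/
def coeff {k : ℕ} (α : FormField n M k) (x : M) (I : Fin k → Fin n) (p : M) : ℝ :=
  chartForm α x (chartAt (EuclideanSpace ℝ (Fin n)) x p)
    (fun a => EuclideanSpace.basisFun (Fin n) ℝ (I a))

/-- `α` is of class `C^∞`. -/
def IsSmoothForm {k : ℕ} (α : FormField n M k) : Prop :=
  ∀ x : M, ContDiffOn ℝ ∞ (chartForm α x) (chartAt (EuclideanSpace ℝ (Fin n)) x).target

/-- `α` is continuous at the points of `V`. -/
def IsContinuousFormOn {k : ℕ} (α : FormField n M k) (V : Set M) : Prop :=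
  ∀ (x : M) (I : Fin k → Fin n),
    ContinuousOn (coeff α x I) (V ∩ (chartAt (EuclideanSpace ℝ (Fin n)) x).source)

/-- The exterior differential of a smooth form: at `x`, the exterior differential on `ℝⁿ` of the
form read in the chart around `x`, pulled back by this chart. -/
def extD {k : ℕ} (α : FormField n M k) : FormField n M (k + 1) := fun x =>
  (extDeriv (chartForm α x) (chartAt (EuclideanSpace ℝ (Fin n)) x x)).compContinuousLinearMap
    (dchart n x)

/-- A smooth form with compact support contained in the open set `V`. -/
def IsTestForm {k : ℕ} (V : Opens M) (α : FormField n M k) : Prop :=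
  IsSmoothForm α ∧ ∃ K : Set M, IsCompact K ∧ K ⊆ (V : Set M) ∧ ∀ x ∉ K, α x = 0

/-- A function, seen as a form of degree `0`. -/
def ofFun (u : M → ℝ) : FormField n M 0 := fun x =>
  ContinuousAlternatingMap.constOfIsEmpty ℝ (TangentSpace (𝓡 n) x) (Fin 0) (u x)

end Forms

/-! ### Riemannian structure -/

section Riemannian

variable (n : ℕ) {M : Type*} [TopologicalSpace M] [ChartedSpace (EuclideanSpace ℝ (Fin n)) M]
  [RiemannianBundle (fun x : M => TangentSpace (𝓡 n) x)]

instance (x : M) : FiniteDimensional ℝ (TangentSpace (𝓡 n) x) :=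
  inferInstanceAs (FiniteDimensional ℝ (EuclideanSpace ℝ (Fin n)))

/-- Some orthonormal basis of the tangent space at `x`. -/
def onb (x : M) : OrthonormalBasis (Fin n) ℝ (TangentSpace (𝓡 n) x) :=
  (stdOrthonormalBasis ℝ (TangentSpace (𝓡 n) x)).reindex
    (finCongr (by
      change Module.finrank ℝ (EuclideanSpace ℝ (Fin n)) = n
      simp))

/-- The matrix `(g_ij)` of the metric in the chart around `x`. -/
def gram (x : M) (y : EuclideanSpace ℝ (Fin n)) : Matrix (Fin n) (Fin n) ℝ := Matrix.of fun i j =>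
  inner ℝ (dchartSymm n x y (EuclideanSpace.basisFun (Fin n) ℝ i))
    (dchartSymm n x y (EuclideanSpace.basisFun (Fin n) ℝ j))

/-- The Riemannian volume of the domain of the chart around `x`, extended by zero: it has the
density `√(det g_ij)` with respect to the Lebesgue measure in this chart. -/
def chartVol [MeasurableSpace M] (x : M) : Measure M :=
  (((volume : Measure (EuclideanSpace ℝ (Fin n))).restrict
      (chartAt (EuclideanSpace ℝ (Fin n)) x).target).withDensity
    (fun y => ENNReal.ofReal √(gram n x y).det)).map (chartAt (EuclideanSpace ℝ (Fin n)) x).symm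

variable (M) in
/-- The Riemannian volume of `M`: the smallest measure that is at least the Riemannian volume of
each chart domain. (Since the volumes of the chart domains agree on overlaps and countably many
chart domains cover `M`, its restriction to each chart domain is the volume of that domain.) -/
def vol [MeasurableSpace M] : Measure M := ⨆ x : M, chartVol n x

variable {n}

/-- The norm on `Λᵏ T_x^* M` of the scalar product for which the products
`e^{i₁} ∧ ⋯ ∧ e^{i_k}`, `i₁ < ⋯ < i_k`, of an orthonormal coframe form an orthonormal basis. -/
def formNorm {k : ℕ} {x : M} (α : (TangentSpace (𝓡 n) x) [⋀^Fin k]→L[ℝ] ℝ) : ℝ :=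
  √((k.factorial : ℝ)⁻¹ * ∑ I : Fin k → Fin n, (α fun a => onb n x (I a)) ^ 2)

theorem formNorm_eq {k : ℕ} {x : M} (α : (TangentSpace (𝓡 n) x) [⋀^Fin k]→L[ℝ] ℝ) :
    formNorm α = √((k.factorial : ℝ)⁻¹) *
      ‖WithLp.toLp 2 (fun I : Fin k → Fin n => α fun a => onb n x (I a))‖ := by
  rw [formNorm, Real.sqrt_mul (by positivity), EuclideanSpace.norm_eq]
  simp

theorem formNorm_nonneg {k : ℕ} {x : M} (α : (TangentSpace (𝓡 n) x) [⋀^Fin k]→L[ℝ] ℝ) :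
    0 ≤ formNorm α := Real.sqrt_nonneg _

theorem formNorm_add_le {k : ℕ} {x : M} (α β : (TangentSpace (𝓡 n) x) [⋀^Fin k]→L[ℝ] ℝ) :
    formNorm (α + β) ≤ formNorm α + formNorm β := by
  simp only [formNorm_eq, ← mul_add]
  refine mul_le_mul_of_nonneg_left ?_ (by positivity)
  exact norm_add_le (WithLp.toLp 2 (fun I : Fin k → Fin n => α fun a => onb n x (I a)))
    (WithLp.toLp 2 (fun I : Fin k → Fin n => β fun a => onb n x (I a)))

theorem formNorm_smul {k : ℕ} {x : M} (c : ℝ) (α : (TangentSpace (𝓡 n) x) [⋀^Fin k]→L[ℝ] ℝ) :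
    formNorm (c • α) = |c| * formNorm α := by
  simp only [formNorm_eq]
  rw [mul_left_comm]
  congr 1
  exact norm_smul c (WithLp.toLp 2 (fun I : Fin k → Fin n => α fun a => onb n x (I a)))

theorem formNorm_eq_zero_of_lt {k : ℕ} (hk : n < k) {x : M}
    (α : (TangentSpace (𝓡 n) x) [⋀^Fin k]→L[ℝ] ℝ) : formNorm α = 0 := by
  have : ∀ I : Fin k → Fin n, (α fun a => onb n x (I a)) = 0 := fun I => by
    apply α.map_eq_zero_of_not_injective
    intro hI
    have hI' : Function.Injective I := fun a b hab => hI (by simp [hab])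
    have := Fintype.card_le_of_injective I hI'
    simp at this
    omega
  simp [formNorm, this]

variable [IsManifold (𝓡 n) ∞ M]
  [IsContMDiffRiemannianBundle (𝓡 n) ∞ (EuclideanSpace ℝ (Fin n))
    (fun x : M => TangentSpace (𝓡 n) x)]

theorem continuousOn_gram (x : M) (i j : Fin n) :
    ContinuousOn (fun y => gram n x y i j) (chartAt (EuclideanSpace ℝ (Fin n)) x).target := by
  have hc : IsContinuousRiemannianBundle (EuclideanSpace ℝ (Fin n))
      (fun x : M => TangentSpace (𝓡 n) x) := by
    obtain ⟨g, hg, h⟩ := IsContMDiffRiemannianBundle.exists_contMDiff (IB := 𝓡 n) (n := ∞)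
      (F := EuclideanSpace ℝ (Fin n)) (E := fun x : M => TangentSpace (𝓡 n) x)
    exact ⟨g, hg.continuous, h⟩
  have key : ∀ e : EuclideanSpace ℝ (Fin n), ContinuousOn
      (fun y => (⟨(chartAt (EuclideanSpace ℝ (Fin n)) x).symm y, dchartSymm n x y e⟩ :
        TotalSpace (EuclideanSpace ℝ (Fin n)) (fun x : M => TangentSpace (𝓡 n) x)))
      (chartAt (EuclideanSpace ℝ (Fin n)) x).target := by
    intro e
    have h1 := (contMDiffOn_chart_symm (I := 𝓡 n) (n := ∞) (x := x)).continuousOn_tangentMapWithin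
      (by simp) (chartAt (EuclideanSpace ℝ (Fin n)) x).open_target.uniqueMDiffOn
    have h2 : Continuous (fun y : EuclideanSpace ℝ (Fin n) =>
        (⟨y, e⟩ : TangentBundle (𝓡 n) (EuclideanSpace ℝ (Fin n)))) := by
      have : Continuous (fun y : EuclideanSpace ℝ (Fin n) => (y, e)) := by fun_prop
      exact (tangentBundleModelSpaceHomeomorph (𝓡 n)).symm.continuous.comp this
    have h3 := h1.comp h2.continuousOn (s := (chartAt (EuclideanSpace ℝ (Fin n)) x).target)
      (fun y hy => hy)
    refine h3.congr fun y hy => ?_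
    simp only [Function.comp, tangentMapWithin, dchartSymm]
    rw [mfderivWithin_of_isOpen (chartAt (EuclideanSpace ℝ (Fin n)) x).open_target hy]
    rfl
  exact ContinuousOn.inner_bundle (key _) (key _)

theorem exists_onb_eq_sum (x : M) {y : EuclideanSpace ℝ (Fin n)}
    (hy : y ∈ (chartAt (EuclideanSpace ℝ (Fin n)) x).target) :
    ∃ C : Matrix (Fin n) (Fin n) ℝ, ∀ l,
      onb n ((chartAt (EuclideanSpace ℝ (Fin n)) x).symm y) l =
        ∑ i, C l i • dchartSymm n x y (EuclideanSpace.basisFun (Fin n) ℝ i) := by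
  have hd := mdifferentiable_chart (I := 𝓡 n) x
  have hs := hd.symm.comp_symm_deriv (x := (chartAt (EuclideanSpace ℝ (Fin n)) x).symm y)
    ((chartAt (EuclideanSpace ℝ (Fin n)) x).map_target hy)
  have hsurj : ∀ w, ∃ e, dchartSymm n x y e = w := by
    intro w
    have := DFunLike.congr_fun hs w
    simp only [OpenPartialHomeomorph.symm_symm] at this
    rw [(chartAt (EuclideanSpace ℝ (Fin n)) x).right_inv hy] at this
    exact ⟨_, this⟩
  choose e he using hsurj
  refine ⟨Matrix.of fun l i => e (onb n _ l) i, fun l => ?_⟩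
  conv_lhs => rw [← he (onb n _ l)]
  conv_lhs => rw [← (EuclideanSpace.basisFun (Fin n) ℝ).sum_repr (e (onb n _ l))]
  simp

theorem formNorm_eq_coeff {k : ℕ} (α : FormField n M k) (x : M) {p : M}
    (hp : p ∈ (chartAt (EuclideanSpace ℝ (Fin n)) x).source) :
    formNorm (α p) = √((k.factorial : ℝ)⁻¹ * ∑ I : Fin k → Fin n, ∑ J : Fin k → Fin n,
      (∏ a, (gram n x (chartAt (EuclideanSpace ℝ (Fin n)) x p))⁻¹ (I a) (J a)) *
        (coeff α x I p * coeff α x J p)) := by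
  obtain ⟨y, hy, rfl⟩ : ∃ y ∈ (chartAt (EuclideanSpace ℝ (Fin n)) x).target,
      (chartAt (EuclideanSpace ℝ (Fin n)) x).symm y = p :=
    ⟨_, (chartAt (EuclideanSpace ℝ (Fin n)) x).map_source hp,
      (chartAt (EuclideanSpace ℝ (Fin n)) x).left_inv hp⟩
  obtain ⟨C, hC⟩ := exists_onb_eq_sum x hy
  rw [formNorm, sum_sq_onb _ _ C hC]
  simp only [coeff, (chartAt (EuclideanSpace ℝ (Fin n)) x).right_inv hy]
  rfl

variable [MeasurableSpace M]

/-- `α` is measurable on `U`: all its coefficients in charts are measurable (up to null sets). -/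
def MeasurableFormOn {k : ℕ} (U : Set M) (α : FormField n M k) : Prop :=
  ∀ (x : M) (I : Fin k → Fin n), AEMeasurable (coeff α x I)
    ((vol n M).restrict (U ∩ (chartAt (EuclideanSpace ℝ (Fin n)) x).source))

variable [BorelSpace M] [SecondCountableTopology M]

theorem MeasurableFormOn.aemeasurable_formNorm {k : ℕ} {U : Opens M} {α : FormField n M k}
    (hα : MeasurableFormOn (U : Set M) α) :
    AEMeasurable (fun p => formNorm (α p)) ((vol n M).restrict (U : Set M)) := by
  have hloc : ∀ x : M, AEMeasurable (fun p => formNorm (α p)) ((vol n M).restrict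
      ((U : Set M) ∩ (chartAt (EuclideanSpace ℝ (Fin n)) x).source)) := by
    intro x
    have hm : MeasurableSet ((U : Set M) ∩ (chartAt (EuclideanSpace ℝ (Fin n)) x).source) :=
      (U.isOpen.inter (chartAt (EuclideanSpace ℝ (Fin n)) x).open_source).measurableSet
    have hG : ∀ i j, AEMeasurable
        (fun p => gram n x (chartAt (EuclideanSpace ℝ (Fin n)) x p) i j) ((vol n M).restrict
          ((U : Set M) ∩ (chartAt (EuclideanSpace ℝ (Fin n)) x).source)) := by
      intro i j
      refine ContinuousOn.aemeasurable ?_ hm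
      refine (continuousOn_gram x i j).comp
        ((chartAt (EuclideanSpace ℝ (Fin n)) x).continuousOn.mono inter_subset_right) ?_
      exact fun p hp => (chartAt (EuclideanSpace ℝ (Fin n)) x).map_source hp.2
    have hdet : ∀ A : M → Matrix (Fin n) (Fin n) ℝ, ∀ μ : Measure M,
        (∀ i j, AEMeasurable (fun p => A p i j) μ) → AEMeasurable (fun p => (A p).det) μ := by
      intro A μ hA
      simp only [Matrix.det_apply']
      refine Finset.aemeasurable_fun_sum _ fun σ _ => ?_
      refine AEMeasurable.const_mul ?_ _
      exact Finset.aemeasurable_fun_prod _ fun i _ => hA _ _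
    have hinv : ∀ i j, AEMeasurable
        (fun p => (gram n x (chartAt (EuclideanSpace ℝ (Fin n)) x p))⁻¹ i j)
          ((vol n M).restrict
            ((U : Set M) ∩ (chartAt (EuclideanSpace ℝ (Fin n)) x).source)) := by
      intro i j
      simp only [Matrix.inv_def, Ring.inverse_eq_inv', Matrix.smul_apply, smul_eq_mul,
        Matrix.adjugate_apply]
      refine AEMeasurable.mul (hdet _ _ hG).inv (hdet _ _ fun a b => ?_)
      by_cases hab : a = j
      · subst hab; simp
      · simpa [Matrix.updateRow_apply, hab] using hG a b
    have hF : AEMeasurable (fun p => √((k.factorial : ℝ)⁻¹ *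
        ∑ I : Fin k → Fin n, ∑ J : Fin k → Fin n,
          (∏ a, (gram n x (chartAt (EuclideanSpace ℝ (Fin n)) x p))⁻¹ (I a) (J a)) *
            (coeff α x I p * coeff α x J p))) ((vol n M).restrict
          ((U : Set M) ∩ (chartAt (EuclideanSpace ℝ (Fin n)) x).source)) := by
      refine AEMeasurable.sqrt (AEMeasurable.const_mul ?_ _)
      refine Finset.aemeasurable_fun_sum _ fun I _ => Finset.aemeasurable_fun_sum _ fun J _ => ?_
      refine AEMeasurable.mul ?_ ((hα x I).mul (hα x J))
      exact Finset.aemeasurable_fun_prod _ fun a _ => hinv _ _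
    refine hF.congr ?_
    filter_upwards [ae_restrict_mem hm] with p hp
    exact (formNorm_eq_coeff α x hp.2).symm
  obtain ⟨s, hs, hcov⟩ := countable_cover_nhds
    (f := fun x : M => (chartAt (EuclideanSpace ℝ (Fin n)) x).source)
    fun x => (chartAt (EuclideanSpace ℝ (Fin n)) x).open_source.mem_nhds
      (mem_chart_source (EuclideanSpace ℝ (Fin n)) x)
  have : Countable s := hs.to_subtype
  have hU : (U : Set M) =
      ⋃ x : s, (U : Set M) ∩ (chartAt (EuclideanSpace ℝ (Fin n)) (x : M)).source := by
    rw [← inter_iUnion, ← biUnion_eq_iUnion (t := fun x _ =>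
      (chartAt (EuclideanSpace ℝ (Fin n)) x).source), hcov, inter_univ]
  rw [hU, aemeasurable_iUnion_iff]
  exact fun x => hloc x

/-- The exponent `n / k`, which is `∞` for `k = 0`. -/
def confExp (n k : ℕ) : ℝ≥0∞ := if k = 0 then ⊤ else (n : ℝ≥0∞) / (k : ℝ≥0∞)

theorem one_le_confExp {n k : ℕ} (h : k ≤ n) : 1 ≤ confExp n k := by
  unfold confExp
  split_ifs with hk
  · exact le_top
  · rw [ENNReal.le_div_iff_mul_le (Or.inl (by exact_mod_cast hk)) (Or.inl (by simp))]
    simpa using h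

/-- The `L^{n/k}`-norm on `U` of a form of degree `k`. -/
def lNorm {k : ℕ} (U : Opens M) (α : FormField n M k) : ℝ≥0∞ :=
  eLpNorm (fun p => formNorm (α p)) (confExp n k) ((vol n M).restrict (U : Set M))

theorem lNorm_add_le {k : ℕ} {U : Opens M} {α β : FormField n M k}
    (hα : MeasurableFormOn (U : Set M) α) (hβ : MeasurableFormOn (U : Set M) β) :
    lNorm U (α + β) ≤ lNorm U α + lNorm U β := by
  rcases le_or_gt k n with hk | hk
  · refine le_trans (eLpNorm_mono_real (g := (fun p => formNorm (α p)) + fun p => formNorm (β p))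
      fun p => ?_) (eLpNorm_add_le hα.aemeasurable_formNorm.aestronglyMeasurable
        hβ.aemeasurable_formNorm.aestronglyMeasurable (one_le_confExp hk))
    rw [Real.norm_of_nonneg (formNorm_nonneg _)]
    exact formNorm_add_le _ _
  · simp [lNorm, formNorm_eq_zero_of_lt hk]

theorem lNorm_smul {k : ℕ} {U : Opens M} (c : ℝ) (α : FormField n M k) :
    lNorm U (c • α) = ‖c‖ₑ * lNorm U α := by
  unfold lNorm
  have : (fun p => formNorm ((c • α) p)) = |c| • fun p => formNorm (α p) := by
    ext p
    simp [formNorm_smul]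
  rw [this, eLpNorm_const_smul]
  simp

theorem coeff_add {k : ℕ} (α β : FormField n M k) (x : M) (I : Fin k → Fin n) :
    coeff (α + β) x I = coeff α x I + coeff β x I := rfl

theorem coeff_smul {k : ℕ} (c : ℝ) (α : FormField n M k) (x : M) (I : Fin k → Fin n) :
    coeff (c • α) x I = c • coeff α x I := rfl

/-- Measurable forms of degree `k` on `U` with `∫_U |α|^{n/k} < ∞` (essentially bounded ones if
`k = 0`). Only the values on `U` matter. -/
def lFormSubmodule (U : Opens M) (k : ℕ) : Submodule ℝ (FormField n M k) where
  carrier := {α | MeasurableFormOn (U : Set M) α ∧ lNorm U α < ⊤}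
  add_mem' := by
    rintro α β ⟨hα, hα'⟩ ⟨hβ, hβ'⟩
    refine ⟨fun x I => ?_, (lNorm_add_le hα hβ).trans_lt (ENNReal.add_lt_top.2 ⟨hα', hβ'⟩)⟩
    rw [coeff_add]
    exact (hα x I).add (hβ x I)
  zero_mem' := by
    refine ⟨fun x I => ?_, ?_⟩
    · have : coeff (0 : FormField n M k) x I = 0 := rfl
      rw [this]
      exact aemeasurable_const
    · simpa using (lNorm_smul (U := U) (0 : ℝ) (0 : FormField n M k)).trans_lt
        (by simp)
  smul_mem' := by
    rintro c α ⟨hα, hα'⟩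
    refine ⟨fun x I => ?_, ?_⟩
    · rw [coeff_smul]
      exact (hα x I).const_smul c
    · rw [lNorm_smul]
      exact ENNReal.mul_lt_top (by simp) hα'

variable (n) in
/-- The space `L^{n/k}(U, Λᵏ)`, with its seminorm. Two elements represent the same class of forms on
`U` if and only if they agree almost everywhere on `U`, i.e. are at distance zero. -/
def LForm (U : Opens M) (k : ℕ) : Type _ := lFormSubmodule (n := n) U k

namespace LForm

variable {U V : Opens M} {k : ℕ}

instance : AddCommGroup (LForm n U k) :=
  inferInstanceAs (AddCommGroup (lFormSubmodule (n := n) U k))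

instance : Module ℝ (LForm n U k) :=
  inferInstanceAs (Module ℝ (lFormSubmodule (n := n) U k))

/-- The underlying form. -/
def form (α : LForm n U k) : FormField n M k := α.1

/-- The element of `L^{n/k}(U, Λᵏ)` given by a form. -/
def mk (α : FormField n M k) (h : MeasurableFormOn (U : Set M) α) (h' : lNorm U α < ⊤) :
    LForm n U k := ⟨α, h, h'⟩

theorem form_mk (α : FormField n M k) (h : MeasurableFormOn (U : Set M) α) (h' : lNorm U α < ⊤) :
    (mk α h h').form = α := rfl

theorem measurable_form (α : LForm n U k) : MeasurableFormOn (U : Set M) α.form := α.2.1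

theorem lNorm_form_lt_top (α : LForm n U k) : lNorm U α.form < ⊤ := α.2.2

@[ext] theorem ext {α β : LForm n U k} (h : α.form = β.form) : α = β := Subtype.ext h

theorem form_add (α β : LForm n U k) : (α + β).form = α.form + β.form := rfl
theorem form_smul (c : ℝ) (α : LForm n U k) : (c • α).form = c • α.form := rfl
theorem form_zero : (0 : LForm n U k).form = 0 := rfl

instance : Norm (LForm n U k) := ⟨fun α => (lNorm U α.form).toReal⟩

theorem norm_def (α : LForm n U k) : ‖α‖ = (lNorm U α.form).toReal := rfl

theorem core : SeminormedSpace.Core ℝ (LForm n U k) where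
  norm_nonneg _ := ENNReal.toReal_nonneg
  norm_smul c α := by
    simp [norm_def, form_smul, lNorm_smul]
  norm_triangle α β := by
    have hα := α.lNorm_form_lt_top.ne
    have hβ := β.lNorm_form_lt_top.ne
    rw [norm_def, norm_def, norm_def, form_add, ← ENNReal.toReal_add hα hβ]
    exact ENNReal.toReal_mono (ENNReal.add_ne_top.2 ⟨hα, hβ⟩)
      (lNorm_add_le α.measurable_form β.measurable_form)

instance : SeminormedAddCommGroup (LForm n U k) := SeminormedAddCommGroup.ofCore core

instance : NormedSpace ℝ (LForm n U k) where
  norm_smul_le c α := (core.norm_smul c α).le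

theorem lNorm_mono (h : V ≤ U) (α : FormField n M k) : lNorm V α ≤ lNorm U α :=
  eLpNorm_mono_measure _ (Measure.restrict_mono h le_rfl)

theorem _root_.ConfDeRham.MeasurableFormOn.mono (h : V ≤ U) {α : FormField n M k}
    (hα : MeasurableFormOn (U : Set M) α) : MeasurableFormOn (V : Set M) α :=
  fun x I => (hα x I).mono_measure (Measure.restrict_mono (inter_subset_inter_left _ h) le_rfl)

/-- Restriction of forms from `U` to a smaller open set `V`. -/
def res (h : V ≤ U) (k : ℕ) : LForm n U k →ₗ[ℝ] LForm n V k where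
  toFun α := mk α.form (α.measurable_form.mono h) ((lNorm_mono h _).trans_lt α.lNorm_form_lt_top)
  map_add' α β := by
    apply ext
    rw [form_mk, form_add, form_add, form_mk, form_mk]
  map_smul' c α := by
    apply ext
    rw [RingHom.id_apply, form_mk, form_smul, form_smul, form_mk]

theorem form_res (h : V ≤ U) (α : LForm n U k) : (res h k α).form = α.form :=
  form_mk α.form (α.measurable_form.mono h) ((lNorm_mono h _).trans_lt α.lNorm_form_lt_top)

theorem norm_res_le (h : V ≤ U) (α : LForm n U k) : ‖res h k α‖ ≤ ‖α‖ := by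
  rw [norm_def, norm_def, form_res]
  exact ENNReal.toReal_mono α.lNorm_form_lt_top.ne (lNorm_mono h _)

theorem continuous_res (h : V ≤ U) : Continuous (res (n := n) h k) :=
  AddMonoidHomClass.continuous_of_bound (res (n := n) h k) 1 fun α => by
    simpa using norm_res_le h α

end LForm

/-! ### Weak exterior differential -/

/-- `τ` is the Riemannian volume form of an orientation of the open set `V`: it is continuous and
has norm one on `V`. Orientations of `V` correspond to such forms. -/
def IsOrientation (V : Opens M) (τ : FormField n M n) : Prop :=
  IsContinuousFormOn τ (V : Set M) ∧ ∀ x ∈ V, formNorm (τ x) = 1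

/-- The density of a form `β` of top degree with respect to the Riemannian volume, for the
orientation with volume form `τ`: since `τ(e) = 1` or `τ(e) = -1` according as the orthonormal basis
`e` is positively oriented or not, `β = (β(e) τ(e)) τ`. The integral `∫_V β` over the oriented open
set `V` is the integral of this density over `V`. -/
def topDensity (τ : FormField n M n) {j : ℕ} (h : j = n)
    (β : ∀ x : M, (TangentSpace (𝓡 n) x) [⋀^Fin j]→ₗ[ℝ] ℝ) (x : M) : ℝ :=
  β x (fun i => onb n x (Fin.cast h i)) * τ x (onb n x)

/-- `θ` is the weak exterior differential on `U` of `φ`: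
`∫_V θ ∧ ω = (-1)^{k+1} ∫_V φ ∧ dω` (where both integrals exist) for all oriented open sets `V ⊆ U`
and all smooth forms `ω` with compact support in `V` of the complementary degree. -/
def HasWeakD (U : Opens M) {k : ℕ} (φ : FormField n M k) (θ : FormField n M (k + 1)) : Prop :=
  ∀ V : Opens M, V ≤ U → ∀ τ : FormField n M n, IsOrientation V τ →
    ∀ (m : ℕ) (h : k + 1 + m = n) (ω' : FormField n M m), IsTestForm V ω' →
      IntegrableOn (topDensity τ h fun x => wedge (θ x) (ω' x)) (V : Set M) (vol n M) ∧
      IntegrableOn (topDensity τ (show k + (m + 1) = n by omega)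
        fun x => wedge (φ x) (extD ω' x)) (V : Set M) (vol n M) ∧
      ∫ x in (V : Set M), topDensity τ h (fun x => wedge (θ x) (ω' x)) x ∂(vol n M) =
        (-1) ^ (k + 1) * ∫ x in (V : Set M), topDensity τ (show k + (m + 1) = n by omega)
          (fun x => wedge (φ x) (extD ω' x)) x ∂(vol n M)

theorem topDensity_add (τ : FormField n M n) {j m : ℕ} (h : j + m = n) (φ φ' : FormField n M j)
    (η : FormField n M m) :
    topDensity τ h (fun x => wedge ((φ + φ') x) (η x)) =
      topDensity τ h (fun x => wedge (φ x) (η x)) +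
        topDensity τ h (fun x => wedge (φ' x) (η x)) := by
  ext x
  simp [topDensity, wedge_add_left, add_mul]

theorem topDensity_smul (τ : FormField n M n) {j m : ℕ} (h : j + m = n) (c : ℝ)
    (φ : FormField n M j) (η : FormField n M m) :
    topDensity τ h (fun x => wedge ((c • φ) x) (η x)) =
      c • topDensity τ h (fun x => wedge (φ x) (η x)) := by
  ext x
  simp [topDensity, wedge_smul_left, mul_assoc]

theorem topDensity_zero (τ : FormField n M n) {j m : ℕ} (h : j + m = n) (η : FormField n M m) :
    topDensity τ h (fun x => wedge ((0 : FormField n M j) x) (η x)) = 0 := by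
  ext x
  simp [topDensity, wedge_zero_left]

theorem HasWeakD.add {U : Opens M} {k : ℕ} {φ φ' : FormField n M k}
    {θ θ' : FormField n M (k + 1)} (h : HasWeakD U φ θ) (h' : HasWeakD U φ' θ') :
    HasWeakD U (φ + φ') (θ + θ') := by
  intro V hV τ hτ m hm η hη
  obtain ⟨h1, h2, h3⟩ := h V hV τ hτ m hm η hη
  obtain ⟨h1', h2', h3'⟩ := h' V hV τ hτ m hm η hη
  rw [topDensity_add, topDensity_add]
  refine ⟨h1.add h1', h2.add h2', ?_⟩
  simp only [Pi.add_apply]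
  rw [integral_add h1 h1', integral_add h2 h2', h3, h3']
  ring

theorem HasWeakD.smul {U : Opens M} {k : ℕ} (c : ℝ) {φ : FormField n M k}
    {θ : FormField n M (k + 1)} (h : HasWeakD U φ θ) : HasWeakD U (c • φ) (c • θ) := by
  intro V hV τ hτ m hm η hη
  obtain ⟨h1, h2, h3⟩ := h V hV τ hτ m hm η hη
  rw [topDensity_smul, topDensity_smul]
  refine ⟨h1.smul c, h2.smul c, ?_⟩
  simp only [Pi.smul_apply]
  rw [integral_smul, integral_smul, h3]
  simp only [smul_eq_mul]
  ring

theorem HasWeakD.zero (U : Opens M) (k : ℕ) :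
    HasWeakD U (0 : FormField n M k) (0 : FormField n M (k + 1)) := by
  intro V hV τ hτ m hm η hη
  rw [topDensity_zero, topDensity_zero]
  exact ⟨integrableOn_zero, integrableOn_zero, by simp⟩

theorem HasWeakD.mono {U V : Opens M} (hVU : V ≤ U) {k : ℕ} {φ : FormField n M k}
    {θ : FormField n M (k + 1)} (h : HasWeakD U φ θ) : HasWeakD V φ θ :=
  fun W hW => h W (hW.trans hVU)

/-! ### Conformal cohomology, reduced conformal cohomology and torsion -/

variable (n)

/-- Closed forms in `L^{n/k}(U, Λᵏ)`. -/
def closedForms (U : Opens M) (k : ℕ) : Submodule ℝ (LForm n U k) where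
  carrier := {α | HasWeakD U α.form 0}
  add_mem' {α β} hα hβ := by
    have := HasWeakD.add (show HasWeakD U α.form 0 from hα) (show HasWeakD U β.form 0 from hβ)
    rw [add_zero] at this
    exact this
  zero_mem' := HasWeakD.zero U k
  smul_mem' c α hα := by
    have := HasWeakD.smul c (show HasWeakD U α.form 0 from hα)
    rw [smul_zero] at this
    exact this

/-- Forms of degree `k` in `L^{n/k}` which are the weak exterior differential of a form of degree
`k - 1` in `L^{n/(k-1)}`. In degree `0` only the zero class, i.e. the functions which vanish almost
everywhere. -/
def exactForms (U : Opens M) : ∀ k : ℕ, Submodule ℝ (LForm n U k)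
  | 0 =>
    { carrier := {α | ‖α‖ = 0}
      add_mem' := fun {α β} hα hβ => by
        have h1 : ‖α‖ = 0 := hα
        have h2 : ‖β‖ = 0 := hβ
        have h3 := norm_add_le α β
        exact le_antisymm (by linarith) (norm_nonneg _)
      zero_mem' := norm_zero
      smul_mem' := fun c α hα => by
        have h1 : ‖α‖ = 0 := hα
        simp [norm_smul, h1] }
  | k + 1 =>
    { carrier := {α | ∃ β : LForm n U k, HasWeakD U β.form α.form}
      add_mem' := by
        rintro α α' ⟨β, h⟩ ⟨β', h'⟩
        exact ⟨β + β', h.add h'⟩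
      zero_mem' := ⟨0, HasWeakD.zero U k⟩
      smul_mem' := by
        rintro c α ⟨β, h⟩
        exact ⟨c • β, h.smul c⟩ }

/-- The closure of the space of exact forms in `L^{n/k}(U, Λᵏ)`. -/
def closureExactForms (U : Opens M) (k : ℕ) : Submodule ℝ (LForm n U k) :=
  (exactForms n U k).topologicalClosure

/-- The conformal cohomology of the Riemannian manifold `U`. -/
abbrev ConfCohomology (U : Opens M) (k : ℕ) : Type _ :=
  closedForms n U k ⧸ (exactForms n U k).submoduleOf (closedForms n U k)

/-- The reduced conformal cohomology of the Riemannian manifold `U`, with its quotient norm. -/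
abbrev RedConfCohomology (U : Opens M) (k : ℕ) : Type _ :=
  closedForms n U k ⧸ (closureExactForms n U k).submoduleOf (closedForms n U k)

/-- The torsion of the Riemannian manifold `U`. -/
abbrev ConfTorsion (U : Opens M) (k : ℕ) : Type _ :=
  closureExactForms n U k ⧸ (exactForms n U k).submoduleOf (closureExactForms n U k)

section Restriction

variable {U V : Opens M} (h : V ≤ U) (k : ℕ)

theorem mem_closedForms {α : LForm n U k} : α ∈ closedForms n U k ↔ HasWeakD U α.form 0 := Iff.rfl

theorem mem_exactForms_zero {α : LForm n U 0} : α ∈ exactForms n U 0 ↔ ‖α‖ = 0 := Iff.rfl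

theorem mem_exactForms_succ {α : LForm n U (k + 1)} :
    α ∈ exactForms n U (k + 1) ↔ ∃ β : LForm n U k, HasWeakD U β.form α.form := Iff.rfl

theorem res_mem_closedForms : ∀ α ∈ closedForms n U k, LForm.res h k α ∈ closedForms n V k := by
  intro α hα
  rw [mem_closedForms] at hα ⊢
  rw [LForm.form_res]
  exact hα.mono h

theorem res_mem_exactForms : ∀ α ∈ exactForms n U k, LForm.res h k α ∈ exactForms n V k := by
  intro α hα
  cases k with
  | zero =>
    rw [mem_exactForms_zero] at hα ⊢
    exact le_antisymm ((LForm.norm_res_le h α).trans (le_of_eq hα)) (norm_nonneg _)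
  | succ k =>
    rw [mem_exactForms_succ] at hα ⊢
    obtain ⟨β, hβ⟩ := hα
    refine ⟨LForm.res h k β, ?_⟩
    rw [LForm.form_res, LForm.form_res]
    exact hβ.mono h

theorem res_mem_closureExactForms :
    ∀ α ∈ closureExactForms n U k, LForm.res h k α ∈ closureExactForms n V k :=
  fun _ hα => map_mem_closure (LForm.continuous_res h) hα (res_mem_exactForms n h k)

/-- Restriction of forms, on conformal cohomology. -/
def resConfCohomology : ConfCohomology n U k →ₗ[ℝ] ConfCohomology n V k :=
  Submodule.mapQ _ _ ((LForm.res h k).restrict (res_mem_closedForms n h k))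
    fun α hα => res_mem_exactForms n h k α.1 hα

/-- Restriction of forms, on reduced conformal cohomology. -/
def resRedConfCohomology : RedConfCohomology n U k →ₗ[ℝ] RedConfCohomology n V k :=
  Submodule.mapQ _ _ ((LForm.res h k).restrict (res_mem_closedForms n h k))
    fun α hα => res_mem_closureExactForms n h k α.1 hα

/-- Restriction of forms, on torsion. -/
def resConfTorsion : ConfTorsion n U k →ₗ[ℝ] ConfTorsion n V k :=
  Submodule.mapQ _ _ ((LForm.res h k).restrict (res_mem_closureExactForms n h k))
    fun α hα => res_mem_exactForms n h k α.1 hα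

end Restriction

/-! ### Conformal capacity and polar sets -/

/-- The space `Ω_conf^k(U)` of forms in `L^{n/k}` with a weak exterior differential in
`L^{n/(k+1)}`, as the space of pairs `(α, dα)`; the topology is that of the graph norm. -/
def confForms (U : Opens M) (k : ℕ) : Set (LForm n U k × LForm n U (k + 1)) :=
  {p | HasWeakD U p.1.form p.2.form}

/-- The closure in `Ω_conf^0(U)` of the continuous functions with compact support in `U` which
belong to `Ω_conf^0(U)`. -/
def royden₀ (U : Opens M) : Set (LForm n U 0 × LForm n U 1) :=
  confForms n U 0 ∩ closure {p | p ∈ confForms n U 0 ∧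
    ∃ v : M → ℝ, Continuous v ∧ HasCompactSupport v ∧ tsupport v ⊆ (U : Set M) ∧
      p.1.form = ofFun v}

/-- Pairs `(u, du)` for `u` admissible for the condenser `(F, U)`: `u ≥ 0` almost everywhere on `U`
and `u ≥ 1` (almost everywhere) on a neighbourhood of `F`. -/
def admissible (F : Set M) (U : Opens M) : Set (LForm n U 0 × LForm n U 1) :=
  {p | p ∈ royden₀ n U ∧
    (∀ᵐ x ∂(vol n M).restrict (U : Set M), 0 ≤ p.1.form x 0) ∧
    ∃ W : Opens M, F ⊆ (W : Set M) ∧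
      ∀ᵐ x ∂(vol n M).restrict ((U : Set M) ∩ (W : Set M)), 1 ≤ p.1.form x 0}

/-- The conformal capacity of `F` in `U`, the infimum of `∫_U |du|^n` over the admissible `u`. -/
def confCap (F : Set M) (U : Opens M) : ℝ≥0∞ :=
  ⨅ p ∈ admissible n F U, ∫⁻ x in (U : Set M), ENNReal.ofReal (formNorm (p.2.form x) ^ n) ∂(vol n M)

/-- `S` is conformally polar. -/
def IsConformallyPolar (S : Set M) : Prop :=
  ∀ U₁ U₂ : Opens M, U₁ ≤ U₂ → IsCompact (closure (U₁ : Set M)) → IsCompact (closure (U₂ : Set M)) →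
    0 < (⨅ x ∈ U₁, ⨅ y ∉ U₂, Manifold.riemannianEDist (𝓡 n) x y) →
      confCap n (S ∩ (U₁ : Set M)) U₂ = 0

end Riemannian
end
end ConfDeRham

/-!
A closed conformally polar set `S` is a null set and is invisible to the weak exterior differential.
Granting these two facts, a form on `M \ S` in `L^{n/k}` is the same thing as a form on `M` in
`L^{n/k}`, with the same norm, and it is closed or exact on `M \ S` if and only if it is on `M`
(`res_compl_mem_closedForms_iff`, `res_compl_mem_exactForms_iff`). Restriction is thus an isometric
bijection which matches closed forms, exact forms and the closure of the exact forms, and it induces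
isomorphisms on the three quotients, isometric ones for the quotient norm.

The main point is removability (`HasWeakD.of_compl`). Let `θ = dφ` hold on `M \ S`, with `φ` in
`L^{n/k}` and `θ` in `L^{n/(k+1)}`, and let `β` be a test form, which a partition of unity makes
supported in a small compact set `K` in the domain of a chart. Vanishing capacity provides smooth
functions `ψ_j` with values in `[0, 1]`, equal to `1` near `S ∩ K`, such that `ψ_j` tends to `0` in
`L¹(K)` and almost everywhere, and `dψ_j` tends to `0` in `Lⁿ(K)`
(`IsConformallyPolar.exists_cutoff`). The form `(1 - ψ_j) β` is a test form on `M \ S`, and in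

`∫ θ ∧ (1 - ψ_j) β = (-1)^{k+1} ∫ φ ∧ ((1 - ψ_j) dβ - dψ_j ∧ β)`

the last term tends to zero by the Hölder inequality, because `k/n + 1/n = (k+1)/n ≤ 1`
(`tendsto_lintegral_mul_of_lintegral_pow_le`). The other terms converge by dominated convergence,
which gives the identity for `β`. The same limit gives the measurability of the integrands on `M`,
hence the existence of the integrals, as the pointwise bound `|θ ∧ β| ≤ C |θ| |β|` holds
(`abs_topDensity_wedge_le`).

The functions `ψ_j` come from admissible functions `u` with `∫ |du|ⁿ` small. Read in a chart, the
weak differential of `u` consists of weak partial derivatives (`exists_weak_partial_derivative`).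
Testing it against a coordinate function bounds the integral of `u` by the norm of `du`
(`exists_integral_le_of_mem_royden₀`), since `u` is a limit of functions with compact support.
Mollifying `u` and composing with a smooth step function which is `0` near `0` and `1` near `1`
yields the cut-off function (`exists_smooth_cutoff`). In particular `∫ ψ_j ≥ vol (S ∩ K)`, so `S` is
a null set (`IsConformallyPolar.vol_eq_zero`).
-/

namespace ConfDeRham

set_option linter.unusedSectionVars false

/-! ### Exterior products and pointwise norms -/

section Wedge

variable {V : Type*} [AddCommGroup V] [Module ℝ V] [TopologicalSpace V] {k m : ℕ}

/-- The exterior product as a normalised sum over all permutations. -/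
theorem factorial_mul_wedge (α : V [⋀^Fin k]→L[ℝ] ℝ) (β : V [⋀^Fin m]→L[ℝ] ℝ)
    (v : Fin (k + m) → V) :
    (k.factorial * m.factorial : ℝ) * wedge α β v =
      ∑ σ : Equiv.Perm (Fin k ⊕ Fin m), ((Equiv.Perm.sign σ : ℤ) : ℝ) *
        ((α fun a => v (finSumFinEquiv (σ (Sum.inl a)))) *
          β fun b => v (finSumFinEquiv (σ (Sum.inr b)))) := by
  have h := MultilinearMap.domCoprod_alternization_eq α.toAlternatingMap β.toAlternatingMap
  have h2 := congrArg (fun f => (LinearMap.mul' ℝ ℝ) (f fun i => v (finSumFinEquiv i))) h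
  simp only [Fintype.card_fin, AlternatingMap.smul_apply, MultilinearMap.alternatization_apply,
    map_sum, map_nsmul] at h2
  have h3 : wedge α β v = (LinearMap.mul' ℝ ℝ)
      ((α.toAlternatingMap.domCoprod β.toAlternatingMap) fun i => v (finSumFinEquiv i)) := rfl
  rw [h3]
  rw [nsmul_eq_mul] at h2
  push_cast at h2
  rw [← h2]
  refine Finset.sum_congr rfl fun σ _ => ?_
  rw [Units.smul_def, map_zsmul, zsmul_eq_mul]
  simp

theorem wedge_add_right (α : V [⋀^Fin k]→L[ℝ] ℝ) (β β' : V [⋀^Fin m]→L[ℝ] ℝ) :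
    wedge α (β + β') = wedge α β + wedge α β' := by
  ext v
  have hne : (k.factorial * m.factorial : ℝ) ≠ 0 := by positivity
  apply mul_left_cancel₀ hne
  rw [AlternatingMap.add_apply, mul_add, factorial_mul_wedge, factorial_mul_wedge,
    factorial_mul_wedge, ← Finset.sum_add_distrib]
  refine Finset.sum_congr rfl fun σ _ => ?_
  rw [ContinuousAlternatingMap.add_apply]; ring

theorem wedge_smul_right (c : ℝ) (α : V [⋀^Fin k]→L[ℝ] ℝ) (β : V [⋀^Fin m]→L[ℝ] ℝ) :
    wedge α (c • β) = c • wedge α β := by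
  ext v
  have hne : (k.factorial * m.factorial : ℝ) ≠ 0 := by positivity
  apply mul_left_cancel₀ hne
  rw [AlternatingMap.smul_apply, smul_eq_mul, mul_left_comm, factorial_mul_wedge,
    factorial_mul_wedge, Finset.mul_sum]
  refine Finset.sum_congr rfl fun σ _ => ?_
  rw [ContinuousAlternatingMap.smul_apply, smul_eq_mul]; ring

theorem wedge_zero_right (α : V [⋀^Fin k]→L[ℝ] ℝ) :
    wedge α (0 : V [⋀^Fin m]→L[ℝ] ℝ) = 0 := by
  simpa using wedge_smul_right (0 : ℝ) α (0 : V [⋀^Fin m]→L[ℝ] ℝ)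

end Wedge

section Norm

variable {n : ℕ} {M : Type*} [TopologicalSpace M] [ChartedSpace (EuclideanSpace ℝ (Fin n)) M]
  [RiemannianBundle (fun x : M => TangentSpace (𝓡 n) x)]

theorem abs_apply_onb_le {k : ℕ} {x : M} (α : (TangentSpace (𝓡 n) x) [⋀^Fin k]→L[ℝ] ℝ)
    (I : Fin k → Fin n) :
    |α fun a => onb n x (I a)| ≤ √(k.factorial : ℝ) * formNorm α := by
  rw [formNorm, ← Real.sqrt_mul (by positivity), ← mul_assoc,
    mul_inv_cancel₀ (by positivity), one_mul, ← Real.sqrt_sq_eq_abs]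
  exact Real.sqrt_le_sqrt (Finset.single_le_sum
    (f := fun I : Fin k → Fin n => (α fun a => onb n x (I a)) ^ 2)
    (fun _ _ => sq_nonneg _) (Finset.mem_univ I))

/-- In top degree the coefficients on an orthonormal basis vanish or agree up to sign, so that the
norm is the absolute value of one of them. -/
theorem formNorm_top {x : M} (α : (TangentSpace (𝓡 n) x) [⋀^Fin n]→L[ℝ] ℝ) :
    formNorm α = |α (onb n x)| := by
  have h : ∑ I : Fin n → Fin n, (α fun a => onb n x (I a)) ^ 2 =
      (n.factorial : ℝ) * (α (onb n x)) ^ 2 := by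
    have h1 : ∑ σ : Equiv.Perm (Fin n), (α fun a => onb n x (σ a)) ^ 2 =
        (n.factorial : ℝ) * (α (onb n x)) ^ 2 := by
      have : ∀ σ : Equiv.Perm (Fin n), (α fun a => onb n x (σ a)) ^ 2 = (α (onb n x)) ^ 2 := by
        intro σ
        have h2 : (α fun a => onb n x (σ a)) = Equiv.Perm.sign σ • α (onb n x) :=
          α.toAlternatingMap.map_perm (onb n x) σ
        rw [h2]
        rcases Int.units_eq_one_or (Equiv.Perm.sign σ) with h | h <;> simp [h]
      simp [this, Fintype.card_perm]
    rw [← h1]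
    symm
    refine Finset.sum_bij_ne_zero (fun σ _ _ => (σ : Fin n → Fin n)) (fun _ _ _ => Finset.mem_univ _)
      (fun σ _ _ τ _ _ h => DFunLike.coe_injective h) ?_ (fun _ _ _ => rfl)
    intro I _ hI
    have hinj : Function.Injective I := by
      by_contra hI'
      apply hI
      rw [α.map_eq_zero_of_not_injective, sq, mul_zero]
      intro h
      apply hI'
      intro a b hab
      exact h (by simp [hab])
    exact ⟨Equiv.ofBijective I (Finite.injective_iff_bijective.1 hinj), Finset.mem_univ _,
      by simpa using hI, rfl⟩
  rw [formNorm, h, ← mul_assoc, inv_mul_cancel₀ (by positivity), one_mul, Real.sqrt_sq_eq_abs]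

/-- The bound `|φ ∧ η| ≤ C |φ| |η|` at the points where `τ` is a volume form, with a crude constant. -/
theorem abs_topDensity_wedge_le {τ : FormField n M n} {k m : ℕ} (h : k + m = n)
    (φ : FormField n M k) (η : FormField n M m) {x : M} (hx : formNorm (τ x) = 1) :
    |topDensity τ h (fun x => wedge (φ x) (η x)) x| ≤
      ((k + m).factorial * (√(k.factorial : ℝ) * √(m.factorial : ℝ))) *
        (formNorm (φ x) * formNorm (η x)) := by
  rw [topDensity, abs_mul, ← formNorm_top, hx, mul_one]
  have h1 := factorial_mul_wedge (φ x) (η x) (fun i => onb n x (Fin.cast h i))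
  have hge : (1 : ℝ) ≤ (k.factorial * m.factorial : ℝ) := by
    exact_mod_cast Nat.succ_le_of_lt (by positivity)
  calc |wedge (φ x) (η x) fun i => onb n x (Fin.cast h i)|
      ≤ (k.factorial * m.factorial : ℝ) * |wedge (φ x) (η x) fun i => onb n x (Fin.cast h i)| :=
        le_mul_of_one_le_left (abs_nonneg _) hge
    _ = |(k.factorial * m.factorial : ℝ) * wedge (φ x) (η x) fun i => onb n x (Fin.cast h i)| := by
        rw [abs_mul, abs_of_nonneg (by positivity : (0 : ℝ) ≤ k.factorial * m.factorial)]
    _ ≤ ∑ σ : Equiv.Perm (Fin k ⊕ Fin m), (√(k.factorial : ℝ) * formNorm (φ x)) *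
          (√(m.factorial : ℝ) * formNorm (η x)) := by
        rw [h1]
        refine (Finset.abs_sum_le_sum_abs _ _).trans (Finset.sum_le_sum fun σ _ => ?_)
        have hs : |((Equiv.Perm.sign σ : ℤ) : ℝ)| = 1 := by
          rcases Int.units_eq_one_or (Equiv.Perm.sign σ) with h | h <;> simp [h]
        rw [abs_mul, hs, one_mul, abs_mul]
        exact mul_le_mul (abs_apply_onb_le _ _) (abs_apply_onb_le _ _) (abs_nonneg _)
          (mul_nonneg (Real.sqrt_nonneg _) (formNorm_nonneg _))
    _ = _ := by
        simp [Fintype.card_perm]; ring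

theorem topDensity_add_right (τ : FormField n M n) {j m : ℕ} (h : j + m = n) (φ : FormField n M j)
    (η η' : FormField n M m) :
    topDensity τ h (fun x => wedge (φ x) ((η + η') x)) =
      topDensity τ h (fun x => wedge (φ x) (η x)) +
        topDensity τ h (fun x => wedge (φ x) (η' x)) := by
  ext x
  simp [topDensity, wedge_add_right, add_mul]

theorem topDensity_fun_smul_right (τ : FormField n M n) {j m : ℕ} (h : j + m = n)
    (φ : FormField n M j) (f : M → ℝ) (η : FormField n M m) (x : M) :
    topDensity τ h (fun x => wedge (φ x) (f x • η x)) x =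
      f x * topDensity τ h (fun x => wedge (φ x) (η x)) x := by
  simp [topDensity, wedge_smul_right, mul_assoc]

end Norm

/-! ### Forms on Euclidean space and coordinate changes -/

section AltMaps

variable {n k : ℕ}

theorem apply_eq_sum_basisFun (A : (EuclideanSpace ℝ (Fin n)) [⋀^Fin k]→L[ℝ] ℝ)
    (w : Fin k → EuclideanSpace ℝ (Fin n)) :
    A w = ∑ J : Fin k → Fin n, (∏ a, w a (J a)) *
      A fun a => EuclideanSpace.basisFun (Fin n) ℝ (J a) := by
  have hw : w = fun a => ∑ i, w a i • EuclideanSpace.basisFun (Fin n) ℝ i := by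
    funext a
    simpa using ((EuclideanSpace.basisFun (Fin n) ℝ).sum_repr (w a)).symm
  conv_lhs => rw [hw]
  have := (A.toMultilinearMap).map_sum
    (fun (a : Fin k) (i : Fin n) => w a i • EuclideanSpace.basisFun (Fin n) ℝ i)
  refine this.trans (Finset.sum_congr rfl fun I _ => ?_)
  exact (A.toMultilinearMap).map_smul_univ _ _

variable (n k) in
/-- A continuous linear map recovering an alternating form from its coefficients on the standard
basis vectors. -/
theorem exists_clm_leftInverse_coeff :
    ∃ L : ((Fin k → Fin n) → ℝ) →L[ℝ] ((EuclideanSpace ℝ (Fin n)) [⋀^Fin k]→L[ℝ] ℝ),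
      ∀ A : (EuclideanSpace ℝ (Fin n)) [⋀^Fin k]→L[ℝ] ℝ,
        L (fun I => A fun a => EuclideanSpace.basisFun (Fin n) ℝ (I a)) = A := by
  let ev : ((EuclideanSpace ℝ (Fin n)) [⋀^Fin k]→L[ℝ] ℝ) →ₗ[ℝ] ((Fin k → Fin n) → ℝ) :=
    { toFun := fun A I => A fun a => EuclideanSpace.basisFun (Fin n) ℝ (I a)
      map_add' := fun _ _ => rfl
      map_smul' := fun _ _ => rfl }
  have hev : LinearMap.ker ev = ⊥ := by
    rw [LinearMap.ker_eq_bot']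
    intro A hA
    ext w
    rw [apply_eq_sum_basisFun]
    refine Finset.sum_eq_zero fun J _ => ?_
    have : (A fun a => EuclideanSpace.basisFun (Fin n) ℝ (J a)) = 0 := congrFun hA J
    rw [this, mul_zero]
  obtain ⟨g, hg⟩ := LinearMap.exists_leftInverse_of_injective ev hev
  exact ⟨LinearMap.toContinuousLinearMap g, fun A => DFunLike.congr_fun hg A⟩

theorem contDiffAt_form_of_coeff {F : EuclideanSpace ℝ (Fin n) →
      (EuclideanSpace ℝ (Fin n)) [⋀^Fin k]→L[ℝ] ℝ} {y : EuclideanSpace ℝ (Fin n)}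
    (h : ∀ I : Fin k → Fin n, ContDiffAt ℝ ∞
      (fun y => F y fun a => EuclideanSpace.basisFun (Fin n) ℝ (I a)) y) : ContDiffAt ℝ ∞ F y := by
  obtain ⟨L, hL⟩ := exists_clm_leftInverse_coeff n k
  have h1 : F = fun y => L (fun I => F y fun a => EuclideanSpace.basisFun (Fin n) ℝ (I a)) :=
    funext fun y => (hL _).symm
  rw [h1]
  exact L.contDiff.contDiffAt.comp y (contDiffAt_pi.2 h)

theorem contDiffAt_form_apply_const {F : EuclideanSpace ℝ (Fin n) →
      (EuclideanSpace ℝ (Fin n)) [⋀^Fin k]→L[ℝ] ℝ} {y : EuclideanSpace ℝ (Fin n)}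
    (h : ContDiffAt ℝ ∞ F y) (v : Fin k → EuclideanSpace ℝ (Fin n)) :
    ContDiffAt ℝ ∞ (fun y => F y v) y :=
  (ContinuousAlternatingMap.apply ℝ (EuclideanSpace ℝ (Fin n)) ℝ v).contDiff.contDiffAt.comp y h

/-- The pull-back of a smooth form by a smooth map is smooth: its coefficients are polynomials in those
of the form and in the partial derivatives of the map. -/
theorem contDiffAt_form_pullback {F : EuclideanSpace ℝ (Fin n) →
      (EuclideanSpace ℝ (Fin n)) [⋀^Fin k]→L[ℝ] ℝ}
    {T : EuclideanSpace ℝ (Fin n) → EuclideanSpace ℝ (Fin n)} {y : EuclideanSpace ℝ (Fin n)}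
    (hT : ContDiffAt ℝ ∞ T y) (hF : ContDiffAt ℝ ∞ F (T y)) :
    ContDiffAt ℝ ∞ (fun y => (F (T y)).compContinuousLinearMap (fderiv ℝ T y)) y := by
  refine contDiffAt_form_of_coeff fun I => ?_
  simp only [ContinuousAlternatingMap.compContinuousLinearMap_apply]
  have h1 : (fun y => (F (T y)) (fderiv ℝ T y ∘ fun a => EuclideanSpace.basisFun (Fin n) ℝ (I a)))
      = fun y => ∑ J : Fin k → Fin n,
        (∏ a, (fderiv ℝ T y (EuclideanSpace.basisFun (Fin n) ℝ (I a))) (J a)) *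
          F (T y) fun a => EuclideanSpace.basisFun (Fin n) ℝ (J a) :=
    funext fun y => apply_eq_sum_basisFun _ _
  rw [h1]
  refine ContDiffAt.sum fun J _ => ContDiffAt.mul (contDiffAt_prod fun a _ => ?_)
    ((contDiffAt_form_apply_const hF _).comp y hT)
  have h2 : ContDiffAt ℝ ∞ (fderiv ℝ T) y := hT.fderiv_right (by simp)
  have h3 : ContDiffAt ℝ ∞ (fun y => fderiv ℝ T y (EuclideanSpace.basisFun (Fin n) ℝ (I a))) y :=
    h2.clm_apply contDiffAt_const
  exact (EuclideanSpace.proj (J a) : EuclideanSpace ℝ (Fin n) →L[ℝ] ℝ).contDiff.contDiffAt.comp y h3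

end AltMaps

section Charts

variable {n : ℕ} {M : Type*} [TopologicalSpace M] [ChartedSpace (EuclideanSpace ℝ (Fin n)) M]

/-- The coordinate change from the chart around `x` to the chart around `x'`. -/
def coordChange (x x' : M) (y : EuclideanSpace ℝ (Fin n)) : EuclideanSpace ℝ (Fin n) :=
  chartAt (EuclideanSpace ℝ (Fin n)) x' ((chartAt (EuclideanSpace ℝ (Fin n)) x).symm y)

/-- The part of the target of the chart around `x` where the coordinate change to the chart around
`x'` is defined. -/
def overlap (x x' : M) : Set (EuclideanSpace ℝ (Fin n)) :=
  (chartAt (EuclideanSpace ℝ (Fin n)) x).target ∩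
    (chartAt (EuclideanSpace ℝ (Fin n)) x).symm ⁻¹' (chartAt (EuclideanSpace ℝ (Fin n)) x').source

theorem isOpen_overlap (x x' : M) : IsOpen (overlap (n := n) x x') :=
  (chartAt (EuclideanSpace ℝ (Fin n)) x).isOpen_inter_preimage_symm
    (chartAt (EuclideanSpace ℝ (Fin n)) x').open_source

theorem coordChange_mem {x x' : M} {y : EuclideanSpace ℝ (Fin n)} (hy : y ∈ overlap x x') :
    coordChange x x' y ∈ overlap x' x := by
  refine ⟨(chartAt (EuclideanSpace ℝ (Fin n)) x').map_source hy.2, ?_⟩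
  rw [mem_preimage, coordChange, (chartAt (EuclideanSpace ℝ (Fin n)) x').left_inv hy.2]
  exact (chartAt (EuclideanSpace ℝ (Fin n)) x).map_target hy.1

theorem coordChange_coordChange {x x' : M} {y : EuclideanSpace ℝ (Fin n)}
    (hy : y ∈ overlap x x') : coordChange x' x (coordChange x x' y) = y := by
  rw [coordChange, coordChange, (chartAt (EuclideanSpace ℝ (Fin n)) x').left_inv hy.2,
    (chartAt (EuclideanSpace ℝ (Fin n)) x).right_inv hy.1]

theorem symm_coordChange {x x' : M} {y : EuclideanSpace ℝ (Fin n)} (hy : y ∈ overlap x x') :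
    (chartAt (EuclideanSpace ℝ (Fin n)) x').symm (coordChange x x' y) =
      (chartAt (EuclideanSpace ℝ (Fin n)) x).symm y :=
  (chartAt (EuclideanSpace ℝ (Fin n)) x').left_inv hy.2

variable [IsManifold (𝓡 n) ∞ M]

theorem contDiffOn_coordChange (x x' : M) :
    ContDiffOn ℝ ∞ (coordChange (n := n) x x') (overlap x x') := by
  rw [← contMDiffOn_iff_contDiffOn]
  exact (contMDiffOn_chart (I := 𝓡 n) (n := ∞) (x := x')).comp
    ((contMDiffOn_chart_symm (I := 𝓡 n) (n := ∞) (x := x)).mono inter_subset_left)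
    fun y hy => hy.2

theorem contDiffAt_coordChange {x x' : M} {y : EuclideanSpace ℝ (Fin n)}
    (hy : y ∈ overlap x x') : ContDiffAt ℝ ∞ (coordChange x x') y :=
  (contDiffOn_coordChange x x').contDiffAt ((isOpen_overlap x x').mem_nhds hy)

theorem mdifferentiableAt_chart_symm {x : M} {y : EuclideanSpace ℝ (Fin n)}
    (hy : y ∈ (chartAt (EuclideanSpace ℝ (Fin n)) x).target) :
    MDifferentiableAt (𝓡 n) (𝓡 n) (chartAt (EuclideanSpace ℝ (Fin n)) x).symm y :=
  ((contMDiffOn_chart_symm (I := 𝓡 n) (n := ∞) (x := x)).contMDiffAt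
    ((chartAt (EuclideanSpace ℝ (Fin n)) x).open_target.mem_nhds hy)).mdifferentiableAt (by simp)

theorem dchartSymm_eq_comp {x x' : M} {y : EuclideanSpace ℝ (Fin n)} (hy : y ∈ overlap x x') :
    (dchartSymm n x y : EuclideanSpace ℝ (Fin n) →L[ℝ] EuclideanSpace ℝ (Fin n)) =
      ContinuousLinearMap.comp
        (dchartSymm n x' (coordChange x x' y) :
          EuclideanSpace ℝ (Fin n) →L[ℝ] EuclideanSpace ℝ (Fin n))
        (fderiv ℝ (coordChange x x') y) := by
  have h1 : (chartAt (EuclideanSpace ℝ (Fin n)) x).symm =ᶠ[𝓝 y]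
      (chartAt (EuclideanSpace ℝ (Fin n)) x').symm ∘ coordChange x x' := by
    filter_upwards [(isOpen_overlap x x').mem_nhds hy] with z hz
    exact (symm_coordChange hz).symm
  have hd : MDifferentiableAt (𝓡 n) (𝓡 n) (coordChange x x') y :=
    ((contDiffAt_coordChange hy).differentiableAt (by simp)).mdifferentiableAt
  have h2 := mfderiv_comp (I := 𝓡 n) (I' := 𝓡 n) (I'' := 𝓡 n) y
    (mdifferentiableAt_chart_symm (coordChange_mem hy).1) hd
  rw [mfderiv_eq_fderiv] at h2
  have h3 := h1.mfderiv_eq (I := 𝓡 n) (I' := 𝓡 n)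
  exact h3.trans h2

/-- The expressions of a form in two charts are related by the coordinate change. -/
theorem chartForm_eq_pullback {k : ℕ} (α : FormField n M k) {x x' : M}
    {y : EuclideanSpace ℝ (Fin n)} (hy : y ∈ overlap x x') :
    chartForm α x y = (chartForm α x' (coordChange x x' y)).compContinuousLinearMap
      (fderiv ℝ (coordChange x x') y) := by
  -- all tangent spaces are copies of the model space, so an equality of base points can be used
  have key : ∀ (p q : M) (_ : p = q)
      (L : EuclideanSpace ℝ (Fin n) →L[ℝ] EuclideanSpace ℝ (Fin n)),
      ((α p : EuclideanSpace ℝ (Fin n) [⋀^Fin k]→L[ℝ] ℝ).compContinuousLinearMap L) =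
      ((α q : EuclideanSpace ℝ (Fin n) [⋀^Fin k]→L[ℝ] ℝ).compContinuousLinearMap L) := by
    rintro p _ rfl L; rfl
  have h := dchartSymm_eq_comp hy
  have h2 := key _ _ (symm_coordChange hy).symm
    (dchartSymm n x y : EuclideanSpace ℝ (Fin n) →L[ℝ] EuclideanSpace ℝ (Fin n))
  refine h2.trans ?_
  rw [h]
  rfl

/-! ### Smooth forms and their exterior differential -/

theorem IsSmoothForm.contDiffAt {k : ℕ} {α : FormField n M k} (hα : IsSmoothForm α) {x : M}
    {y : EuclideanSpace ℝ (Fin n)} (hy : y ∈ (chartAt (EuclideanSpace ℝ (Fin n)) x).target) :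
    ContDiffAt ℝ ∞ (chartForm α x) y :=
  (hα x).contDiffAt ((chartAt (EuclideanSpace ℝ (Fin n)) x).open_target.mem_nhds hy)

theorem chartForm_eventuallyEq_pullback {k : ℕ} (α : FormField n M k) {x x' : M}
    {y : EuclideanSpace ℝ (Fin n)} (hy : y ∈ overlap x x') :
    chartForm α x =ᶠ[𝓝 y] fun y => (chartForm α x' (coordChange x x' y)).compContinuousLinearMap
      (fderiv ℝ (coordChange x x') y) := by
  filter_upwards [(isOpen_overlap x x').mem_nhds hy] with z hz
  exact chartForm_eq_pullback α hz

/-- Smoothness may be checked near each point in one chart. -/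
theorem isSmoothForm_of_forall_exists {k : ℕ} {α : FormField n M k}
    (h : ∀ p : M, ∃ x : M, p ∈ (chartAt (EuclideanSpace ℝ (Fin n)) x).source ∧
      ContDiffAt ℝ ∞ (chartForm α x) (chartAt (EuclideanSpace ℝ (Fin n)) x p)) :
    IsSmoothForm α := by
  intro x y hy
  obtain ⟨x', hx', hc⟩ := h ((chartAt (EuclideanSpace ℝ (Fin n)) x).symm y)
  have hy' : y ∈ overlap x x' := ⟨hy, hx'⟩
  refine ContDiffAt.contDiffWithinAt ?_
  exact (contDiffAt_form_pullback (contDiffAt_coordChange hy') hc).congr_of_eventuallyEq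
    (chartForm_eventuallyEq_pullback α hy')

theorem dchart_comp_dchartSymm {x : M} {y : EuclideanSpace ℝ (Fin n)}
    (hy : y ∈ (chartAt (EuclideanSpace ℝ (Fin n)) x).target) :
    (dchart n ((chartAt (EuclideanSpace ℝ (Fin n)) x).symm y)).comp (dchartSymm n x y) =
      fderiv ℝ (coordChange x ((chartAt (EuclideanSpace ℝ (Fin n)) x).symm y)) y := by
  have h1 : MDifferentiableAt (𝓡 n) (𝓡 n) (chartAt (EuclideanSpace ℝ (Fin n))
      ((chartAt (EuclideanSpace ℝ (Fin n)) x).symm y))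
      ((chartAt (EuclideanSpace ℝ (Fin n)) x).symm y) :=
    ((contMDiffOn_chart (I := 𝓡 n) (n := ∞)).contMDiffAt
      ((chartAt (EuclideanSpace ℝ (Fin n)) _).open_source.mem_nhds
        (mem_chart_source _ _))).mdifferentiableAt (by simp)
  have h2 := mfderiv_comp (I := 𝓡 n) (I' := 𝓡 n) (I'' := 𝓡 n) y h1
    (mdifferentiableAt_chart_symm hy)
  rw [← mfderiv_eq_fderiv]
  exact h2.symm

/-- The exterior differential is computed in every chart by the exterior differential on `ℝⁿ`. -/
theorem chartForm_extD {k : ℕ} {α : FormField n M k} (hα : IsSmoothForm α) {x : M}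
    {y : EuclideanSpace ℝ (Fin n)} (hy : y ∈ (chartAt (EuclideanSpace ℝ (Fin n)) x).target) :
    chartForm (extD α) x y = extDeriv (chartForm α x) y := by
  set p := (chartAt (EuclideanSpace ℝ (Fin n)) x).symm y with hp
  have hy' : y ∈ overlap x p := ⟨hy, mem_chart_source _ _⟩
  rw [(chartForm_eventuallyEq_pullback α hy').extDeriv_eq, extDeriv_pullback (r := ∞)
    ((hα.contDiffAt (coordChange_mem hy').1).differentiableAt (by simp))
    (contDiffAt_coordChange hy')
    (by
      rw [minSmoothness_of_isRCLikeNormedField]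
      exact WithTop.coe_le_coe.2 (le_top : (2 : ℕ∞) ≤ ⊤)),
    ← dchart_comp_dchartSymm hy]
  rfl

theorem IsSmoothForm.contDiffAt_extDeriv {k : ℕ} {α : FormField n M k} (hα : IsSmoothForm α)
    {x : M} {y : EuclideanSpace ℝ (Fin n)}
    (hy : y ∈ (chartAt (EuclideanSpace ℝ (Fin n)) x).target) :
    ContDiffAt ℝ ∞ (extDeriv (chartForm α x)) y := by
  have h := (hα.contDiffAt hy).fderiv_right (m := ∞) (by simp)
  exact (ContinuousAlternatingMap.alternatizeUncurryFinCLM ℝ (EuclideanSpace ℝ (Fin n))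
    ℝ).contDiff.contDiffAt.comp y h

theorem IsSmoothForm.extD {k : ℕ} {α : FormField n M k} (hα : IsSmoothForm α) :
    IsSmoothForm (extD α) := by
  intro x y hy
  refine ContDiffAt.contDiffWithinAt ((hα.contDiffAt_extDeriv hy).congr_of_eventuallyEq ?_)
  filter_upwards [(chartAt (EuclideanSpace ℝ (Fin n)) x).open_target.mem_nhds hy] with z hz
  exact chartForm_extD hα hz

theorem chartForm_add {k : ℕ} (α β : FormField n M k) (x : M) :
    chartForm (α + β) x = chartForm α x + chartForm β x := rfl

theorem IsSmoothForm.add {k : ℕ} {α β : FormField n M k} (hα : IsSmoothForm α)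
    (hβ : IsSmoothForm β) : IsSmoothForm (α + β) := fun x => (hα x).add (hβ x)

theorem extD_add {k : ℕ} {α β : FormField n M k} (hα : IsSmoothForm α) (hβ : IsSmoothForm β) :
    ConfDeRham.extD (α + β) = ConfDeRham.extD α + ConfDeRham.extD β := by
  funext x
  have hx := mem_chart_target (EuclideanSpace ℝ (Fin n)) x
  simp only [ConfDeRham.extD, Pi.add_apply]
  rw [chartForm_add, extDeriv_add ((hα.contDiffAt hx).differentiableAt (by simp))
    ((hβ.contDiffAt hx).differentiableAt (by simp))]
  rfl

/-- The exterior differential is local. -/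
theorem extD_congr {k : ℕ} {α β : FormField n M k} {p : M} (h : ∀ᶠ q in 𝓝 p, α q = β q) :
    extD α p = extD β p := by
  unfold extD
  congr 1
  apply Filter.EventuallyEq.extDeriv_eq
  have hc := (chartAt (EuclideanSpace ℝ (Fin n)) p).continuousAt_symm
    (mem_chart_target (EuclideanSpace ℝ (Fin n)) p)
  rw [ContinuousAt, (chartAt (EuclideanSpace ℝ (Fin n)) p).left_inv (mem_chart_source _ p)] at hc
  filter_upwards [hc.eventually h] with y hy
  rw [chartForm, chartForm, hy]

theorem extD_zero {k : ℕ} : extD (0 : FormField n M k) = 0 := by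
  funext x
  have : chartForm (0 : FormField n M k) x = 0 := rfl
  simp only [extD, this]
  have h2 : extDeriv (0 : EuclideanSpace ℝ (Fin n) →
      (EuclideanSpace ℝ (Fin n)) [⋀^Fin k]→L[ℝ] ℝ) (chartAt (EuclideanSpace ℝ (Fin n)) x x) = 0 := by
    ext v
    simp [extDeriv, ContinuousAlternatingMap.alternatizeUncurryFin_apply]
  rw [h2]
  rfl

/-- A form vanishing off a closed set has its exterior differential vanishing off this set. -/
theorem extD_eq_zero_of_notMem {k : ℕ} {α : FormField n M k} {K : Set M} (hK : IsClosed K)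
    (h : ∀ p ∉ K, α p = 0) {p : M} (hp : p ∉ K) : extD α p = 0 := by
  rw [extD_congr (β := 0), extD_zero]
  · rfl
  · filter_upwards [hK.isOpen_compl.mem_nhds hp] with q hq using h q hq

theorem chartForm_fun_smul {k : ℕ} (f : M → ℝ) (α : FormField n M k) (x : M) :
    chartForm (fun p => f p • α p) x =
      fun y => f ((chartAt (EuclideanSpace ℝ (Fin n)) x).symm y) • chartForm α x y := rfl

theorem contDiffAt_comp_chart_symm {f : M → ℝ} {p x : M}
    (hp : p ∈ (chartAt (EuclideanSpace ℝ (Fin n)) x).source)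
    (hf : ContMDiffAt (𝓡 n) 𝓘(ℝ, ℝ) ∞ f p) :
    ContDiffAt ℝ ∞ (fun y => f ((chartAt (EuclideanSpace ℝ (Fin n)) x).symm y))
      (chartAt (EuclideanSpace ℝ (Fin n)) x p) := by
  rw [← contMDiffAt_iff_contDiffAt]
  have h1 : ContMDiffAt (𝓡 n) (𝓡 n) ∞ (chartAt (EuclideanSpace ℝ (Fin n)) x).symm
      (chartAt (EuclideanSpace ℝ (Fin n)) x p) :=
    (contMDiffOn_chart_symm (I := 𝓡 n) (n := ∞) (x := x)).contMDiffAt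
      ((chartAt (EuclideanSpace ℝ (Fin n)) x).open_target.mem_nhds
        ((chartAt (EuclideanSpace ℝ (Fin n)) x).map_source hp))
  refine ContMDiffAt.comp _ (I' := 𝓡 n) ?_ h1
  rwa [(chartAt (EuclideanSpace ℝ (Fin n)) x).left_inv hp]

/-- The product of a smooth form supported in the closed set `K` with a function which is smooth
on a neighbourhood of `K`. -/
theorem IsSmoothForm.fun_smul {k : ℕ} {α : FormField n M k} (hα : IsSmoothForm α) {f : M → ℝ}
    {K : Set M} (hK : IsClosed K) (hαK : ∀ p ∉ K, α p = 0)
    (hf : ∀ p ∈ K, ContMDiffAt (𝓡 n) 𝓘(ℝ, ℝ) ∞ f p) : IsSmoothForm fun p => f p • α p := by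
  refine isSmoothForm_of_forall_exists fun p => ⟨p, mem_chart_source _ p, ?_⟩
  by_cases hp : p ∈ K
  · rw [chartForm_fun_smul]
    exact (contDiffAt_comp_chart_symm (mem_chart_source _ p) (hf p hp)).smul
      (hα.contDiffAt (mem_chart_target _ p))
  · have hc := (chartAt (EuclideanSpace ℝ (Fin n)) p).continuousAt_symm
      (mem_chart_target (EuclideanSpace ℝ (Fin n)) p)
    rw [ContinuousAt, (chartAt (EuclideanSpace ℝ (Fin n)) p).left_inv (mem_chart_source _ p)] at hc
    refine ContDiffAt.congr_of_eventuallyEq (f := fun _ => 0) contDiffAt_const ?_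
    filter_upwards [hc.eventually (hK.isOpen_compl.mem_nhds hp)] with y hy
    rw [chartForm_fun_smul]
    simp only [chartForm, hαK _ hy]
    rw [show (0 : (TangentSpace (𝓡 n) ((chartAt (EuclideanSpace ℝ (Fin n)) p).symm y))
      [⋀^Fin k]→L[ℝ] ℝ).compContinuousLinearMap (dchartSymm n p y) = 0 from rfl, smul_zero]

/-- The failure of `d` to commute with the multiplication by a function is controlled by the
differential of this function. -/
theorem abs_extDeriv_smul_sub_le {k : ℕ} {h : EuclideanSpace ℝ (Fin n) → ℝ}
    {F : EuclideanSpace ℝ (Fin n) → (EuclideanSpace ℝ (Fin n)) [⋀^Fin k]→L[ℝ] ℝ}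
    {y : EuclideanSpace ℝ (Fin n)} (hh : DifferentiableAt ℝ h y) (hF : DifferentiableAt ℝ F y)
    (I : Fin (k + 1) → Fin n) :
    |(extDeriv (fun y => h y • F y) y - h y • extDeriv F y)
        (fun a => EuclideanSpace.basisFun (Fin n) ℝ (I a))| ≤
      (k + 1) * (‖fderiv ℝ h y‖ * ‖F y‖) := by
  have h1 : extDeriv (fun y => h y • F y) y - h y • extDeriv F y =
      ContinuousAlternatingMap.alternatizeUncurryFin ((fderiv ℝ h y).smulRight (F y)) := by
    rw [extDeriv, fderiv_fun_smul hh hF,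
      ContinuousAlternatingMap.alternatizeUncurryFin_add,
      ContinuousAlternatingMap.alternatizeUncurryFin_smul, extDeriv, add_sub_cancel_left]
  rw [h1, ContinuousAlternatingMap.alternatizeUncurryFin_apply]
  refine (Finset.abs_sum_le_sum_abs _ _).trans ?_
  have h2 : ∀ i : Fin (k + 1), |(-1 : ℤ) ^ (i : ℕ) • (((fderiv ℝ h y).smulRight (F y))
      (EuclideanSpace.basisFun (Fin n) ℝ (I i))) (i.removeNth fun a =>
        EuclideanSpace.basisFun (Fin n) ℝ (I a))| ≤ ‖fderiv ℝ h y‖ * ‖F y‖ := by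
    intro i
    rw [zsmul_eq_mul, abs_mul]
    push_cast
    rw [abs_pow, abs_neg, abs_one, one_pow, one_mul]
    simp only [ContinuousLinearMap.smulRight_apply, ContinuousAlternatingMap.smul_apply,
      smul_eq_mul, abs_mul]
    gcongr
    · simpa using (fderiv ℝ h y).le_opNorm (EuclideanSpace.basisFun (Fin n) ℝ (I i))
    · simpa [Fin.removeNth] using (F y).le_opNorm (i.removeNth fun a =>
        EuclideanSpace.basisFun (Fin n) ℝ (I a))
  refine (Finset.sum_le_sum fun i _ => h2 i).trans ?_
  simp

end Charts

/-! ### The Riemannian volume in charts -/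

section Volume

variable {n : ℕ} {M : Type*} [TopologicalSpace M] [ChartedSpace (EuclideanSpace ℝ (Fin n)) M]
  [RiemannianBundle (fun x : M => TangentSpace (𝓡 n) x)]
  [IsManifold (𝓡 n) ∞ M] [IsContMDiffRiemannianBundle (𝓡 n) ∞ (EuclideanSpace ℝ (Fin n))
    (fun x : M => TangentSpace (𝓡 n) x)]

/-- The matrix expressing the orthonormal basis in the coordinate vectors, and its relation to the
metric. -/
theorem exists_onb_matrix (x : M) {y : EuclideanSpace ℝ (Fin n)}
    (hy : y ∈ (chartAt (EuclideanSpace ℝ (Fin n)) x).target) :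
    ∃ C : Matrix (Fin n) (Fin n) ℝ, (∀ l,
      onb n ((chartAt (EuclideanSpace ℝ (Fin n)) x).symm y) l =
        ∑ i, C l i • dchartSymm n x y (EuclideanSpace.basisFun (Fin n) ℝ i)) ∧
      C * gram n x y * C.transpose = 1 := by
  obtain ⟨C, hC⟩ := exists_onb_eq_sum x hy
  refine ⟨C, hC, ?_⟩
  ext l m
  have : inner ℝ (onb n ((chartAt (EuclideanSpace ℝ (Fin n)) x).symm y) l)
      (onb n ((chartAt (EuclideanSpace ℝ (Fin n)) x).symm y) m) =
        (1 : Matrix (Fin n) (Fin n) ℝ) l m := by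
    rw [OrthonormalBasis.inner_eq_ite, Matrix.one_apply]
  rw [← this, hC l, hC m, sum_inner]
  simp only [inner_sum, inner_smul_left, inner_smul_right, Matrix.mul_apply, gram,
    Matrix.of_apply, Matrix.transpose_apply, Finset.sum_mul]
  rw [Finset.sum_comm]
  refine Finset.sum_congr rfl fun i _ => Finset.sum_congr rfl fun j _ => ?_
  simp; ring

theorem det_gram_pos (x : M) {y : EuclideanSpace ℝ (Fin n)}
    (hy : y ∈ (chartAt (EuclideanSpace ℝ (Fin n)) x).target) : 0 < (gram n x y).det := by
  obtain ⟨C, -, hC⟩ := exists_onb_matrix x hy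
  have h := congrArg Matrix.det hC
  rw [Matrix.det_mul, Matrix.det_mul, Matrix.det_transpose, Matrix.det_one] at h
  have h2 : C.det ^ 2 * (gram n x y).det = 1 := by rw [← h]; ring
  by_contra hcon
  push Not at hcon
  nlinarith [sq_nonneg C.det, mul_nonneg (sq_nonneg C.det) (neg_nonneg.2 hcon)]

/-- The transformation rule `G = Jᵀ G' J` of the metric under a coordinate change of Jacobian `J`. -/
theorem gram_eq_coordChange {x x' : M} {y : EuclideanSpace ℝ (Fin n)} (hy : y ∈ overlap x x') :
    gram n x y = (LinearMap.toMatrix (EuclideanSpace.basisFun (Fin n) ℝ).toBasis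
        (EuclideanSpace.basisFun (Fin n) ℝ).toBasis
        (fderiv ℝ (coordChange x x') y : EuclideanSpace ℝ (Fin n) →ₗ[ℝ] _)).transpose *
      gram n x' (coordChange x x' y) *
      LinearMap.toMatrix (EuclideanSpace.basisFun (Fin n) ℝ).toBasis
        (EuclideanSpace.basisFun (Fin n) ℝ).toBasis
        (fderiv ℝ (coordChange x x') y : EuclideanSpace ℝ (Fin n) →ₗ[ℝ] _) := by
  have key : ∀ (p q : M) (_ : p = q) (v w : EuclideanSpace ℝ (Fin n)),
      @inner ℝ (TangentSpace (𝓡 n) p) _ v w = @inner ℝ (TangentSpace (𝓡 n) q) _ v w := by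
    rintro p _ rfl v w; rfl
  have h := dchartSymm_eq_comp hy
  have hv : ∀ i, (dchartSymm n x y (EuclideanSpace.basisFun (Fin n) ℝ i) :
      EuclideanSpace ℝ (Fin n)) = ∑ j, (LinearMap.toMatrix
        (EuclideanSpace.basisFun (Fin n) ℝ).toBasis (EuclideanSpace.basisFun (Fin n) ℝ).toBasis
        (fderiv ℝ (coordChange x x') y : EuclideanSpace ℝ (Fin n) →ₗ[ℝ] _)) j i •
        (dchartSymm n x' (coordChange x x' y) (EuclideanSpace.basisFun (Fin n) ℝ j) :
          EuclideanSpace ℝ (Fin n)) := by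
    intro i
    have h' : (dchartSymm n x y (EuclideanSpace.basisFun (Fin n) ℝ i) : EuclideanSpace ℝ (Fin n)) =
        dchartSymm n x' (coordChange x x' y) (fderiv ℝ (coordChange x x') y
          (EuclideanSpace.basisFun (Fin n) ℝ i)) := DFunLike.congr_fun h _
    refine h'.trans ?_
    conv_lhs => rw [← (EuclideanSpace.basisFun (Fin n) ℝ).sum_repr
      (fderiv ℝ (coordChange x x') y (EuclideanSpace.basisFun (Fin n) ℝ i))]
    rw [map_sum]
    refine Finset.sum_congr rfl fun j _ => ?_
    rw [map_smul]
    congr 1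
    simp [LinearMap.toMatrix_apply]
  ext i j
  rw [gram, Matrix.of_apply]
  refine (key _ _ (symm_coordChange hy).symm _ _).trans ?_
  rw [hv i, hv j]
  have : ∀ (q : M) (a b : Fin n → ℝ) (v : Fin n → TangentSpace (𝓡 n) q),
      inner ℝ (∑ k, a k • v k) (∑ l, b l • v l) = ∑ l, ∑ k, a k * inner ℝ (v k) (v l) * b l := by
    intro q a b v
    rw [sum_inner]
    simp only [inner_sum, inner_smul_left, inner_smul_right]
    rw [Finset.sum_comm]
    refine Finset.sum_congr rfl fun i _ => Finset.sum_congr rfl fun j _ => ?_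
    simp; ring
  refine (this _ _ _ (fun k => dchartSymm n x' (coordChange x x' y)
    (EuclideanSpace.basisFun (Fin n) ℝ k))).trans ?_
  simp only [Matrix.mul_apply, Matrix.transpose_apply, Finset.sum_mul]
  rfl

theorem det_gram_coordChange {x x' : M} {y : EuclideanSpace ℝ (Fin n)} (hy : y ∈ overlap x x') :
    (gram n x y).det = (fderiv ℝ (coordChange x x') y).det ^ 2 *
      (gram n x' (coordChange x x' y)).det := by
  rw [gram_eq_coordChange hy, Matrix.det_mul, Matrix.det_mul, Matrix.det_transpose,
    LinearMap.det_toMatrix, ContinuousLinearMap.det]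
  ring

theorem continuousOn_det_gram (x : M) :
    ContinuousOn (fun y => (gram n x y).det) (chartAt (EuclideanSpace ℝ (Fin n)) x).target := by
  simp only [Matrix.det_apply']
  exact continuousOn_finsetSum _ fun σ _ => continuousOn_const.mul
    (continuousOn_finsetProd _ fun i _ => continuousOn_gram x _ _)

/-- The density of the Riemannian volume with respect to the Lebesgue measure in a chart. -/
noncomputable def volDensity (n : ℕ) {M : Type*} [TopologicalSpace M]
    [ChartedSpace (EuclideanSpace ℝ (Fin n)) M]
    [RiemannianBundle (fun x : M => TangentSpace (𝓡 n) x)] (x : M)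
    (y : EuclideanSpace ℝ (Fin n)) : ℝ :=
  √(gram n x y).det

theorem volDensity_pos (x : M) {y : EuclideanSpace ℝ (Fin n)}
    (hy : y ∈ (chartAt (EuclideanSpace ℝ (Fin n)) x).target) : 0 < volDensity n x y :=
  Real.sqrt_pos.2 (det_gram_pos x hy)

theorem continuousOn_volDensity (x : M) :
    ContinuousOn (volDensity n x) (chartAt (EuclideanSpace ℝ (Fin n)) x).target :=
  (continuousOn_det_gram x).sqrt

variable [MeasurableSpace M] [BorelSpace M]

/-- The part of the target of the chart around `x` corresponding to `A`. -/
def chartSet (x : M) (A : Set M) : Set (EuclideanSpace ℝ (Fin n)) :=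
  (chartAt (EuclideanSpace ℝ (Fin n)) x).target ∩
    (chartAt (EuclideanSpace ℝ (Fin n)) x).symm ⁻¹' A

theorem measurableSet_chartSet (x : M) {A : Set M} (hA : MeasurableSet A) :
    MeasurableSet (chartSet (n := n) x A) := by
  have h1 : Measurable (fun y : (chartAt (EuclideanSpace ℝ (Fin n)) x).target =>
      (chartAt (EuclideanSpace ℝ (Fin n)) x).symm (y : EuclideanSpace ℝ (Fin n))) :=
    (chartAt (EuclideanSpace ℝ (Fin n)) x).continuousOn_symm.domRestrict.measurable
  have h2 := (chartAt (EuclideanSpace ℝ (Fin n)) x).open_target.measurableSet.subtype_image (h1 hA)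
  convert h2 using 1
  ext y
  simp [chartSet, and_comm]

theorem isOpen_chartSet (x : M) {A : Set M} (hA : IsOpen A) :
    IsOpen (chartSet (n := n) x A) :=
  (chartAt (EuclideanSpace ℝ (Fin n)) x).isOpen_inter_preimage_symm hA

theorem aemeasurable_chart_symm (x : M) {s : Set (EuclideanSpace ℝ (Fin n))}
    (hs : s ⊆ (chartAt (EuclideanSpace ℝ (Fin n)) x).target) (hm : MeasurableSet s) :
    AEMeasurable (chartAt (EuclideanSpace ℝ (Fin n)) x).symm
      ((volume : Measure (EuclideanSpace ℝ (Fin n))).restrict s) :=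
  ((chartAt (EuclideanSpace ℝ (Fin n)) x).continuousOn_symm.mono hs).aemeasurable hm

theorem chartVol_apply (x : M) {A : Set M} (hA : MeasurableSet A) :
    chartVol n x A = ∫⁻ y in chartSet x A, ENNReal.ofReal (volDensity n x y) := by
  rw [chartVol, Measure.map_apply_of_aemeasurable _ hA, withDensity_apply',
    Measure.restrict_restrict' (chartAt (EuclideanSpace ℝ (Fin n)) x).open_target.measurableSet,
    inter_comm]
  · rfl
  · exact (aemeasurable_chart_symm x subset_rfl
      (chartAt (EuclideanSpace ℝ (Fin n)) x).open_target.measurableSet).mono_ac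
        (withDensity_absolutelyContinuous _ _)

/-- Two charts assign the same volume to the sets contained in both domains. -/
theorem chartVol_apply_coordChange (x x' : M) {A : Set M} (hA : MeasurableSet A)
    (hx : A ⊆ (chartAt (EuclideanSpace ℝ (Fin n)) x).source)
    (hx' : A ⊆ (chartAt (EuclideanSpace ℝ (Fin n)) x').source) :
    chartVol n x A = chartVol n x' A := by
  have hsub : chartSet (n := n) x A ⊆ overlap x x' := fun y hy => ⟨hy.1, hx' hy.2⟩
  have himg : coordChange x x' '' chartSet x A = chartSet (n := n) x' A := by
    apply Subset.antisymm
    · rintro _ ⟨y, hy, rfl⟩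
      refine ⟨(coordChange_mem (hsub hy)).1, ?_⟩
      rw [mem_preimage, symm_coordChange (hsub hy)]
      exact hy.2
    · intro z hz
      have hz' : z ∈ overlap x' x := ⟨hz.1, hx hz.2⟩
      refine ⟨coordChange x' x z, ⟨(coordChange_mem hz').1, ?_⟩, coordChange_coordChange hz'⟩
      rw [mem_preimage, symm_coordChange hz']
      exact hz.2
  rw [chartVol_apply x hA, chartVol_apply x' hA, ← himg,
    lintegral_image_eq_lintegral_abs_det_fderiv_mul volume (measurableSet_chartSet x hA)
      (fun y hy => ((contDiffAt_coordChange (hsub hy)).differentiableAt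
        (by simp)).hasFDerivAt.hasFDerivWithinAt)
      (fun y hy z hz h => by
        rw [← coordChange_coordChange (hsub hy), h, coordChange_coordChange (hsub hz)])]
  refine setLIntegral_congr_fun (measurableSet_chartSet x hA) fun y hy => ?_
  rw [← ENNReal.ofReal_mul (abs_nonneg _)]
  congr 1
  rw [volDensity, det_gram_coordChange (hsub hy), Real.sqrt_mul (sq_nonneg _),
    Real.sqrt_sq_eq_abs, volDensity]

/-- On the domain of a chart, the Riemannian volume is the volume of this chart domain. -/
theorem vol_restrict_source (x : M) :
    (vol n M).restrict (chartAt (EuclideanSpace ℝ (Fin n)) x).source = chartVol n x := by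
  set s := (chartAt (EuclideanSpace ℝ (Fin n)) x).source with hs
  have hsm : MeasurableSet s := (chartAt (EuclideanSpace ℝ (Fin n)) x).open_source.measurableSet
  have hle : ∀ x' : M, chartVol n x' ≤ vol n M := fun x' => le_iSup (fun x' => chartVol n x') x'
  have hself : (chartVol n x).restrict s = chartVol n x := by
    apply Measure.restrict_eq_self_of_ae_mem
    rw [ae_iff, show {a | a ∉ s} = sᶜ from rfl, chartVol_apply x hsm.compl]
    have : chartSet (n := n) x sᶜ = ∅ := by
      rw [eq_empty_iff_forall_notMem]
      rintro y ⟨h1, h2⟩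
      exact h2 ((chartAt (EuclideanSpace ℝ (Fin n)) x).map_target h1)
    simp [this]
  apply le_antisymm
  · -- on `s` each `chartVol n x'` is at most `chartVol n x`, so their supremum is as well
    have h1 : vol n M ≤ chartVol n x + (vol n M).restrict sᶜ := by
      refine iSup_le fun x' => ?_
      rw [← Measure.restrict_add_restrict_compl (μ := chartVol n x') hsm]
      refine add_le_add ?_ (Measure.restrict_mono le_rfl (hle x'))
      refine Measure.le_iff.2 fun A hA => ?_
      rw [Measure.restrict_apply hA]
      have hsm' : MeasurableSet (chartAt (EuclideanSpace ℝ (Fin n)) x').source :=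
        (chartAt (EuclideanSpace ℝ (Fin n)) x').open_source.measurableSet
      have h2 : chartVol n x' (A ∩ s) = chartVol n x'
          (A ∩ s ∩ (chartAt (EuclideanSpace ℝ (Fin n)) x').source) := by
        rw [chartVol_apply x' (hA.inter hsm), chartVol_apply x' ((hA.inter hsm).inter hsm')]
        congr 2
        ext y
        constructor
        · rintro ⟨h1, h2⟩
          exact ⟨h1, h2, (chartAt (EuclideanSpace ℝ (Fin n)) x').map_target h1⟩
        · rintro ⟨h1, h2, h3⟩
          exact ⟨h1, h2⟩
      rw [h2, ← chartVol_apply_coordChange x x' ((hA.inter hsm).inter hsm')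
        (fun p hp => hp.1.2) inter_subset_right]
      exact measure_mono fun p hp => hp.1.1
    calc (vol n M).restrict s ≤ (chartVol n x + (vol n M).restrict sᶜ).restrict s :=
          Measure.restrict_mono le_rfl h1
      _ = chartVol n x := by
          rw [Measure.restrict_add, hself, Measure.restrict_restrict hsm, inter_compl_self,
            Measure.restrict_empty, add_zero]
  · rw [← hself]
    exact Measure.restrict_mono le_rfl (hle x)

variable {x : M} {U : Set M}

theorem vol_restrict_eq_map (hU : MeasurableSet U)
    (hUx : U ⊆ (chartAt (EuclideanSpace ℝ (Fin n)) x).source) :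
    (vol n M).restrict U = (((volume : Measure (EuclideanSpace ℝ (Fin n))).restrict
      (chartSet x U)).withDensity fun y => ENNReal.ofReal (volDensity n x y)).map
        (chartAt (EuclideanSpace ℝ (Fin n)) x).symm := by
  have hm := measurableSet_chartSet (n := n) x hU
  rw [← inter_eq_self_of_subset_left hUx, ← Measure.restrict_restrict hU, vol_restrict_source,
    inter_eq_self_of_subset_left hUx]
  ext A hA
  rw [Measure.restrict_apply hA, chartVol_apply x (hA.inter hU),
    Measure.map_apply_of_aemeasurable _ hA, withDensity_apply', Measure.restrict_restrict' hm]
  · congr 2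
    ext y
    simp only [chartSet, mem_inter_iff, mem_preimage]
    tauto
  · exact (aemeasurable_chart_symm x inter_subset_left hm).mono_ac
        (withDensity_absolutelyContinuous _ _)

theorem aemeasurable_volDensity (hU : MeasurableSet U) :
    AEMeasurable (fun y => ENNReal.ofReal (volDensity n x y))
      ((volume : Measure (EuclideanSpace ℝ (Fin n))).restrict (chartSet x U)) :=
  (((continuousOn_volDensity x).mono inter_subset_left).aemeasurable
    (measurableSet_chartSet x hU)).ennreal_ofReal

theorem absolutelyContinuous_withDensity_volDensity (hU : MeasurableSet U) :
    (volume : Measure (EuclideanSpace ℝ (Fin n))).restrict (chartSet x U) ≪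
      ((volume : Measure (EuclideanSpace ℝ (Fin n))).restrict
      (chartSet x U)).withDensity fun y => ENNReal.ofReal (volDensity n x y) := by
  refine withDensity_absolutelyContinuous' (aemeasurable_volDensity hU) ?_
  filter_upwards [ae_restrict_mem (measurableSet_chartSet x hU)] with y hy
  simpa using volDensity_pos x hy.1

/-- As the density of the volume is positive, null sets are null sets for the Lebesgue measure in the
chart. -/
theorem ae_chartSet_of_ae (hU : MeasurableSet U)
    (hUx : U ⊆ (chartAt (EuclideanSpace ℝ (Fin n)) x).source) {P : M → Prop}
    (h : ∀ᵐ p ∂(vol n M).restrict U, P p) :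
    ∀ᵐ y ∂(volume : Measure (EuclideanSpace ℝ (Fin n))).restrict (chartSet x U),
      P ((chartAt (EuclideanSpace ℝ (Fin n)) x).symm y) := by
  rw [vol_restrict_eq_map hU hUx] at h
  have h1 := ae_of_ae_map ((aemeasurable_chart_symm x inter_subset_left
    (measurableSet_chartSet x hU)).mono_ac (withDensity_absolutelyContinuous _ _)) h
  exact (absolutelyContinuous_withDensity_volDensity hU).ae_le h1

theorem aemeasurable_comp_chart_symm {Y : Type*} [MeasurableSpace Y] (hU : MeasurableSet U)
    (hUx : U ⊆ (chartAt (EuclideanSpace ℝ (Fin n)) x).source) {f : M → Y}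
    (hf : AEMeasurable f ((vol n M).restrict U)) :
    AEMeasurable (fun y => f ((chartAt (EuclideanSpace ℝ (Fin n)) x).symm y))
      ((volume : Measure (EuclideanSpace ℝ (Fin n))).restrict (chartSet x U)) := by
  rw [vol_restrict_eq_map hU hUx] at hf
  exact (hf.comp_aemeasurable ((aemeasurable_chart_symm x inter_subset_left
    (measurableSet_chartSet x hU)).mono_ac (withDensity_absolutelyContinuous _ _))).mono_ac
      (absolutelyContinuous_withDensity_volDensity hU)

theorem lintegral_vol_eq (hU : MeasurableSet U)
    (hUx : U ⊆ (chartAt (EuclideanSpace ℝ (Fin n)) x).source) {f : M → ℝ≥0∞}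
    (hf : AEMeasurable f ((vol n M).restrict U)) :
    ∫⁻ p in U, f p ∂(vol n M) = ∫⁻ y in chartSet x U, ENNReal.ofReal (volDensity n x y) *
      f ((chartAt (EuclideanSpace ℝ (Fin n)) x).symm y) := by
  have h1 := aemeasurable_comp_chart_symm hU hUx hf
  rw [vol_restrict_eq_map hU hUx] at hf ⊢
  rw [lintegral_map' hf ((aemeasurable_chart_symm x inter_subset_left
    (measurableSet_chartSet x hU)).mono_ac (withDensity_absolutelyContinuous _ _)),
    lintegral_withDensity_eq_lintegral_mul₀ (aemeasurable_volDensity hU) h1]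
  rfl

theorem integral_vol_eq (hU : MeasurableSet U)
    (hUx : U ⊆ (chartAt (EuclideanSpace ℝ (Fin n)) x).source) {f : M → ℝ}
    (hf : AEStronglyMeasurable f ((vol n M).restrict U)) :
    ∫ p in U, f p ∂(vol n M) = ∫ y in chartSet x U, volDensity n x y *
      f ((chartAt (EuclideanSpace ℝ (Fin n)) x).symm y) := by
  have hs : AEMeasurable (chartAt (EuclideanSpace ℝ (Fin n)) x).symm
      (((volume : Measure (EuclideanSpace ℝ (Fin n))).restrict
      (chartSet x U)).withDensity fun y => ENNReal.ofReal (volDensity n x y)) :=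
    (aemeasurable_chart_symm x inter_subset_left
      (measurableSet_chartSet x hU)).mono_ac (withDensity_absolutelyContinuous _ _)
  rw [vol_restrict_eq_map hU hUx] at hf ⊢
  rw [integral_map hs hf,
    integral_withDensity_eq_integral_toReal_smul₀ (aemeasurable_volDensity hU)
      (ae_of_all _ fun _ => ENNReal.ofReal_lt_top)]
  refine integral_congr_ae (ae_of_all _ fun y => ?_)
  simp only [smul_eq_mul]
  rw [ENNReal.toReal_ofReal (show 0 ≤ volDensity n x y from Real.sqrt_nonneg _)]

/-- On a compact subset of the chart domain, the Riemannian volume is comparable with the Lebesgue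
measure. -/
theorem exists_volDensity_bounds {K : Set M} (hK : IsCompact K)
    (hKx : K ⊆ (chartAt (EuclideanSpace ℝ (Fin n)) x).source) :
    ∃ c C : ℝ, 0 < c ∧ 0 < C ∧ ∀ y ∈ chartSet x K, c ≤ volDensity n x y ∧ volDensity n x y ≤ C := by
  have hKc : IsCompact ((chartAt (EuclideanSpace ℝ (Fin n)) x) '' K) :=
    hK.image_of_continuousOn ((chartAt (EuclideanSpace ℝ (Fin n)) x).continuousOn.mono hKx)
  have hsub : (chartAt (EuclideanSpace ℝ (Fin n)) x) '' K ⊆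
      (chartAt (EuclideanSpace ℝ (Fin n)) x).target := by
    rintro _ ⟨p, hp, rfl⟩
    exact (chartAt (EuclideanSpace ℝ (Fin n)) x).map_source (hKx hp)
  have hmem : ∀ y ∈ chartSet (n := n) x K, y ∈ (chartAt (EuclideanSpace ℝ (Fin n)) x) '' K :=
    fun y hy => ⟨_, hy.2, (chartAt (EuclideanSpace ℝ (Fin n)) x).right_inv hy.1⟩
  have hcont := (continuousOn_volDensity (n := n) x).mono hsub
  rcases ((chartAt (EuclideanSpace ℝ (Fin n)) x) '' K).eq_empty_or_nonempty with he | hne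
  · exact ⟨1, 1, one_pos, one_pos, fun y hy => by simpa [he] using hmem y hy⟩
  · obtain ⟨a, ha, hamin⟩ := hKc.exists_isMinOn hne hcont
    obtain ⟨b, hb, hbmax⟩ := hKc.exists_isMaxOn hne hcont
    exact ⟨volDensity n x a, volDensity n x b, volDensity_pos x (hsub ha),
      volDensity_pos x (hsub hb), fun y hy => ⟨hamin (hmem y hy), hbmax (hmem y hy)⟩⟩

end Volume

/-! ### Mollification and truncation on Euclidean space -/

section Mollify

/-- A smooth function on the line which is `0` on `(-∞, 1/4]` and `1` on `[3/4, ∞)`. -/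
noncomputable def smoothStep (t : ℝ) : ℝ := Real.smoothTransition (2 * t - 1 / 2)

theorem contDiff_smoothStep : ContDiff ℝ ∞ smoothStep :=
  Real.smoothTransition.contDiff.comp (by fun_prop)

theorem smoothStep_nonneg (t : ℝ) : 0 ≤ smoothStep t := Real.smoothTransition.nonneg _

theorem smoothStep_le_one (t : ℝ) : smoothStep t ≤ 1 := Real.smoothTransition.le_one _

theorem smoothStep_eq_one {t : ℝ} (ht : 3 / 4 ≤ t) : smoothStep t = 1 :=
  Real.smoothTransition.one_of_one_le (by linarith)

theorem smoothStep_eq_zero {t : ℝ} (ht : t ≤ 1 / 4) : smoothStep t = 0 :=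
  Real.smoothTransition.zero_of_nonpos (by linarith)

/-- As the step vanishes up to `1/4`, it is dominated by a linear function; this bounds the integral of
a truncated function by the integral of the function. -/
theorem smoothStep_le_four_mul {t : ℝ} (ht : 0 ≤ t) : smoothStep t ≤ 4 * t := by
  rcases le_or_gt t (1 / 4) with h | h
  · rw [smoothStep_eq_zero h]; linarith
  · linarith [smoothStep_le_one t]

theorem exists_bound_deriv_smoothStep : ∃ D : ℝ, 0 ≤ D ∧ ∀ t, |deriv smoothStep t| ≤ D := by
  have hc : Continuous (deriv smoothStep) := contDiff_smoothStep.continuous_deriv (by simp)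
  obtain ⟨D, hD⟩ := (isCompact_Icc (a := (0 : ℝ)) (b := 1)).exists_bound_of_continuousOn
    hc.continuousOn
  refine ⟨max D 0, le_max_right _ _, fun t => ?_⟩
  by_cases ht : t ∈ Icc (0 : ℝ) 1
  · exact (hD t ht).trans (le_max_left _ _)
  · have hz : deriv smoothStep t = 0 := by
      rw [mem_Icc, not_and_or, not_le, not_le] at ht
      rcases ht with ht | ht
      · have : smoothStep =ᶠ[𝓝 t] fun _ => 0 := by
          filter_upwards [Iio_mem_nhds ht] with s hs
          exact smoothStep_eq_zero (by have : s < 0 := hs; linarith)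
        rw [this.deriv_eq, deriv_const]
      · have : smoothStep =ᶠ[𝓝 t] fun _ => 1 := by
          filter_upwards [Ioi_mem_nhds ht] with s hs
          exact smoothStep_eq_one (by have : 1 < s := hs; linarith)
        rw [this.deriv_eq, deriv_const]
    rw [hz, abs_zero]
    exact le_max_right _ _

variable {n : ℕ}

local notation "𝔼" => EuclideanSpace ℝ (Fin n)

/-- Averaging does not increase `Lᵖ`-norms. -/
theorem lintegral_enorm_convolution_pow_le {p : ℕ} (hp : 1 ≤ p) {G r : 𝔼 → ℝ}
    (hG : AEStronglyMeasurable G volume) (hr : Continuous r) (hr0 : ∀ x, 0 ≤ r x)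
    (hr1 : ∫⁻ x, ENNReal.ofReal (r x) = 1) :
    ∫⁻ x, ‖∫ t, G t * r (x - t)‖ₑ ^ p ≤ ∫⁻ t, ‖G t‖ₑ ^ p := by
  have hrm : Measurable fun x => ENNReal.ofReal (r x) := by fun_prop
  -- Jensen's inequality for the probability measure `r (x - t) dt`; then integrate over `x`
  have hpt : ∀ x, ‖∫ t, G t * r (x - t)‖ₑ ^ p ≤
      ∫⁻ t, ENNReal.ofReal (r (x - t)) * ‖G t‖ₑ ^ p := by
    intro x
    have hwm : Measurable fun t => ENNReal.ofReal (r (x - t)) := by fun_prop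
    set ν : Measure 𝔼 := volume.withDensity fun t => ENNReal.ofReal (r (x - t)) with hν
    have hprob : IsProbabilityMeasure ν := by
      constructor
      rw [hν, withDensity_apply _ MeasurableSet.univ, Measure.restrict_univ,
        lintegral_sub_left_eq_self (fun t => ENNReal.ofReal (r t)), hr1]
    have hGν : AEStronglyMeasurable G ν := hG.mono_ac (withDensity_absolutelyContinuous _ _)
    have h1 : ‖∫ t, G t * r (x - t)‖ₑ ≤ ∫⁻ t, ‖G t‖ₑ ∂ν := by
      refine (enorm_integral_le_lintegral_enorm _).trans ?_
      rw [hν, lintegral_withDensity_eq_lintegral_mul₀ hwm.aemeasurable hG.enorm]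
      refine lintegral_mono fun t => ?_
      rw [enorm_mul, mul_comm, Pi.mul_apply, Real.enorm_of_nonneg (hr0 _)]
    have h2 := eLpNorm_le_eLpNorm_of_exponent_le (μ := ν) (p := 1) (q := p)
      (by exact_mod_cast hp) hGν
    rw [eLpNorm_one_eq_lintegral_enorm, eLpNorm_eq_lintegral_rpow_enorm_toReal
      (by exact_mod_cast (by omega : p ≠ 0)) (by simp)] at h2
    have hp0 : (p : ℝ) ≠ 0 := by exact_mod_cast (by omega : p ≠ 0)
    calc ‖∫ t, G t * r (x - t)‖ₑ ^ p ≤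
        ((∫⁻ t, ‖G t‖ₑ ^ ((p : ℝ≥0∞).toReal) ∂ν) ^ (1 / (p : ℝ≥0∞).toReal)) ^ p :=
          pow_le_pow_left' (h1.trans h2) p
      _ = ∫⁻ t, ‖G t‖ₑ ^ p ∂ν := by
          rw [← ENNReal.rpow_natCast, ← ENNReal.rpow_mul]
          simp [hp0]
      _ = ∫⁻ t, ENNReal.ofReal (r (x - t)) * ‖G t‖ₑ ^ p := by
          rw [hν, lintegral_withDensity_eq_lintegral_mul₀ hwm.aemeasurable (hG.enorm.pow_const _)]
          rfl
  refine (lintegral_mono hpt).trans ?_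
  rw [lintegral_lintegral_swap]
  · refine lintegral_mono fun t => ?_
    have hm2 : Measurable fun x => ENNReal.ofReal (r (x - t)) := by fun_prop
    rw [lintegral_mul_const _ hm2,
      lintegral_sub_right_eq_self (fun x => ENNReal.ofReal (r x)), hr1, one_mul]
  · refine AEMeasurable.mul (f := fun z : 𝔼 × 𝔼 => ENNReal.ofReal (r (z.1 - z.2)))
      (g := fun z : 𝔼 × 𝔼 => ‖G z.2‖ₑ ^ p) ?_ ?_
    · have : Measurable fun z : 𝔼 × 𝔼 => ENNReal.ofReal (r (z.1 - z.2)) := by fun_prop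
      exact this.aemeasurable
    · have := (hG.enorm.pow_const p).comp_quasiMeasurePreserving
        (Measure.quasiMeasurePreserving_snd (μ := (volume : Measure 𝔼)) (ν := (volume : Measure 𝔼)))
      exact this

theorem norm_clm_le_sum (ℓ : 𝔼 →L[ℝ] ℝ) :
    ‖ℓ‖ ≤ ∑ i, |ℓ (EuclideanSpace.basisFun (Fin n) ℝ i)| := by
  refine ℓ.opNorm_le_bound (Finset.sum_nonneg fun _ _ => abs_nonneg _) fun v => ?_
  have hv : ℓ v = ∑ i, v i * ℓ (EuclideanSpace.basisFun (Fin n) ℝ i) := by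
    conv_lhs => rw [← (EuclideanSpace.basisFun (Fin n) ℝ).sum_repr v]
    simp
  rw [hv, Finset.sum_mul]
  refine (Finset.abs_sum_le_sum_abs _ _).trans (Finset.sum_le_sum fun i _ => ?_)
  rw [abs_mul, mul_comm]
  exact mul_le_mul_of_nonneg_left (PiLp.norm_apply_le v i) (abs_nonneg _)

/-- A nonnegative function `f` with weak partial derivatives `g i` on `Ω`, which is at least `1` on a
neighbourhood `W` of `K'`, produces by mollification and composition with a smooth step function a
smooth function equal to `1` near `K'`, with controlled `L¹`-norm and `Lⁿ`-norm of the gradient. -/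
theorem exists_smooth_cutoff (hn : 1 ≤ n) : ∃ C : ℝ≥0∞, C ≠ ⊤ ∧
    ∀ (Ω W K K' : Set 𝔼) (f : 𝔼 → ℝ) (g : Fin n → 𝔼 → ℝ),
      IsOpen Ω → IsOpen W → IsCompact K → K ⊆ Ω → IsCompact K' → K' ⊆ Ω ∩ W →
      IntegrableOn f Ω → (∀ i, IntegrableOn (g i) Ω) →
      (∀ ψ : 𝔼 → ℝ, ContDiff ℝ ∞ ψ → HasCompactSupport ψ → tsupport ψ ⊆ Ω → ∀ i,
        ∫ y in Ω, f y * fderiv ℝ ψ y (EuclideanSpace.basisFun (Fin n) ℝ i) =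
          -∫ y in Ω, g i y * ψ y) →
      (∀ᵐ y ∂volume.restrict Ω, 0 ≤ f y) → (∀ᵐ y ∂volume.restrict (Ω ∩ W), 1 ≤ f y) →
      ∃ ψ : 𝔼 → ℝ, ContDiff ℝ ∞ ψ ∧ (∀ y, 0 ≤ ψ y ∧ ψ y ≤ 1) ∧
        (∃ N : Set 𝔼, IsOpen N ∧ K' ⊆ N ∧ ∀ y ∈ N, ψ y = 1) ∧
        ∫⁻ y in K, ‖ψ y‖ₑ ≤ 4 * ∫⁻ y in Ω, ‖f y‖ₑ ∧
        ∫⁻ y in K, ‖fderiv ℝ ψ y‖ₑ ^ n ≤ C * ∑ i, ∫⁻ y in Ω, ‖g i y‖ₑ ^ n := by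
  obtain ⟨D, hD0, hD⟩ := exists_bound_deriv_smoothStep
  -- `Dⁿ` comes from the derivative of the step, `nⁿ⁻¹` from `(∑ aᵢ)ⁿ ≤ nⁿ⁻¹ ∑ aᵢⁿ`
  refine ⟨ENNReal.ofReal D ^ n * (n : ℝ≥0∞) ^ ((n : ℝ) - 1), ?_, ?_⟩
  · refine ENNReal.mul_ne_top (ENNReal.pow_ne_top ENNReal.ofReal_ne_top)
      (ENNReal.rpow_ne_top_of_nonneg ?_ (by simp))
    have : (1 : ℝ) ≤ n := by exact_mod_cast hn
    linarith
  intro Ω W K K' f g hΩ hW hK hKΩ hK' hK'W hf hg hweak hf0 hf1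
  obtain ⟨δ₁, hδ₁, hKδ⟩ := hK.exists_cthickening_subset_open hΩ hKΩ
  obtain ⟨δ₂, hδ₂, hK'δ⟩ := hK'.exists_cthickening_subset_open (hΩ.inter hW) hK'W
  -- balls of radius `ε` around points of `K` stay in `Ω`, those around points at distance less than
  -- `δ₂ / 2` from `K'` stay in `Ω ∩ W`
  set ε := min δ₁ (δ₂ / 2) with hε
  have hε0 : 0 < ε := lt_min hδ₁ (by positivity)
  let φ : ContDiffBump (0 : 𝔼) := ⟨ε / 2, ε, by positivity, by linarith⟩
  set r : 𝔼 → ℝ := φ.normed volume with hr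
  have hrsm : ContDiff ℝ ∞ r := φ.contDiff_normed
  have hr0 : ∀ x, 0 ≤ r x := fun x => φ.nonneg_normed x
  have hrc : HasCompactSupport r := φ.hasCompactSupport_normed
  have hrts : tsupport r = Metric.closedBall 0 ε := φ.tsupport_normed_eq
  have hrint : ∫ x, r x = 1 := φ.integral_normed
  have hrI : Integrable r := φ.integrable_normed
  have hr1 : ∫⁻ x, ENNReal.ofReal (r x) = 1 := by
    rw [← ofReal_integral_eq_lintegral_ofReal hrI (ae_of_all _ hr0), hrint, ENNReal.ofReal_one]
  have hrz : ∀ x t, t ∉ Metric.closedBall x ε → r (x - t) = 0 := by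
    intro x t ht
    apply image_eq_zero_of_notMem_tsupport
    rw [hrts]
    simpa [dist_comm, dist_eq_norm] using ht
  set F : 𝔼 → ℝ := Ω.indicator f with hF
  have hFI : Integrable F := hf.integrable_indicator hΩ.measurableSet
  have hGI : ∀ i, Integrable (Ω.indicator (g i)) := fun i =>
    (hg i).integrable_indicator hΩ.measurableSet
  have hF0 : ∀ᵐ y, 0 ≤ F y := by
    rw [ae_restrict_iff' hΩ.measurableSet] at hf0
    filter_upwards [hf0] with y hy
    by_cases h : y ∈ Ω
    · simpa [hF, h] using hy h
    · simp [hF, h]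
  set fε : 𝔼 → ℝ := MeasureTheory.convolution F r (ContinuousLinearMap.mul ℝ ℝ) volume with hfε
  have hfεdef : ∀ x, fε x = ∫ t, F t * r (x - t) := fun x => rfl
  have hfεsm : ContDiff ℝ ∞ fε :=
    hrc.contDiff_convolution_right _ hFI.locallyIntegrable hrsm
  have hfε0 : ∀ x, 0 ≤ fε x := by
    intro x
    rw [hfεdef]
    refine integral_nonneg_of_ae ?_
    filter_upwards [hF0] with t ht
    exact mul_nonneg ht (hr0 _)
  -- on `K` the partial derivatives of the mollified function are the mollified weak derivatives
  have hder : ∀ x ∈ K, ∀ i, fderiv ℝ fε x (EuclideanSpace.basisFun (Fin n) ℝ i) =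
      ∫ t, Ω.indicator (g i) t * r (x - t) := by
    intro x hx i
    have hball : Metric.closedBall x ε ⊆ Ω :=
      ((Metric.closedBall_subset_closedBall (min_le_left _ _)).trans
        (Metric.closedBall_subset_cthickening hx δ₁)).trans hKδ
    have h1 := (hrc.hasFDerivAt_convolution_right (ContinuousLinearMap.mul ℝ ℝ)
      hFI.locallyIntegrable (hrsm.of_le (by simp)) x).fderiv
    rw [h1, convolution_precompR_apply _ hFI.locallyIntegrable (hrc.fderiv ℝ)
      (hrsm.continuous_fderiv (by simp))]
    set ψ : 𝔼 → ℝ := fun t => r (x - t) with hψ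
    have hψsm : ContDiff ℝ ∞ ψ := hrsm.comp (by fun_prop)
    have hψs : tsupport ψ ⊆ Metric.closedBall x ε := by
      refine closure_minimal (fun t ht => ?_) Metric.isClosed_closedBall
      by_contra hcon
      exact ht (hrz x t hcon)
    have hψc : HasCompactSupport ψ :=
      (isCompact_closedBall x ε).of_isClosed_subset (isClosed_tsupport _) hψs
    have hw := hweak ψ hψsm hψc (hψs.trans hball) i
    have hψd : ∀ t, fderiv ℝ ψ t (EuclideanSpace.basisFun (Fin n) ℝ i) =
        -(fderiv ℝ r (x - t) (EuclideanSpace.basisFun (Fin n) ℝ i)) := by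
      intro t
      have h2 : HasFDerivAt (fun t : 𝔼 => x - t) (-ContinuousLinearMap.id ℝ 𝔼) t :=
        (hasFDerivAt_id t).const_sub x
      have h3 := ((hrsm.differentiable (by simp)) (x - t)).hasFDerivAt.comp t h2
      rw [show ψ = r ∘ fun t => x - t from rfl, h3.fderiv]
      simp
    have e1 : ∫ t, Ω.indicator (g i) t * r (x - t) = ∫ y in Ω, g i y * ψ y := by
      rw [← integral_indicator hΩ.measurableSet]
      congr 1; ext t
      by_cases ht : t ∈ Ω <;> simp [ht, hψ]
    have e2 : (MeasureTheory.convolution F (fun a => (fderiv ℝ r a)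
        (EuclideanSpace.basisFun (Fin n) ℝ i)) (ContinuousLinearMap.mul ℝ ℝ) volume) x =
        -∫ y in Ω, f y * fderiv ℝ ψ y (EuclideanSpace.basisFun (Fin n) ℝ i) := by
      rw [← integral_neg, ← integral_indicator hΩ.measurableSet, MeasureTheory.convolution]
      congr 1; ext t
      by_cases ht : t ∈ Ω
      · rw [indicator_of_mem ht, hψd, hF, indicator_of_mem ht]
        simp
      · simp [ht, hF]
    rw [e1, e2, hw, neg_neg]
  refine ⟨fun x => smoothStep (fε x), contDiff_smoothStep.comp hfεsm,
    fun y => ⟨smoothStep_nonneg _, smoothStep_le_one _⟩, ?_, ?_, ?_⟩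
  · refine ⟨Metric.thickening (δ₂ / 2) K', Metric.isOpen_thickening,
      Metric.self_subset_thickening (by positivity) _, fun x hx => ?_⟩
    obtain ⟨z, hz, hxz⟩ := Metric.mem_thickening_iff.1 hx
    have hball : Metric.closedBall x ε ⊆ Ω ∩ W := by
      refine Subset.trans ?_ ((Metric.closedBall_subset_cthickening hz δ₂).trans hK'δ)
      refine Metric.closedBall_subset_closedBall' ?_
      have : ε ≤ δ₂ / 2 := min_le_right _ _
      linarith
    apply smoothStep_eq_one
    -- `fε x` is an average of values of `f` on `Ω ∩ W`
    have h1 : (1 : ℝ) ≤ fε x := by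
      have hx1 : ∫ t, r (x - t) = 1 := by
        rw [integral_sub_left_eq_self r volume x, hrint]
      rw [hfεdef, ← hx1]
      have hcont : Continuous fun t => r (x - t) := hrsm.continuous.comp (by fun_prop)
      have hcs : HasCompactSupport fun t => r (x - t) :=
        HasCompactSupport.of_support_subset_isCompact (isCompact_closedBall x ε) fun t ht => by
          by_contra hcon
          exact ht (hrz x t hcon)
      refine integral_mono_ae (hcont.integrable_of_hasCompactSupport hcs) ?_ ?_
      · obtain ⟨B, hB⟩ := hcs.exists_bound_of_continuous hcont
        exact hFI.mul_bdd (c := B) hcont.aestronglyMeasurable (ae_of_all _ hB)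
      · rw [ae_restrict_iff' (hΩ.inter hW).measurableSet] at hf1
        filter_upwards [hf1] with t ht
        by_cases htb : t ∈ Metric.closedBall x ε
        · have h3 := ht (hball htb)
          have h4 : F t = f t := indicator_of_mem (hball htb).1 f
          simp only [h4]
          exact le_mul_of_one_le_left (hr0 _) h3
        · simp [hrz x t htb]
    linarith
  · have hle := lintegral_enorm_convolution_pow_le (p := 1) le_rfl hFI.aestronglyMeasurable
      hrsm.continuous hr0 hr1
    simp only [pow_one] at hle
    calc ∫⁻ y in K, ‖smoothStep (fε y)‖ₑ ≤ ∫⁻ y, ‖smoothStep (fε y)‖ₑ :=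
          setLIntegral_le_lintegral _ _
      _ ≤ ∫⁻ y, 4 * ‖fε y‖ₑ := by
          refine lintegral_mono fun y => ?_
          rw [Real.enorm_of_nonneg (smoothStep_nonneg _), Real.enorm_of_nonneg (hfε0 _)]
          refine (ENNReal.ofReal_le_ofReal (smoothStep_le_four_mul (hfε0 y))).trans ?_
          rw [ENNReal.ofReal_mul (by norm_num)]
          simp
      _ = 4 * ∫⁻ y, ‖fε y‖ₑ := lintegral_const_mul' _ _ (by simp)
      _ ≤ 4 * ∫⁻ y in Ω, ‖f y‖ₑ := by
          refine mul_le_mul_right (hle.trans (le_of_eq ?_)) _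
          rw [← lintegral_indicator hΩ.measurableSet]
          congr 1; ext t
          by_cases ht : t ∈ Ω <;> simp [ht, hF]
  · have hpt : ∀ x ∈ K, ‖fderiv ℝ (fun x => smoothStep (fε x)) x‖ₑ ^ n ≤
        ENNReal.ofReal D ^ n * (n : ℝ≥0∞) ^ ((n : ℝ) - 1) *
          ∑ i, ‖∫ t, Ω.indicator (g i) t * r (x - t)‖ₑ ^ n := by
      intro x hx
      have h1 : fderiv ℝ (fun x => smoothStep (fε x)) x =
          deriv smoothStep (fε x) • fderiv ℝ fε x :=
        (((contDiff_smoothStep.differentiable (by simp)) (fε x)).hasDerivAt.comp_hasFDerivAt x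
          ((hfεsm.differentiable (by simp)) x).hasFDerivAt).fderiv
      have h2 : ‖fderiv ℝ fε x‖ₑ ≤ ∑ i, ‖∫ t, Ω.indicator (g i) t * r (x - t)‖ₑ := by
        have := norm_clm_le_sum (fderiv ℝ fε x)
        simp only [hder x hx] at this
        rw [← ofReal_norm]
        refine (ENNReal.ofReal_le_ofReal this).trans (le_of_eq ?_)
        rw [ENNReal.ofReal_sum_of_nonneg fun _ _ => abs_nonneg _]
        refine Finset.sum_congr rfl fun i _ => ?_
        rw [← Real.norm_eq_abs, ofReal_norm]
      have h3 : ‖deriv smoothStep (fε x)‖ₑ ≤ ENNReal.ofReal D := by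
        rw [← ofReal_norm]
        exact ENNReal.ofReal_le_ofReal (hD _)
      have h4 := ENNReal.rpow_sum_le_const_mul_sum_rpow Finset.univ
        (fun i => ‖∫ t, Ω.indicator (g i) t * r (x - t)‖ₑ) (p := n) (by exact_mod_cast hn)
      simp only [ENNReal.rpow_natCast, Finset.card_univ, Fintype.card_fin] at h4
      rw [h1, enorm_smul, mul_pow, mul_assoc]
      gcongr
      exact (pow_le_pow_left' h2 n).trans h4
    calc ∫⁻ x in K, ‖fderiv ℝ (fun x => smoothStep (fε x)) x‖ₑ ^ n
        ≤ ∫⁻ x in K, ENNReal.ofReal D ^ n * (n : ℝ≥0∞) ^ ((n : ℝ) - 1) *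
          ∑ i, ‖∫ t, Ω.indicator (g i) t * r (x - t)‖ₑ ^ n :=
          setLIntegral_mono' hK.measurableSet hpt
      _ ≤ ∫⁻ x, ENNReal.ofReal D ^ n * (n : ℝ≥0∞) ^ ((n : ℝ) - 1) *
          ∑ i, ‖∫ t, Ω.indicator (g i) t * r (x - t)‖ₑ ^ n := setLIntegral_le_lintegral _ _
      _ = ENNReal.ofReal D ^ n * (n : ℝ≥0∞) ^ ((n : ℝ) - 1) *
          ∑ i, ∫⁻ x, ‖∫ t, Ω.indicator (g i) t * r (x - t)‖ₑ ^ n := by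
          have hm : ∀ i, Measurable fun x => ‖∫ t, Ω.indicator (g i) t * r (x - t)‖ₑ ^ n := by
            intro i
            have hc : Continuous (MeasureTheory.convolution (Ω.indicator (g i)) r
                (ContinuousLinearMap.mul ℝ ℝ) volume) :=
              (hrc.contDiff_convolution_right (ContinuousLinearMap.mul ℝ ℝ)
                (hGI i).locallyIntegrable hrsm).continuous
            exact (hc.measurable.enorm.pow_const n)
          rw [lintegral_const_mul _ (Finset.measurable_fun_sum _ fun i _ => hm i),
            lintegral_finsetSum _ fun i _ => hm i]
      _ ≤ _ := by
          refine mul_le_mul_right (Finset.sum_le_sum fun i _ => ?_) _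
          refine (lintegral_enorm_convolution_pow_le hn (hGI i).aestronglyMeasurable
            hrsm.continuous hr0 hr1).trans (le_of_eq ?_)
          rw [← lintegral_indicator hΩ.measurableSet]
          congr 1; ext t
          by_cases ht : t ∈ Ω <;> simp [ht, show n ≠ 0 by omega]

end Mollify

/-! ### Forms of top degree and the contractions of the determinant -/

section TopForms

/-- Change of basis for alternating maps of top degree. -/
theorem map_sum_smul_eq_det_mul {V : Type*} [AddCommGroup V] [Module ℝ V] {n j : ℕ} (h : j = n)
    (f : V [⋀^Fin j]→ₗ[ℝ] ℝ) (v w : Fin n → V) (C : Matrix (Fin n) (Fin n) ℝ)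
    (hC : ∀ l, v l = ∑ i, C l i • w i) :
    f (fun a => v (Fin.cast h a)) = C.det * f fun a => w (Fin.cast h a) := by
  subst h
  set g := f.compLinearMap (Fintype.linearCombination ℝ w) with hg
  have h1 := AlternatingMap.eq_smul_basis_det (Pi.basisFun ℝ (Fin j)) g
  have h2 : g (fun l => C l) = f v := by
    rw [hg, AlternatingMap.compLinearMap_apply]
    congr 1
    funext l
    rw [hC l]
    rfl
  have h3 : g (Pi.basisFun ℝ (Fin j)) = f w := by
    rw [hg, AlternatingMap.compLinearMap_apply]
    congr 1
    funext l
    simp [Fintype.linearCombination_apply, Pi.single_apply]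
  have h4 := DFunLike.congr_fun h1 (fun l => C l)
  rw [h2, h3, AlternatingMap.smul_apply, Pi.basisFun_det_apply] at h4
  rw [smul_eq_mul, mul_comm] at h4
  exact h4

variable {V W : Type*} [AddCommGroup V] [Module ℝ V] [TopologicalSpace V]
  [AddCommGroup W] [Module ℝ W] [TopologicalSpace W] {k m : ℕ}

theorem wedge_compContinuousLinearMap (L : W →L[ℝ] V) (α : V [⋀^Fin k]→L[ℝ] ℝ)
    (β : V [⋀^Fin m]→L[ℝ] ℝ) (v : Fin (k + m) → W) :
    wedge (α.compContinuousLinearMap L) (β.compContinuousLinearMap L) v =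
      wedge α β fun i => L (v i) := by
  have hne : (k.factorial * m.factorial : ℝ) ≠ 0 := by positivity
  apply mul_left_cancel₀ hne
  rw [factorial_mul_wedge, factorial_mul_wedge]
  rfl

/-- The exterior product with a form of degree zero. -/
theorem wedge_degree_zero (c : V [⋀^Fin 0]→L[ℝ] ℝ) (β : V [⋀^Fin m]→L[ℝ] ℝ)
    (v : Fin (0 + m) → V) :
    wedge c β v = c 0 * β fun b => v (Fin.natAdd 0 b) := by
  have hne : ((0 : ℕ).factorial * m.factorial : ℝ) ≠ 0 := by positivity
  apply mul_left_cancel₀ hne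
  rw [factorial_mul_wedge]
  have h : ∀ σ : Equiv.Perm (Fin 0 ⊕ Fin m), ((Equiv.Perm.sign σ : ℤ) : ℝ) *
        ((c fun a => v (finSumFinEquiv (σ (Sum.inl a)))) *
          β fun b => v (finSumFinEquiv (σ (Sum.inr b)))) =
        c 0 * β fun b => v (Fin.natAdd 0 b) := by
    intro σ
    have hc : (c fun a => v (finSumFinEquiv (σ (Sum.inl a)))) = c 0 :=
      congrArg c (Subsingleton.elim _ _)
    have h1 := (β.toAlternatingMap.domDomCongr (Equiv.emptySum (Fin 0) (Fin m)).symm).map_perm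
      (fun i => v (finSumFinEquiv i)) σ
    have h2 : (β fun b => v (finSumFinEquiv (σ (Sum.inr b)))) =
        Equiv.Perm.sign σ • β fun b => v (Fin.natAdd 0 b) := h1
    rw [hc, h2]
    rcases Int.units_eq_one_or (Equiv.Perm.sign σ) with h | h <;> simp [h]
  rw [Finset.sum_congr rfl fun σ _ => h σ]
  simp [Fintype.card_perm]

end TopForms

section Coordinates

variable (n : ℕ)

/-- The determinant, as a continuous form of top degree on `ℝⁿ`. -/
noncomputable def detForm : (EuclideanSpace ℝ (Fin n)) [⋀^Fin n]→L[ℝ] ℝ :=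
  { (EuclideanSpace.basisFun (Fin n) ℝ).toBasis.det with
    cont := by
      change Continuous fun v : Fin n → EuclideanSpace ℝ (Fin n) =>
        ((EuclideanSpace.basisFun (Fin n) ℝ).toBasis.toMatrix v).det
      refine Continuous.matrix_det (continuous_matrix fun i j => ?_)
      simp only [Module.Basis.toMatrix_apply, OrthonormalBasis.coe_toBasis_repr_apply,
        EuclideanSpace.basisFun_repr]
      fun_prop }

theorem detForm_basis : detForm n (fun a => EuclideanSpace.basisFun (Fin n) ℝ a) = 1 := by
  have := (EuclideanSpace.basisFun (Fin n) ℝ).toBasis.det_self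
  rw [OrthonormalBasis.coe_toBasis] at this
  exact this

variable {n} {m : ℕ}

/-- The contraction of the determinant with the `i`-th basis vector, which is up to sign the product
of all `dx_j` with `j ≠ i`. -/
noncomputable def contrForm (h : m + 1 = n) (i : Fin n) :
    (EuclideanSpace ℝ (Fin n)) [⋀^Fin m]→L[ℝ] ℝ :=
  { ((detForm n).toAlternatingMap.domDomCongr (finCongr h).symm).curryLeft
      (EuclideanSpace.basisFun (Fin n) ℝ i) with
    cont := by
      refine (detForm n).cont.comp (continuous_pi fun a => ?_)
      change Continuous fun v : Fin m → EuclideanSpace ℝ (Fin n) =>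
        (Matrix.vecCons (EuclideanSpace.basisFun (Fin n) ℝ i) v : Fin (m + 1) → _)
          ((finCongr h).symm a)
      generalize (finCongr h).symm a = b
      refine Fin.cases ?_ (fun c => ?_) b
      · exact continuous_const
      · exact continuous_apply c }

theorem contrForm_basis (h : m + 1 = n) (i : Fin n) (J : Fin m → Fin n) :
    (contrForm h i fun a => EuclideanSpace.basisFun (Fin n) ℝ (J a)) =
      detForm n fun a => EuclideanSpace.basisFun (Fin n) ℝ
        ((Fin.cons i J : Fin (m + 1) → Fin n) ((finCongr h).symm a)) := by
  have : (contrForm h i fun a => EuclideanSpace.basisFun (Fin n) ℝ (J a)) =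
      detForm n fun a => (Matrix.vecCons (EuclideanSpace.basisFun (Fin n) ℝ i)
        (fun a => EuclideanSpace.basisFun (Fin n) ℝ (J a)) : Fin (m + 1) → _)
          ((finCongr h).symm a) := rfl
  rw [this]
  congr 1
  funext a
  generalize (finCongr h).symm a = b
  refine Fin.cases ?_ (fun c => ?_) b <;> simp

theorem contrForm_basis_eq_zero (h : m + 1 = n) (i : Fin n) {J : Fin m → Fin n} {a : Fin m}
    (ha : J a = i) : (contrForm h i fun a => EuclideanSpace.basisFun (Fin n) ℝ (J a)) = 0 := by
  rw [contrForm_basis]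
  apply (detForm n).map_eq_zero_of_not_injective
  intro hinj
  have h1 := @hinj (finCongr h 0) (finCongr h a.succ) (by simp [ha])
  have h2 := (finCongr h).injective h1
  exact (Fin.succ_ne_zero a) h2.symm

theorem contrForm_basis_ne_zero (h : m + 1 = n) (i : Fin n) {J : Fin m → Fin n}
    (hJ : Function.Injective J) (hi : ∀ a, J a ≠ i) :
    (contrForm h i fun a => EuclideanSpace.basisFun (Fin n) ℝ (J a)) ≠ 0 := by
  rw [contrForm_basis]
  have hinj : Function.Injective fun a => (Fin.cons i J : Fin (m + 1) → Fin n)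
      ((finCongr h).symm a) := by
    refine Function.Injective.comp ?_ (finCongr h).symm.injective
    exact Fin.cons_injective_iff.2 ⟨fun ⟨a, ha⟩ => hi a ha, hJ⟩
  have h1 := (detForm n).toAlternatingMap.map_perm
    (fun a => EuclideanSpace.basisFun (Fin n) ℝ a)
    (Equiv.ofBijective _ (Finite.injective_iff_bijective.1 hinj))
  have h2 : (detForm n fun a => EuclideanSpace.basisFun (Fin n) ℝ
        ((Fin.cons i J : Fin (m + 1) → Fin n) ((finCongr h).symm a))) =
      Equiv.Perm.sign (Equiv.ofBijective _ (Finite.injective_iff_bijective.1 hinj)) •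
        detForm n (fun a => EuclideanSpace.basisFun (Fin n) ℝ a) := h1
  rw [h2, detForm_basis]
  rcases Int.units_eq_one_or
    (Equiv.Perm.sign (Equiv.ofBijective _ (Finite.injective_iff_bijective.1 hinj))) with h | h <;>
    rw [h] <;> simp

/-- The value on the coordinate basis of `d (f η)`, `η` the contraction of the determinant with the
`i`-th basis vector, is a nonzero multiple of the `i`-th partial derivative of `f`. -/
theorem exists_extDeriv_smul_contrForm (h : m + 1 = n) (i : Fin n) : ∃ c : ℝ, c ≠ 0 ∧
    ∀ (f : EuclideanSpace ℝ (Fin n) → ℝ) (y : EuclideanSpace ℝ (Fin n)), DifferentiableAt ℝ f y →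
      extDeriv (fun y => f y • contrForm h i) y
        (fun a => EuclideanSpace.basisFun (Fin n) ℝ (Fin.cast h a)) =
          c * fderiv ℝ f y (EuclideanSpace.basisFun (Fin n) ℝ i) := by
  set i' : Fin (m + 1) := Fin.cast h.symm i with hi'
  refine ⟨(-1) ^ (i' : ℕ) * contrForm h i (i'.removeNth fun a =>
    EuclideanSpace.basisFun (Fin n) ℝ (Fin.cast h a)), ?_, ?_⟩
  · refine mul_ne_zero (by simp) ?_
    refine contrForm_basis_ne_zero h i (J := fun a => Fin.cast h (i'.succAbove a)) ?_ ?_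
    · exact fun a b hab => Fin.succAbove_right_injective (Fin.cast_injective h hab)
    · intro a ha
      refine Fin.succAbove_ne i' a ?_
      exact Fin.cast_injective h (ha.trans rfl)
  · intro f y hf
    rw [extDeriv_apply (hf.smul_const _)]
    rw [Finset.sum_eq_single i']
    · have : fderiv ℝ (fun x => (f x • contrForm h i) (i'.removeNth fun a =>
          EuclideanSpace.basisFun (Fin n) ℝ (Fin.cast h a))) y =
          (contrForm h i (i'.removeNth fun a => EuclideanSpace.basisFun (Fin n) ℝ
            (Fin.cast h a))) • fderiv ℝ f y := by
        simp only [ContinuousAlternatingMap.smul_apply, smul_eq_mul]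
        rw [fderiv_mul_const hf]
      rw [this]
      simp only [_root_.smul_apply, smul_eq_mul]
      have hc : Fin.cast h i' = i := rfl
      rw [hc, zsmul_eq_mul]
      push_cast
      ring
    · intro j _ hj
      have hz : contrForm h i (j.removeNth fun a =>
          EuclideanSpace.basisFun (Fin n) ℝ (Fin.cast h a)) = 0 := by
        obtain ⟨a, ha⟩ := Fin.exists_succAbove_eq hj.symm
        refine contrForm_basis_eq_zero h i (J := fun a => Fin.cast h (j.succAbove a)) (a := a) ?_
        rw [ha]; rfl
      have : (fun x => (f x • contrForm h i) (j.removeNth fun a =>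
          EuclideanSpace.basisFun (Fin n) ℝ (Fin.cast h a))) = fun _ => 0 := by
        funext x
        rw [ContinuousAlternatingMap.smul_apply, hz, smul_zero]
      rw [this]
      simp
    · simp

/-- The exterior product of a form of degree one with the contraction of the determinant with the
`i`-th basis vector only sees the `i`-th coefficient. -/
theorem exists_wedge_contrForm (h : m + 1 = n) (h' : 0 + 1 + m = n) (i : Fin n) : ∃ c : ℝ,
    ∀ α : (EuclideanSpace ℝ (Fin n)) [⋀^Fin (0 + 1)]→L[ℝ] ℝ,
      wedge α (contrForm h i) (fun a => EuclideanSpace.basisFun (Fin n) ℝ (Fin.cast h' a)) =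
        c * α fun _ => EuclideanSpace.basisFun (Fin n) ℝ i := by
  have hne : ((0 + 1 : ℕ).factorial * m.factorial : ℝ) ≠ 0 := by positivity
  have : Subsingleton (Fin (0 + 1)) := inferInstanceAs (Subsingleton (Fin 1))
  -- the permutations which give an argument other than `e_i` to `α` contribute nothing
  let T : Equiv.Perm (Fin (0 + 1) ⊕ Fin m) → ℝ := fun σ =>
    if Fin.cast h' (finSumFinEquiv (σ (Sum.inl 0))) = i then
      ((Equiv.Perm.sign σ : ℤ) : ℝ) * contrForm h i (fun b => EuclideanSpace.basisFun (Fin n) ℝ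
        (Fin.cast h' (finSumFinEquiv (σ (Sum.inr b))))) else 0
  refine ⟨((0 + 1 : ℕ).factorial * m.factorial : ℝ)⁻¹ * ∑ σ, T σ, fun α => ?_⟩
  apply mul_left_cancel₀ hne
  rw [factorial_mul_wedge, ← mul_assoc, mul_inv_cancel_left₀ hne, Finset.sum_mul]
  refine Finset.sum_congr rfl fun σ _ => ?_
  have hα : (α fun a => EuclideanSpace.basisFun (Fin n) ℝ
      (Fin.cast h' (finSumFinEquiv (σ (Sum.inl a))))) =
      α fun _ => EuclideanSpace.basisFun (Fin n) ℝ
        (Fin.cast h' (finSumFinEquiv (σ (Sum.inl 0)))) := by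
    congr 1
    funext a
    rw [Subsingleton.elim a 0]
  rw [hα]
  by_cases hσ : Fin.cast h' (finSumFinEquiv (σ (Sum.inl 0))) = i
  · simp only [T, hσ, if_true]
    ring
  · simp only [T, hσ, if_false, zero_mul]
    -- the vector `e_i` is among the remaining arguments
    have hex : ∃ b : Fin m, Fin.cast h' (finSumFinEquiv (σ (Sum.inr b))) = i := by
      set q := σ.symm (finSumFinEquiv.symm (Fin.cast h'.symm i)) with hq
      have hq' : Fin.cast h' (finSumFinEquiv (σ q)) = i := by simp [hq]
      rcases hqc : q with a | b
      · rw [hqc, Subsingleton.elim a 0] at hq'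
        exact absurd hq' hσ
      · exact ⟨b, by rw [← hqc]; exact hq'⟩
    obtain ⟨b, hb⟩ := hex
    rw [contrForm_basis_eq_zero h i (J := fun b => Fin.cast h' (finSumFinEquiv (σ (Sum.inr b)))) hb]
    ring

end Coordinates

/-! ### The weak differential of a function in a chart -/

section ChartPull

variable {n : ℕ} {M : Type*} [TopologicalSpace M] [ChartedSpace (EuclideanSpace ℝ (Fin n)) M]

open Classical in
/-- The pull-back by the chart around `x₀` of a form on `ℝⁿ`, extended by zero outside the domain of
the chart. -/
noncomputable def chartPull {k : ℕ} (x₀ : M) (F : EuclideanSpace ℝ (Fin n) →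
    (EuclideanSpace ℝ (Fin n)) [⋀^Fin k]→L[ℝ] ℝ) : FormField n M k := fun p =>
  if p ∈ (chartAt (EuclideanSpace ℝ (Fin n)) x₀).source then
    (F (chartAt (EuclideanSpace ℝ (Fin n)) x₀ p)).compContinuousLinearMap
      (mfderiv (𝓡 n) (𝓡 n) (chartAt (EuclideanSpace ℝ (Fin n)) x₀) p)
  else 0

variable [IsManifold (𝓡 n) ∞ M]

theorem chartForm_chartPull {k : ℕ} (x₀ : M) (F : EuclideanSpace ℝ (Fin n) →
    (EuclideanSpace ℝ (Fin n)) [⋀^Fin k]→L[ℝ] ℝ) {y : EuclideanSpace ℝ (Fin n)}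
    (hy : y ∈ (chartAt (EuclideanSpace ℝ (Fin n)) x₀).target) :
    chartForm (chartPull x₀ F) x₀ y = F y := by
  have hmem := (chartAt (EuclideanSpace ℝ (Fin n)) x₀).map_target hy
  have hinv := (chartAt (EuclideanSpace ℝ (Fin n)) x₀).right_inv hy
  have hd := (mdifferentiable_chart (I := 𝓡 n) x₀).comp_symm_deriv hy
  have h1 : chartForm (chartPull x₀ F) x₀ y =
      (F (chartAt (EuclideanSpace ℝ (Fin n)) x₀
        ((chartAt (EuclideanSpace ℝ (Fin n)) x₀).symm y))).compContinuousLinearMap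
      (ContinuousLinearMap.comp (mfderiv (𝓡 n) (𝓡 n) (chartAt (EuclideanSpace ℝ (Fin n)) x₀)
        ((chartAt (EuclideanSpace ℝ (Fin n)) x₀).symm y))
        (mfderiv (𝓡 n) (𝓡 n) (chartAt (EuclideanSpace ℝ (Fin n)) x₀).symm y)) := by
    rw [chartForm, chartPull, if_pos hmem]
    rfl
  rw [h1, hinv]
  have h2 : (F y).compContinuousLinearMap
      (ContinuousLinearMap.comp (mfderiv (𝓡 n) (𝓡 n) (chartAt (EuclideanSpace ℝ (Fin n)) x₀)
        ((chartAt (EuclideanSpace ℝ (Fin n)) x₀).symm y))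
        (mfderiv (𝓡 n) (𝓡 n) (chartAt (EuclideanSpace ℝ (Fin n)) x₀).symm y)) =
      (F y).compContinuousLinearMap (ContinuousLinearMap.id ℝ (EuclideanSpace ℝ (Fin n))) :=
    congrArg _ hd
  exact h2

/-- On a subset of a chart domain, the continuity of a form may be checked in this chart. -/
theorem continuousOn_coeff_of_chartForm {k : ℕ} (α : FormField n M k) (x₀ : M) {V : Set M}
    (hVx : V ⊆ (chartAt (EuclideanSpace ℝ (Fin n)) x₀).source)
    (hc : ∀ J : Fin k → Fin n, ContinuousOn (fun y => chartForm α x₀ y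
      fun a => EuclideanSpace.basisFun (Fin n) ℝ (J a)) (chartSet x₀ V)) :
    IsContinuousFormOn α V := by
  intro x I
  have hcont : ContinuousOn (fun y => chartForm α x y
      fun a => EuclideanSpace.basisFun (Fin n) ℝ (I a)) (chartSet x V) := by
    have hov : chartSet (n := n) x V ⊆ overlap x x₀ := fun y hy => ⟨hy.1, hVx hy.2⟩
    have h1 : EqOn (fun y => chartForm α x y fun a => EuclideanSpace.basisFun (Fin n) ℝ (I a))
        (fun y => ∑ J : Fin k → Fin n, (∏ a, (fderiv ℝ (coordChange x x₀) y
          (EuclideanSpace.basisFun (Fin n) ℝ (I a))) (J a)) *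
          chartForm α x₀ (coordChange x x₀ y)
            fun a => EuclideanSpace.basisFun (Fin n) ℝ (J a)) (chartSet x V) := by
      intro y hy
      simp only
      rw [chartForm_eq_pullback α (hov hy)]
      rw [ContinuousAlternatingMap.compContinuousLinearMap_apply]
      exact apply_eq_sum_basisFun _ _
    refine ContinuousOn.congr ?_ h1
    have hT := (contDiffOn_coordChange x x₀).mono hov
    refine continuousOn_finsetSum _ fun J _ => ContinuousOn.mul
      (continuousOn_finsetProd _ fun a _ => ?_) ?_
    · have h2 : ContinuousOn (fderiv ℝ (coordChange x x₀)) (chartSet (n := n) x V) :=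
        ((contDiffOn_coordChange x x₀).continuousOn_fderiv_of_isOpen (isOpen_overlap x x₀)
          (by simp)).mono hov
      have h3 := h2.clm_apply (continuousOn_const (c := EuclideanSpace.basisFun (Fin n) ℝ (I a)))
      exact (EuclideanSpace.proj (𝕜 := ℝ) (J a)
        : EuclideanSpace ℝ (Fin n) →L[ℝ] ℝ).continuous.comp_continuousOn h3
    · refine (hc J).comp hT.continuousOn fun y hy => ⟨(coordChange_mem (hov hy)).1, ?_⟩
      rw [mem_preimage, symm_coordChange (hov hy)]
      exact hy.2
  refine hcont.comp ((chartAt (EuclideanSpace ℝ (Fin n)) x).continuousOn.mono inter_subset_right)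
    fun p hp => ⟨(chartAt (EuclideanSpace ℝ (Fin n)) x).map_source hp.2, ?_⟩
  rw [mem_preimage, (chartAt (EuclideanSpace ℝ (Fin n)) x).left_inv hp.2]
  exact hp.1

/-- The pull-back by a chart of a smooth form with compact support is a test form. -/
theorem isTestForm_chartPull [T2Space M] {k : ℕ} (x₀ : M) {F : EuclideanSpace ℝ (Fin n) →
    (EuclideanSpace ℝ (Fin n)) [⋀^Fin k]→L[ℝ] ℝ} (hF : ContDiff ℝ ∞ F) {U : Opens M}
    {s : Set (EuclideanSpace ℝ (Fin n))} (hs : IsCompact s) (hsU : s ⊆ chartSet x₀ (U : Set M))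
    (hFs : ∀ y ∉ s, F y = 0) : IsTestForm U (chartPull x₀ F) := by
  set K := (chartAt (EuclideanSpace ℝ (Fin n)) x₀).symm '' s with hKdef
  have hK : IsCompact K := hs.image_of_continuousOn
    ((chartAt (EuclideanSpace ℝ (Fin n)) x₀).continuousOn_symm.mono fun y hy => (hsU hy).1)
  have hzero : ∀ p ∉ K, chartPull x₀ F p = 0 := by
    intro p hp
    rw [chartPull]
    split_ifs with hps
    · rw [hFs]
      · rfl
      · intro hmem
        exact hp ⟨_, hmem, (chartAt (EuclideanSpace ℝ (Fin n)) x₀).left_inv hps⟩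
    · rfl
  refine ⟨isSmoothForm_of_forall_exists fun p => ?_, K, hK, ?_, hzero⟩
  · by_cases hp : p ∈ (chartAt (EuclideanSpace ℝ (Fin n)) x₀).source
    · refine ⟨x₀, hp, hF.contDiffAt.congr_of_eventuallyEq ?_⟩
      filter_upwards [(chartAt (EuclideanSpace ℝ (Fin n)) x₀).open_target.mem_nhds
        ((chartAt (EuclideanSpace ℝ (Fin n)) x₀).map_source hp)] with y hy
      exact chartForm_chartPull x₀ F hy
    · have hpK : p ∉ K := by
        rintro ⟨y, hy, rfl⟩
        exact hp ((chartAt (EuclideanSpace ℝ (Fin n)) x₀).map_target (hsU hy).1)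
      refine ⟨p, mem_chart_source _ p, ?_⟩
      have hc := (chartAt (EuclideanSpace ℝ (Fin n)) p).continuousAt_symm
        (mem_chart_target (EuclideanSpace ℝ (Fin n)) p)
      rw [ContinuousAt, (chartAt (EuclideanSpace ℝ (Fin n)) p).left_inv
        (mem_chart_source _ p)] at hc
      refine ContDiffAt.congr_of_eventuallyEq (f := fun _ => 0) contDiffAt_const ?_
      filter_upwards [hc.eventually (hK.isClosed.isOpen_compl.mem_nhds hpK)] with y hy
      rw [chartForm, hzero _ hy]
      rfl
  · rintro _ ⟨y, hy, rfl⟩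
    exact (hsU hy).2

end ChartPull

section WeakDerivative

variable {n : ℕ} {M : Type*} [TopologicalSpace M] [ChartedSpace (EuclideanSpace ℝ (Fin n)) M]
  [RiemannianBundle (fun x : M => TangentSpace (𝓡 n) x)]
  [IsManifold (𝓡 n) ∞ M] [IsContMDiffRiemannianBundle (𝓡 n) ∞ (EuclideanSpace ℝ (Fin n))
    (fun x : M => TangentSpace (𝓡 n) x)]

variable (n) in
/-- The orientation form `√det(g_ij) dx₁ ∧ ⋯ ∧ dxₙ` of the domain of the chart around `x₀`. -/
noncomputable def chartOrientation (x₀ : M) : FormField n M n :=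
  chartPull x₀ fun y => volDensity n x₀ y • detForm n

/-- Top-degree forms take proportional values on the orthonormal basis and on the coordinate vectors.
The factor is `± 1 / √(det g_ij)`, the sign being that of the orientation of the orthonormal basis. -/
theorem topForm_onb_eq (x₀ : M) {y : EuclideanSpace ℝ (Fin n)}
    (hy : y ∈ (chartAt (EuclideanSpace ℝ (Fin n)) x₀).target) :
    ∃ c : ℝ, c ^ 2 * volDensity n x₀ y ^ 2 = 1 ∧ ∀ (j : ℕ) (h : j = n)
      (f : (TangentSpace (𝓡 n) ((chartAt (EuclideanSpace ℝ (Fin n)) x₀).symm y)) [⋀^Fin j]→ₗ[ℝ] ℝ),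
      (f fun a => onb n _ (Fin.cast h a)) = c * f fun a =>
        dchartSymm n x₀ y (EuclideanSpace.basisFun (Fin n) ℝ (Fin.cast h a)) := by
  obtain ⟨C, hC, hC'⟩ := exists_onb_matrix x₀ hy
  refine ⟨C.det, ?_, fun j h f => map_sum_smul_eq_det_mul h f _ _ C hC⟩
  have h := congrArg Matrix.det hC'
  rw [Matrix.det_mul, Matrix.det_mul, Matrix.det_transpose, Matrix.det_one] at h
  rw [volDensity, Real.sq_sqrt (det_gram_pos x₀ hy).le, ← h]
  ring

theorem chartOrientation_basis (x₀ : M) {y : EuclideanSpace ℝ (Fin n)}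
    (hy : y ∈ (chartAt (EuclideanSpace ℝ (Fin n)) x₀).target) :
    (chartOrientation n x₀ ((chartAt (EuclideanSpace ℝ (Fin n)) x₀).symm y) fun a =>
      dchartSymm n x₀ y (EuclideanSpace.basisFun (Fin n) ℝ a)) = volDensity n x₀ y := by
  have h : (chartForm (chartOrientation n x₀) x₀ y fun a =>
      EuclideanSpace.basisFun (Fin n) ℝ a) = volDensity n x₀ y := by
    rw [chartOrientation, chartForm_chartPull x₀ _ hy]
    rw [ContinuousAlternatingMap.smul_apply, detForm_basis, smul_eq_mul, mul_one]
  exact h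

theorem isOrientation_chartOrientation (x₀ : M) {V : Opens M}
    (hV : (V : Set M) ⊆ (chartAt (EuclideanSpace ℝ (Fin n)) x₀).source) :
    IsOrientation V (chartOrientation n x₀) := by
  refine ⟨continuousOn_coeff_of_chartForm _ x₀ hV fun J => ?_, fun p hp => ?_⟩
  · have h1 : EqOn (fun y => chartForm (chartOrientation n x₀) x₀ y
        fun a => EuclideanSpace.basisFun (Fin n) ℝ (J a))
        (fun y => volDensity n x₀ y * detForm n
          fun a => EuclideanSpace.basisFun (Fin n) ℝ (J a)) (chartSet x₀ (V : Set M)) := by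
      intro y hy
      simp only
      rw [chartOrientation, chartForm_chartPull x₀ _ hy.1]
      rfl
    exact ContinuousOn.congr (((continuousOn_volDensity x₀).mono inter_subset_left).mul
      continuousOn_const) h1
  · obtain ⟨y, hy, rfl⟩ : ∃ y ∈ (chartAt (EuclideanSpace ℝ (Fin n)) x₀).target,
        (chartAt (EuclideanSpace ℝ (Fin n)) x₀).symm y = p :=
      ⟨_, (chartAt (EuclideanSpace ℝ (Fin n)) x₀).map_source (hV hp),
        (chartAt (EuclideanSpace ℝ (Fin n)) x₀).left_inv (hV hp)⟩
    obtain ⟨c, hc, hf⟩ := topForm_onb_eq x₀ hy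
    have h1 := hf n rfl (chartOrientation n x₀
      ((chartAt (EuclideanSpace ℝ (Fin n)) x₀).symm y)).toAlternatingMap
    have h2 : chartOrientation n x₀ ((chartAt (EuclideanSpace ℝ (Fin n)) x₀).symm y)
        (onb n ((chartAt (EuclideanSpace ℝ (Fin n)) x₀).symm y)) = c * volDensity n x₀ y := by
      rw [← chartOrientation_basis x₀ hy]
      exact h1
    rw [formNorm_top, h2, ← Real.sqrt_sq_eq_abs, mul_pow, hc, Real.sqrt_one]

/-- In the chart, integrating a top-degree form amounts to integrating its value on the coordinate
vectors against the Lebesgue measure. -/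
theorem volDensity_mul_topDensity (x₀ : M) {j : ℕ} (h : j = n)
    (β : ∀ x : M, (TangentSpace (𝓡 n) x) [⋀^Fin j]→ₗ[ℝ] ℝ) {y : EuclideanSpace ℝ (Fin n)}
    (hy : y ∈ (chartAt (EuclideanSpace ℝ (Fin n)) x₀).target) :
    volDensity n x₀ y * topDensity (chartOrientation n x₀) h β
      ((chartAt (EuclideanSpace ℝ (Fin n)) x₀).symm y) =
      β ((chartAt (EuclideanSpace ℝ (Fin n)) x₀).symm y) fun a =>
        dchartSymm n x₀ y (EuclideanSpace.basisFun (Fin n) ℝ (Fin.cast h a)) := by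
  obtain ⟨c, hc, hf⟩ := topForm_onb_eq x₀ hy
  have h1 := hf n rfl (chartOrientation n x₀
      ((chartAt (EuclideanSpace ℝ (Fin n)) x₀).symm y)).toAlternatingMap
  have h2 : chartOrientation n x₀ ((chartAt (EuclideanSpace ℝ (Fin n)) x₀).symm y)
        (onb n ((chartAt (EuclideanSpace ℝ (Fin n)) x₀).symm y)) = c * volDensity n x₀ y := by
    rw [← chartOrientation_basis x₀ hy]
    exact h1
  rw [topDensity, hf j h, h2]
  linear_combination (β ((chartAt (EuclideanSpace ℝ (Fin n)) x₀).symm y) fun a =>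
        dchartSymm n x₀ y (EuclideanSpace.basisFun (Fin n) ℝ (Fin.cast h a))) * hc

theorem volDensity_mul_topDensity_wedge (x₀ : M) {k m : ℕ} (h : k + m = n)
    (φ : FormField n M k) (η : FormField n M m) {y : EuclideanSpace ℝ (Fin n)}
    (hy : y ∈ (chartAt (EuclideanSpace ℝ (Fin n)) x₀).target) :
    volDensity n x₀ y * topDensity (chartOrientation n x₀) h (fun x => wedge (φ x) (η x))
      ((chartAt (EuclideanSpace ℝ (Fin n)) x₀).symm y) =
      wedge (chartForm φ x₀ y) (chartForm η x₀ y) fun a =>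
        EuclideanSpace.basisFun (Fin n) ℝ (Fin.cast h a) := by
  rw [volDensity_mul_topDensity x₀ h _ hy, chartForm, chartForm, wedge_compContinuousLinearMap]

variable [MeasurableSpace M] [BorelSpace M] [SecondCountableTopology M] [T2Space M]

/-- In a chart, the weak exterior differential of a function is given by weak partial derivatives,
up to normalisation constants depending on the index only. -/
theorem exists_weak_partial_derivative (hn : 1 ≤ n) (x₀ : M) : ∃ κ : Fin n → ℝ,
    ∀ (U : Opens M), (U : Set M) ⊆ (chartAt (EuclideanSpace ℝ (Fin n)) x₀).source →
    ∀ (φ : FormField n M 0) (θ : FormField n M (0 + 1)), HasWeakD U φ θ →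
    ∀ ψ : EuclideanSpace ℝ (Fin n) → ℝ, ContDiff ℝ ∞ ψ → HasCompactSupport ψ →
      tsupport ψ ⊆ chartSet x₀ (U : Set M) → ∀ i : Fin n,
      ∫ y in chartSet x₀ (U : Set M), chartForm φ x₀ y 0 *
          fderiv ℝ ψ y (EuclideanSpace.basisFun (Fin n) ℝ i) =
        -∫ y in chartSet x₀ (U : Set M), (κ i * chartForm θ x₀ y
          fun _ => EuclideanSpace.basisFun (Fin n) ℝ i) * ψ y := by
  obtain ⟨m, hm⟩ : ∃ m, m + 1 = n := ⟨n - 1, by omega⟩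
  have hm' : 0 + 1 + m = n := by omega
  choose c hc0 hc using fun i => exists_extDeriv_smul_contrForm hm i
  choose d hd using fun i => exists_wedge_contrForm hm hm' i
  refine ⟨fun i => (c i)⁻¹ * d i, fun U hU φ θ hw ψ hψ hψc hψs i => ?_⟩
  have hUm : MeasurableSet (U : Set M) := U.isOpen.measurableSet
  -- for this test form, both sides of the weak identity only involve the index `i`
  set F : EuclideanSpace ℝ (Fin n) → (EuclideanSpace ℝ (Fin n)) [⋀^Fin m]→L[ℝ] ℝ :=
    fun y => ψ y • contrForm hm i with hF
  have hFsm : ContDiff ℝ ∞ F := hψ.smul contDiff_const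
  have htest : IsTestForm U (chartPull x₀ F) := by
    refine isTestForm_chartPull x₀ hFsm hψc hψs fun y hy => ?_
    rw [hF]
    simp only
    rw [image_eq_zero_of_notMem_tsupport hy, zero_smul]
  obtain ⟨h1, h2, h3⟩ := hw U le_rfl (chartOrientation n x₀)
    (isOrientation_chartOrientation x₀ hU) m hm' _ htest
  rw [integral_vol_eq hUm hU h1.aestronglyMeasurable,
    integral_vol_eq hUm hU h2.aestronglyMeasurable] at h3
  have e1 : ∫ y in chartSet x₀ (U : Set M), volDensity n x₀ y *
      topDensity (chartOrientation n x₀) hm' (fun x => wedge (θ x) (chartPull x₀ F x))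
        ((chartAt (EuclideanSpace ℝ (Fin n)) x₀).symm y) =
      ∫ y in chartSet x₀ (U : Set M), d i * ((chartForm θ x₀ y
          fun _ => EuclideanSpace.basisFun (Fin n) ℝ i) * ψ y) := by
    refine setIntegral_congr_fun (measurableSet_chartSet x₀ hUm) fun y hy => ?_
    rw [volDensity_mul_topDensity_wedge x₀ hm' θ _ hy.1, chartForm_chartPull x₀ F hy.1, hF,
      wedge_smul_right, AlternatingMap.smul_apply, hd, smul_eq_mul]
    ring
  have e2 : ∫ y in chartSet x₀ (U : Set M), volDensity n x₀ y *
      topDensity (chartOrientation n x₀) (show 0 + (m + 1) = n by omega)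
        (fun x => wedge (φ x) (extD (chartPull x₀ F) x))
        ((chartAt (EuclideanSpace ℝ (Fin n)) x₀).symm y) =
      ∫ y in chartSet x₀ (U : Set M), c i * (chartForm φ x₀ y 0 *
          fderiv ℝ ψ y (EuclideanSpace.basisFun (Fin n) ℝ i)) := by
    refine setIntegral_congr_fun (measurableSet_chartSet x₀ hUm) fun y hy => ?_
    rw [volDensity_mul_topDensity_wedge x₀ _ φ _ hy.1, chartForm_extD htest.1 hy.1,
      wedge_degree_zero]
    have h4 : chartForm (chartPull x₀ F) x₀ =ᶠ[𝓝 y] F := by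
      filter_upwards [(chartAt (EuclideanSpace ℝ (Fin n)) x₀).open_target.mem_nhds hy.1] with z hz
      exact chartForm_chartPull x₀ F hz
    rw [h4.extDeriv_eq]
    have h5 := hc i ψ y ((hψ.differentiable (by simp)) y)
    have h6 : (extDeriv F y fun b => EuclideanSpace.basisFun (Fin n) ℝ
        (Fin.cast (show 0 + (m + 1) = n by omega) (Fin.natAdd 0 b))) =
        c i * fderiv ℝ ψ y (EuclideanSpace.basisFun (Fin n) ℝ i) := by
      rw [← h5]
      congr 1
      funext b
      congr 1
      ext
      simp
    rw [h6]
    ring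
  rw [e1, e2, integral_const_mul, integral_const_mul] at h3
  have e3 : ∫ y in chartSet x₀ (U : Set M), ((c i)⁻¹ * d i * chartForm θ x₀ y
      fun _ => EuclideanSpace.basisFun (Fin n) ℝ i) * ψ y =
      (c i)⁻¹ * d i * ∫ y in chartSet x₀ (U : Set M), (chartForm θ x₀ y
      fun _ => EuclideanSpace.basisFun (Fin n) ℝ i) * ψ y := by
    rw [← integral_const_mul]
    simp only [mul_assoc]
  rw [e3, mul_assoc, h3, zero_add, pow_one, neg_one_mul, mul_neg, neg_neg,
    inv_mul_cancel_left₀ (hc0 i)]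

end WeakDerivative

/-! ### Norms and coefficients of forms in a chart -/

section NormBounds

variable {n : ℕ} {M : Type*} [TopologicalSpace M] [ChartedSpace (EuclideanSpace ℝ (Fin n)) M]
  [RiemannianBundle (fun x : M => TangentSpace (𝓡 n) x)]
  [IsManifold (𝓡 n) ∞ M] [IsContMDiffRiemannianBundle (𝓡 n) ∞ (EuclideanSpace ℝ (Fin n))
    (fun x : M => TangentSpace (𝓡 n) x)]

theorem continuousOn_gram_inv (x : M) (i j : Fin n) :
    ContinuousOn (fun y => (gram n x y)⁻¹ i j)
      (chartAt (EuclideanSpace ℝ (Fin n)) x).target := by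
  simp only [Matrix.inv_def, Ring.inverse_eq_inv', Matrix.smul_apply, smul_eq_mul,
    Matrix.adjugate_apply]
  refine ((continuousOn_det_gram x).inv₀ fun y hy => (det_gram_pos x hy).ne').mul ?_
  simp only [Matrix.det_apply']
  refine continuousOn_finsetSum _ fun σ _ => continuousOn_const.mul
    (continuousOn_finsetProd _ fun a _ => ?_)
  by_cases hab : σ a = j
  · simp only [hab, Matrix.updateRow_self]
    exact continuousOn_const
  · simpa [Matrix.updateRow_apply, hab] using continuousOn_gram x (σ a) a

variable {x₀ : M} {K : Set M}

theorem exists_bound_comp_chart (hK : IsCompact K)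
    (hKx : K ⊆ (chartAt (EuclideanSpace ℝ (Fin n)) x₀).source)
    {f : EuclideanSpace ℝ (Fin n) → ℝ}
    (hf : ContinuousOn f (chartAt (EuclideanSpace ℝ (Fin n)) x₀).target) :
    ∃ B : ℝ, 0 ≤ B ∧ ∀ p ∈ K, |f (chartAt (EuclideanSpace ℝ (Fin n)) x₀ p)| ≤ B := by
  obtain ⟨B, hB⟩ := hK.exists_bound_of_continuousOn (hf.comp
    ((chartAt (EuclideanSpace ℝ (Fin n)) x₀).continuousOn.mono hKx)
      fun p hp => (chartAt (EuclideanSpace ℝ (Fin n)) x₀).map_source (hKx hp))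
  exact ⟨max B 0, le_max_right _ _, fun p hp => (hB p hp).trans (le_max_left _ _)⟩

/-- On compact subsets of a chart domain, the norm of a form is controlled by its coefficients. -/
theorem exists_formNorm_le_coeff (k : ℕ) (hK : IsCompact K)
    (hKx : K ⊆ (chartAt (EuclideanSpace ℝ (Fin n)) x₀).source) :
    ∃ C : ℝ, 0 ≤ C ∧ ∀ (α : FormField n M k), ∀ p ∈ K,
      formNorm (α p) ≤ C * ∑ I : Fin k → Fin n, |coeff α x₀ I p| := by
  have hb : ∀ I J : Fin k → Fin n, ∃ B : ℝ, 0 ≤ B ∧ ∀ p ∈ K,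
      |∏ a, (gram n x₀ (chartAt (EuclideanSpace ℝ (Fin n)) x₀ p))⁻¹ (I a) (J a)| ≤ B :=
    fun I J => exists_bound_comp_chart hK hKx (f := fun y => ∏ a, (gram n x₀ y)⁻¹ (I a) (J a))
      (continuousOn_finsetProd _ fun a _ => continuousOn_gram_inv x₀ _ _)
  choose B hB0 hB using hb
  set B' := ∑ I, ∑ J, B I J with hB'
  have hle : ∀ I J, B I J ≤ B' := fun I J =>
    (Finset.single_le_sum (f := fun J => B I J) (fun J _ => hB0 I J) (Finset.mem_univ J)).trans
      (Finset.single_le_sum (f := fun I => ∑ J, B I J)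
        (fun I _ => Finset.sum_nonneg fun J _ => hB0 I J) (Finset.mem_univ I))
  have hB'0 : 0 ≤ B' := Finset.sum_nonneg fun I _ => Finset.sum_nonneg fun J _ => hB0 I J
  refine ⟨√((k.factorial : ℝ)⁻¹ * B'), Real.sqrt_nonneg _, fun α p hp => ?_⟩
  have hs : 0 ≤ ∑ I : Fin k → Fin n, |coeff α x₀ I p| := Finset.sum_nonneg fun _ _ => abs_nonneg _
  rw [formNorm_eq_coeff α x₀ (hKx hp)]
  conv_rhs => rw [← Real.sqrt_sq hs, ← Real.sqrt_mul (by positivity)]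
  apply Real.sqrt_le_sqrt
  rw [mul_assoc]
  refine mul_le_mul_of_nonneg_left ?_ (by positivity)
  rw [sq, Finset.sum_mul_sum, Finset.mul_sum]
  refine Finset.sum_le_sum fun I _ => ?_
  rw [Finset.mul_sum]
  refine Finset.sum_le_sum fun J _ => (le_abs_self _).trans ?_
  rw [abs_mul, abs_mul]
  exact mul_le_mul_of_nonneg_right ((hB I J p hp).trans (hle I J)) (by positivity)

/-- On compact subsets of a chart domain, the coefficients of a form are controlled by its norm. -/
theorem exists_coeff_le_formNorm (k : ℕ) (hK : IsCompact K)
    (hKx : K ⊆ (chartAt (EuclideanSpace ℝ (Fin n)) x₀).source) :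
    ∃ C : ℝ, 0 ≤ C ∧ ∀ (α : FormField n M k) (I : Fin k → Fin n), ∀ p ∈ K,
      |coeff α x₀ I p| ≤ C * formNorm (α p) := by
  choose B hB0 hB using fun i : Fin n => exists_bound_comp_chart hK hKx
    (f := fun y => √(gram n x₀ y i i)) (continuousOn_gram x₀ i i).sqrt
  set B' := ∑ i, B i with hB'
  have hle : ∀ i, B i ≤ B' := fun i =>
    Finset.single_le_sum (f := B) (fun i _ => hB0 i) (Finset.mem_univ i)
  have hB'0 : 0 ≤ B' := Finset.sum_nonneg fun i _ => hB0 i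
  refine ⟨∑ _J : Fin k → Fin n, B' ^ k * √(k.factorial : ℝ),
    Finset.sum_nonneg fun _ _ => by positivity, fun α I p hp => ?_⟩
  obtain ⟨y, hy, rfl⟩ : ∃ y ∈ (chartAt (EuclideanSpace ℝ (Fin n)) x₀).target,
      (chartAt (EuclideanSpace ℝ (Fin n)) x₀).symm y = p :=
    ⟨_, (chartAt (EuclideanSpace ℝ (Fin n)) x₀).map_source (hKx hp),
      (chartAt (EuclideanSpace ℝ (Fin n)) x₀).left_inv (hKx hp)⟩
  have hyr := (chartAt (EuclideanSpace ℝ (Fin n)) x₀).right_inv hy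
  set p := (chartAt (EuclideanSpace ℝ (Fin n)) x₀).symm y with hpdef
  let w : Fin k → TangentSpace (𝓡 n) p := fun a =>
    dchartSymm n x₀ y (EuclideanSpace.basisFun (Fin n) ℝ (I a))
  have hco : coeff α x₀ I p = α p w := by
    rw [coeff, hyr]
    rfl
  have hw : w = fun a => ∑ l, inner ℝ (onb n p l) (w a) • onb n p l := by
    funext a
    exact ((onb n p).sum_repr' (w a)).symm
  have hexp : α p w = ∑ J : Fin k → Fin n, (∏ a, inner ℝ (onb n p (J a)) (w a)) *
      α p fun a => onb n p (J a) := by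
    conv_lhs => rw [hw]
    have := ((α p).toMultilinearMap).map_sum
      (fun (a : Fin k) (l : Fin n) => inner ℝ (onb n p l) (w a) • onb n p l)
    refine this.trans (Finset.sum_congr rfl fun J _ => ?_)
    exact ((α p).toMultilinearMap).map_smul_univ _ _
  have hin : ∀ a l, |inner ℝ (onb n p l) (w a)| ≤ B' := by
    intro a l
    refine (abs_real_inner_le_norm _ _).trans ?_
    rw [OrthonormalBasis.norm_eq_one, one_mul, norm_eq_sqrt_real_inner]
    have h1 := hB (I a) p hp
    rw [hyr, abs_of_nonneg (Real.sqrt_nonneg _)] at h1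
    exact h1.trans (hle _)
  rw [hco, hexp, Finset.sum_mul]
  refine (Finset.abs_sum_le_sum_abs _ _).trans (Finset.sum_le_sum fun J _ => ?_)
  rw [abs_mul, mul_assoc, Finset.abs_prod]
  refine mul_le_mul ?_ (abs_apply_onb_le _ _) (abs_nonneg _) (by positivity)
  refine (Finset.prod_le_prod (fun _ _ => abs_nonneg _) fun a _ => hin a (J a)).trans ?_
  simp

theorem formNorm_degree_zero {x : M} (α : (TangentSpace (𝓡 n) x) [⋀^Fin 0]→L[ℝ] ℝ) :
    formNorm α = |α 0| := by
  rw [formNorm]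
  have : ∀ I : Fin 0 → Fin n, (α fun a => onb n x (I a)) = α 0 := fun I =>
    congrArg α (Subsingleton.elim _ _)
  simp [this, Real.sqrt_sq_eq_abs]

/-- A smooth form is bounded on compact sets in the domain of a chart. -/
theorem IsSmoothForm.exists_formNorm_le_of_subset_source {k : ℕ} {α : FormField n M k}
    (hα : IsSmoothForm α) (hK : IsCompact K)
    (hKx : K ⊆ (chartAt (EuclideanSpace ℝ (Fin n)) x₀).source) :
    ∃ C : ℝ, 0 ≤ C ∧ ∀ p ∈ K, formNorm (α p) ≤ C := by
  obtain ⟨C, hC0, hC⟩ := exists_formNorm_le_coeff k hK hKx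
  choose B hB0 hB using fun I : Fin k → Fin n => exists_bound_comp_chart hK hKx
    (f := fun y => chartForm α x₀ y fun a => EuclideanSpace.basisFun (Fin n) ℝ (I a))
    (fun y hy => (contDiffAt_form_apply_const (hα.contDiffAt hy)
      _).continuousAt.continuousWithinAt)
  refine ⟨C * ∑ I, B I, mul_nonneg hC0 (Finset.sum_nonneg fun I _ => hB0 I), fun p hp => ?_⟩
  exact (hC α p hp).trans (mul_le_mul_of_nonneg_left
    (Finset.sum_le_sum fun I _ => hB I p hp) hC0)

/-- Multiplication by a function of the coordinates and `d` commute up to a term controlled by the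
gradient of this function. -/
theorem exists_formNorm_extD_smul_sub_le {k : ℕ} {α : FormField n M k}
    (hα : IsSmoothForm α) (hK : IsCompact K)
    (hKx : K ⊆ (chartAt (EuclideanSpace ℝ (Fin n)) x₀).source) :
    ∃ C : ℝ, 0 ≤ C ∧ ∀ h : EuclideanSpace ℝ (Fin n) → ℝ, ContDiff ℝ ∞ h →
      IsSmoothForm (fun p => h (chartAt (EuclideanSpace ℝ (Fin n)) x₀ p) • α p) →
      ∀ p ∈ K, formNorm (extD (fun p => h (chartAt (EuclideanSpace ℝ (Fin n)) x₀ p) • α p) p -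
        h (chartAt (EuclideanSpace ℝ (Fin n)) x₀ p) • extD α p) ≤
        C * ‖fderiv ℝ h (chartAt (EuclideanSpace ℝ (Fin n)) x₀ p)‖ := by
  obtain ⟨C, hC0, hC⟩ := exists_formNorm_le_coeff (k + 1) hK hKx
  obtain ⟨B, hB0, hB⟩ := exists_bound_comp_chart hK hKx (f := fun y => ‖chartForm α x₀ y‖)
    (fun y hy => (hα.contDiffAt hy).continuousAt.norm.continuousWithinAt)
  refine ⟨C * ∑ _I : Fin (k + 1) → Fin n, ((k + 1) * B), by positivity, fun h hh hs p hp => ?_⟩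
  set R : FormField n M (k + 1) := fun p =>
    extD (fun p => h (chartAt (EuclideanSpace ℝ (Fin n)) x₀ p) • α p) p -
        h (chartAt (EuclideanSpace ℝ (Fin n)) x₀ p) • extD α p with hR
  refine (hC R p hp).trans ?_
  rw [mul_assoc, Finset.sum_mul]
  refine mul_le_mul_of_nonneg_left (Finset.sum_le_sum fun I _ => ?_) hC0
  set y := chartAt (EuclideanSpace ℝ (Fin n)) x₀ p with hy
  have hyt : y ∈ (chartAt (EuclideanSpace ℝ (Fin n)) x₀).target :=
    (chartAt (EuclideanSpace ℝ (Fin n)) x₀).map_source (hKx hp)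
  have hev : chartForm (fun p => h (chartAt (EuclideanSpace ℝ (Fin n)) x₀ p) • α p) x₀ =ᶠ[𝓝 y]
      fun y => h y • chartForm α x₀ y := by
    filter_upwards [(chartAt (EuclideanSpace ℝ (Fin n)) x₀).open_target.mem_nhds hyt] with z hz
    have h1 : chartForm (fun p => h (chartAt (EuclideanSpace ℝ (Fin n)) x₀ p) • α p) x₀ z =
      h (chartAt (EuclideanSpace ℝ (Fin n)) x₀ ((chartAt (EuclideanSpace ℝ (Fin n)) x₀).symm z)) •
        chartForm α x₀ z := rfl
    rw [h1, (chartAt (EuclideanSpace ℝ (Fin n)) x₀).right_inv hz]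
  have hform : chartForm R x₀ y = extDeriv (fun y => h y • chartForm α x₀ y) y -
      h y • extDeriv (chartForm α x₀) y := by
    rw [← hev.extDeriv_eq, ← chartForm_extD hs hyt, ← chartForm_extD hα hyt]
    have h1 : chartForm R x₀ y =
      chartForm (extD (fun p => h (chartAt (EuclideanSpace ℝ (Fin n)) x₀ p) • α p)) x₀ y -
      h (chartAt (EuclideanSpace ℝ (Fin n)) x₀ ((chartAt (EuclideanSpace ℝ (Fin n)) x₀).symm y)) •
        chartForm (extD α) x₀ y := rfl
    rw [h1, (chartAt (EuclideanSpace ℝ (Fin n)) x₀).right_inv hyt]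
  rw [coeff, ← hy, hform]
  refine (abs_extDeriv_smul_sub_le ((hh.differentiable (by simp)) y)
    ((hα.contDiffAt hyt).differentiableAt (by simp)) I).trans ?_
  have hBp : ‖chartForm α x₀ y‖ ≤ B := by simpa using hB p hp
  calc ((k : ℝ) + 1) * (‖fderiv ℝ h y‖ * ‖chartForm α x₀ y‖)
      ≤ (k + 1) * (‖fderiv ℝ h y‖ * B) := by gcongr
    _ = (k + 1) * B * ‖fderiv ℝ h y‖ := by ring

end NormBounds

/-! ### Functions with small differential -/

section Capacity

variable {n : ℕ} {M : Type*} [TopologicalSpace M] [ChartedSpace (EuclideanSpace ℝ (Fin n)) M]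
  [RiemannianBundle (fun x : M => TangentSpace (𝓡 n) x)]
  [IsManifold (𝓡 n) ∞ M] [IsContMDiffRiemannianBundle (𝓡 n) ∞ (EuclideanSpace ℝ (Fin n))
    (fun x : M => TangentSpace (𝓡 n) x)]
  [MeasurableSpace M] [BorelSpace M] [SecondCountableTopology M]

theorem lForm_enorm_eq {U : Opens M} {k : ℕ} (a : LForm n U k) : ‖a‖ₑ = lNorm U a.form := by
  rw [← ofReal_norm, LForm.norm_def, ENNReal.ofReal_toReal a.lNorm_form_lt_top.ne]

theorem enorm_pow_eq_lintegral (hn : 1 ≤ n) {U : Opens M} (a : LForm n U 1) :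
    ‖a‖ₑ ^ n = ∫⁻ p in (U : Set M), ENNReal.ofReal (formNorm (a.form p) ^ n) ∂(vol n M) := by
  have hn0 : (n : ℝ) ≠ 0 := by exact_mod_cast (by omega : n ≠ 0)
  have hexp : confExp n 1 = n := by simp [confExp]
  rw [lForm_enorm_eq, lNorm, hexp, eLpNorm_eq_lintegral_rpow_enorm_toReal
    (by exact_mod_cast (by omega : n ≠ 0)) (by simp), ← ENNReal.rpow_natCast, ← ENNReal.rpow_mul]
  simp only [ENNReal.toReal_natCast, one_div, inv_mul_cancel₀ hn0, ENNReal.rpow_one,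
    ENNReal.rpow_natCast]
  refine lintegral_congr fun p => ?_
  rw [Real.enorm_of_nonneg (formNorm_nonneg _), ENNReal.ofReal_pow (formNorm_nonneg _)]

theorem chartForm_apply_basisFun {k : ℕ} (α : FormField n M k) (x : M) (I : Fin k → Fin n)
    {y : EuclideanSpace ℝ (Fin n)} (hy : y ∈ (chartAt (EuclideanSpace ℝ (Fin n)) x).target) :
    (chartForm α x y fun a => EuclideanSpace.basisFun (Fin n) ℝ (I a)) =
      coeff α x I ((chartAt (EuclideanSpace ℝ (Fin n)) x).symm y) := by
  rw [coeff, (chartAt (EuclideanSpace ℝ (Fin n)) x).right_inv hy]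

theorem chartForm_apply_zero (α : FormField n M 0) (x : M) (y : EuclideanSpace ℝ (Fin n)) :
    chartForm α x y 0 = α ((chartAt (EuclideanSpace ℝ (Fin n)) x).symm y) 0 :=
  congrArg (α _) (Subsingleton.elim _ _)

variable {x₀ : M} {U : Opens M}

theorem aemeasurable_chartForm {k : ℕ}
    (hUx : (U : Set M) ⊆ (chartAt (EuclideanSpace ℝ (Fin n)) x₀).source)
    {α : FormField n M k} (hα : MeasurableFormOn (U : Set M) α) (I : Fin k → Fin n) :
    AEMeasurable (fun y => chartForm α x₀ y fun a => EuclideanSpace.basisFun (Fin n) ℝ (I a))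
      ((volume : Measure (EuclideanSpace ℝ (Fin n))).restrict (chartSet x₀ (U : Set M))) := by
  have h := hα x₀ I
  rw [inter_eq_self_of_subset_left hUx] at h
  refine (aemeasurable_comp_chart_symm U.isOpen.measurableSet hUx h).congr ?_
  filter_upwards [ae_restrict_mem (measurableSet_chartSet x₀ U.isOpen.measurableSet)] with y hy
  exact (chartForm_apply_basisFun α x₀ I hy.1).symm

theorem chartSet_eq_image {K : Set M}
    (hKx : K ⊆ (chartAt (EuclideanSpace ℝ (Fin n)) x₀).source) :
    chartSet x₀ K = (chartAt (EuclideanSpace ℝ (Fin n)) x₀) '' K := by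
  ext y
  constructor
  · rintro ⟨h1, h2⟩
    exact ⟨_, h2, (chartAt (EuclideanSpace ℝ (Fin n)) x₀).right_inv h1⟩
  · rintro ⟨p, hp, rfl⟩
    refine ⟨(chartAt (EuclideanSpace ℝ (Fin n)) x₀).map_source (hKx hp), ?_⟩
    rw [mem_preimage, (chartAt (EuclideanSpace ℝ (Fin n)) x₀).left_inv (hKx hp)]
    exact hp

theorem isCompact_chartSet {K : Set M} (hK : IsCompact K)
    (hKx : K ⊆ (chartAt (EuclideanSpace ℝ (Fin n)) x₀).source) :
    IsCompact (chartSet (n := n) x₀ K) := by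
  rw [chartSet_eq_image hKx]
  exact hK.image_of_continuousOn
    ((chartAt (EuclideanSpace ℝ (Fin n)) x₀).continuousOn.mono hKx)

theorem chartSet_mono {A B : Set M} (h : A ⊆ B) : chartSet (n := n) x₀ A ⊆ chartSet x₀ B :=
  inter_subset_inter_right _ (preimage_mono h)

theorem volume_chartSet_ne_top (hUc : IsCompact (closure (U : Set M)))
    (hUx : closure (U : Set M) ⊆ (chartAt (EuclideanSpace ℝ (Fin n)) x₀).source) :
    (volume : Measure (EuclideanSpace ℝ (Fin n))) (chartSet x₀ (U : Set M)) ≠ ⊤ :=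
  ((measure_mono (chartSet_mono subset_closure)).trans_lt
    (isCompact_chartSet hUc hUx).measure_lt_top).ne

/-- The `Lⁿ`-norm of the coefficients of a form of degree one is controlled by its norm. -/
theorem exists_lintegral_coeff_pow_le (hUc : IsCompact (closure (U : Set M)))
    (hUx : closure (U : Set M) ⊆ (chartAt (EuclideanSpace ℝ (Fin n)) x₀).source) (hn : 1 ≤ n) :
    ∃ C : ℝ≥0∞, C ≠ ⊤ ∧
    ∀ (a : LForm n U 1) (i : Fin n),
      ∫⁻ y in chartSet x₀ (U : Set M), ‖chartForm a.form x₀ y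
        fun _ => EuclideanSpace.basisFun (Fin n) ℝ i‖ₑ ^ n ≤ C * ‖a‖ₑ ^ n := by
  obtain ⟨B, hB0, hB⟩ := exists_coeff_le_formNorm (n := n) 1 hUc hUx
  obtain ⟨c, _, hc, -, hcb⟩ := exists_volDensity_bounds hUc hUx
  have hUm : MeasurableSet (U : Set M) := U.isOpen.measurableSet
  have hUx' := subset_closure.trans hUx
  refine ⟨(ENNReal.ofReal c)⁻¹ * ENNReal.ofReal B ^ n, ENNReal.mul_ne_top
    (ENNReal.inv_ne_top.2 (by simpa using hc)) (ENNReal.pow_ne_top ENNReal.ofReal_ne_top),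
    fun a i => ?_⟩
  have hm : AEMeasurable (fun p => ENNReal.ofReal (formNorm (a.form p) ^ n))
      ((vol n M).restrict (U : Set M)) :=
    (a.measurable_form.aemeasurable_formNorm.pow_const n).ennreal_ofReal
  rw [enorm_pow_eq_lintegral hn, lintegral_vol_eq hUm hUx' hm]
  have hpt : ∀ y ∈ chartSet x₀ (U : Set M), ‖chartForm a.form x₀ y
        fun _ => EuclideanSpace.basisFun (Fin n) ℝ i‖ₑ ^ n ≤
      (ENNReal.ofReal c)⁻¹ * ENNReal.ofReal B ^ n * (ENNReal.ofReal (volDensity n x₀ y) *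
        ENNReal.ofReal (formNorm (a.form
          ((chartAt (EuclideanSpace ℝ (Fin n)) x₀).symm y)) ^ n)) := by
    intro y hy
    have h1 := hB a.form (fun _ => i) _ (subset_closure hy.2)
    rw [← chartForm_apply_basisFun a.form x₀ (fun _ => i) hy.1] at h1
    have h2 : ‖chartForm a.form x₀ y fun _ => EuclideanSpace.basisFun (Fin n) ℝ i‖ₑ ≤
        ENNReal.ofReal B * ENNReal.ofReal (formNorm (a.form
          ((chartAt (EuclideanSpace ℝ (Fin n)) x₀).symm y))) := by
      rw [← ofReal_norm, ← ENNReal.ofReal_mul hB0]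
      exact ENNReal.ofReal_le_ofReal h1
    have h3 : 1 ≤ (ENNReal.ofReal c)⁻¹ * ENNReal.ofReal (volDensity n x₀ y) := by
      rw [← ENNReal.inv_mul_cancel (a := ENNReal.ofReal c) (by simpa using hc)
        ENNReal.ofReal_ne_top]
      gcongr
      exact (hcb y (chartSet_mono subset_closure hy)).1
    calc _ ≤ (ENNReal.ofReal B * ENNReal.ofReal (formNorm (a.form
          ((chartAt (EuclideanSpace ℝ (Fin n)) x₀).symm y)))) ^ n := pow_le_pow_left' h2 n
      _ = ENNReal.ofReal B ^ n * ENNReal.ofReal (formNorm (a.form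
          ((chartAt (EuclideanSpace ℝ (Fin n)) x₀).symm y)) ^ n) := by
          rw [mul_pow, ENNReal.ofReal_pow (formNorm_nonneg _)]
      _ ≤ ((ENNReal.ofReal c)⁻¹ * ENNReal.ofReal (volDensity n x₀ y)) *
          (ENNReal.ofReal B ^ n * ENNReal.ofReal (formNorm (a.form
          ((chartAt (EuclideanSpace ℝ (Fin n)) x₀).symm y)) ^ n)) :=
          le_mul_of_one_le_left' h3
      _ = _ := by ring
  refine (setLIntegral_mono' (measurableSet_chartSet x₀ hUm) hpt).trans (le_of_eq ?_)
  rw [lintegral_const_mul' _ _ (ENNReal.mul_ne_top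
    (ENNReal.inv_ne_top.2 (by simpa using hc)) (ENNReal.pow_ne_top ENNReal.ofReal_ne_top))]

theorem exists_lintegral_coeff_le (hUc : IsCompact (closure (U : Set M)))
    (hUx : closure (U : Set M) ⊆ (chartAt (EuclideanSpace ℝ (Fin n)) x₀).source) (hn : 1 ≤ n) :
    ∃ C : ℝ≥0∞, C ≠ ⊤ ∧
    ∀ (a : LForm n U 1) (i : Fin n),
      ∫⁻ y in chartSet x₀ (U : Set M), ‖chartForm a.form x₀ y
        fun _ => EuclideanSpace.basisFun (Fin n) ℝ i‖ₑ ≤ C * ‖a‖ₑ := by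
  obtain ⟨C, hC, h⟩ := exists_lintegral_coeff_pow_le hUc hUx hn
  have hn1 : (1 : ℝ) ≤ n := by exact_mod_cast hn
  have hn0 : (n : ℝ) ≠ 0 := by linarith
  set μ := (volume : Measure (EuclideanSpace ℝ (Fin n))).restrict (chartSet x₀ (U : Set M)) with hμ
  have hfin : μ univ ≠ ⊤ := by
    rw [hμ, Measure.restrict_apply_univ]
    exact volume_chartSet_ne_top hUc hUx
  refine ⟨C ^ (1 / (n : ℝ)) * μ univ ^ (1 - 1 / (n : ℝ)), ENNReal.mul_ne_top
    (ENNReal.rpow_ne_top_of_nonneg (by positivity) hC)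
    (ENNReal.rpow_ne_top_of_nonneg ?_ hfin), fun a i => ?_⟩
  · rw [sub_nonneg, div_le_one (by linarith)]
    exact hn1
  have hm : AEStronglyMeasurable (fun y => chartForm a.form x₀ y
        fun _ => EuclideanSpace.basisFun (Fin n) ℝ i) μ :=
    (aemeasurable_chartForm (subset_closure.trans hUx) a.measurable_form
      fun _ => i).aestronglyMeasurable
  have h1 := eLpNorm_le_eLpNorm_mul_rpow_measure_univ (μ := μ) (p := 1) (q := n)
    (by exact_mod_cast hn) hm
  rw [eLpNorm_one_eq_lintegral_enorm, eLpNorm_eq_lintegral_rpow_enorm_toReal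
    (by exact_mod_cast (by omega : n ≠ 0)) (by simp)] at h1
  simp only [ENNReal.toReal_natCast, ENNReal.rpow_natCast, ENNReal.toReal_one, div_one] at h1
  refine h1.trans ?_
  have h2 : (∫⁻ y, ‖chartForm a.form x₀ y
        fun _ => EuclideanSpace.basisFun (Fin n) ℝ i‖ₑ ^ n ∂μ) ^ (1 / (n : ℝ)) ≤
      C ^ (1 / (n : ℝ)) * ‖a‖ₑ := by
    refine (ENNReal.rpow_le_rpow (h a i) (by positivity)).trans (le_of_eq ?_)
    rw [ENNReal.mul_rpow_of_nonneg _ _ (by positivity), ← ENNReal.rpow_natCast,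
      ← ENNReal.rpow_mul, mul_one_div_cancel hn0, ENNReal.rpow_one]
  calc _ ≤ C ^ (1 / (n : ℝ)) * ‖a‖ₑ * μ univ ^ (1 - 1 / (n : ℝ)) := by gcongr
    _ = _ := by ring

theorem integrableOn_chartForm_one (hUc : IsCompact (closure (U : Set M)))
    (hUx : closure (U : Set M) ⊆ (chartAt (EuclideanSpace ℝ (Fin n)) x₀).source) (hn : 1 ≤ n)
    (a : LForm n U 1) (i : Fin n) :
    IntegrableOn (fun y => chartForm a.form x₀ y fun _ => EuclideanSpace.basisFun (Fin n) ℝ i)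
      (chartSet x₀ (U : Set M)) := by
  obtain ⟨C, hC, h⟩ := exists_lintegral_coeff_le hUc hUx hn
  refine ⟨(aemeasurable_chartForm (subset_closure.trans hUx) a.measurable_form
      fun _ => i).aestronglyMeasurable, ?_⟩
  exact (h a i).trans_lt (ENNReal.mul_lt_top hC.lt_top enorm_lt_top)

theorem ae_abs_chartForm_zero_le
    (hUx : closure (U : Set M) ⊆ (chartAt (EuclideanSpace ℝ (Fin n)) x₀).source) (u : LForm n U 0) :
    ∀ᵐ y ∂(volume : Measure (EuclideanSpace ℝ (Fin n))).restrict (chartSet x₀ (U : Set M)),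
      |chartForm u.form x₀ y 0| ≤ ‖u‖ := by
  have hUm : MeasurableSet (U : Set M) := U.isOpen.measurableSet
  have h1 : ∀ᵐ p ∂(vol n M).restrict (U : Set M), formNorm (u.form p) ≤ ‖u‖ := by
    have h2 := enorm_ae_le_eLpNormEssSup (fun p => formNorm (u.form p))
      ((vol n M).restrict (U : Set M))
    have h3 : eLpNormEssSup (fun p => formNorm (u.form p)) ((vol n M).restrict (U : Set M)) =
        ‖u‖ₑ := by
      rw [lForm_enorm_eq, lNorm, confExp, if_pos rfl, eLpNorm_exponent_top]
    filter_upwards [h2] with p hp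
    rw [h3, Real.enorm_of_nonneg (formNorm_nonneg _), ← ofReal_norm] at hp
    exact (ENNReal.ofReal_le_ofReal_iff (norm_nonneg _)).1 hp
  filter_upwards [ae_chartSet_of_ae hUm (subset_closure.trans hUx) h1] with y hy
  rwa [formNorm_degree_zero, ← chartForm_apply_zero] at hy

theorem integrableOn_chartForm_zero (hUc : IsCompact (closure (U : Set M)))
    (hUx : closure (U : Set M) ⊆ (chartAt (EuclideanSpace ℝ (Fin n)) x₀).source) (u : LForm n U 0) :
    IntegrableOn (fun y => chartForm u.form x₀ y 0) (chartSet x₀ (U : Set M)) := by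
  have hm : AEMeasurable (fun y => chartForm u.form x₀ y 0)
      ((volume : Measure (EuclideanSpace ℝ (Fin n))).restrict (chartSet x₀ (U : Set M))) := by
    refine (aemeasurable_chartForm (subset_closure.trans hUx) u.measurable_form
      Fin.elim0).congr (ae_of_all _ fun y => ?_)
    exact congrArg _ (Subsingleton.elim _ _)
  exact IntegrableOn.of_bound (volume_chartSet_ne_top hUc hUx).lt_top hm.aestronglyMeasurable ‖u‖
    (ae_abs_chartForm_zero_le hUx u)

theorem continuous_integral_chartForm_zero (hUc : IsCompact (closure (U : Set M)))
    (hUx : closure (U : Set M) ⊆ (chartAt (EuclideanSpace ℝ (Fin n)) x₀).source) :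
    Continuous fun u : LForm n U 0 => ∫ y in chartSet x₀ (U : Set M), chartForm u.form x₀ y 0 := by
  let I : LForm n U 0 →ₗ[ℝ] ℝ :=
    { toFun := fun u => ∫ y in chartSet x₀ (U : Set M), chartForm u.form x₀ y 0
      map_add' := fun u v => by
        rw [← integral_add (integrableOn_chartForm_zero hUc hUx u)
          (integrableOn_chartForm_zero hUc hUx v)]
        rfl
      map_smul' := fun c u => by
        rw [RingHom.id_apply, smul_eq_mul, ← integral_const_mul]
        rfl }
  refine AddMonoidHomClass.continuous_of_bound I
    ((volume : Measure (EuclideanSpace ℝ (Fin n))).real (chartSet x₀ (U : Set M))) fun u => ?_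
  rw [mul_comm]
  exact norm_setIntegral_le_of_norm_le_const_ae
    (μ := (volume : Measure (EuclideanSpace ℝ (Fin n))))
    (f := fun y => chartForm u.form x₀ y 0) (volume_chartSet_ne_top hUc hUx).lt_top
    (ae_abs_chartForm_zero_le hUx u)

variable [T2Space M]

/-- A Poincaré inequality. For a function `u` with compact support, testing its weak differential
against a coordinate function `y₁` gives `∫ u = ∫ u ∂₁y₁ = -∫ y₁ ∂₁u`. The first integral has no
absolute value inside, which is harmless for the nonnegative functions of the capacity. -/
theorem exists_integral_le_of_mem_royden₀ (hUc : IsCompact (closure (U : Set M)))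
    (hUx : closure (U : Set M) ⊆ (chartAt (EuclideanSpace ℝ (Fin n)) x₀).source) (hn : 1 ≤ n) :
    ∃ C : ℝ≥0∞, C ≠ ⊤ ∧
    ∀ p ∈ royden₀ n U,
      ‖∫ y in chartSet x₀ (U : Set M), chartForm p.1.form x₀ y 0‖ₑ ≤ C * ‖p.2‖ₑ := by
  have hUx' := subset_closure.trans hUx
  have hUm : MeasurableSet (U : Set M) := U.isOpen.measurableSet
  obtain ⟨κ, hκ⟩ := exists_weak_partial_derivative hn x₀
  obtain ⟨C, hC, hCb⟩ := exists_lintegral_coeff_le hUc hUx hn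
  obtain ⟨R, hR⟩ := (isCompact_chartSet (n := n) hUc hUx).isBounded.exists_norm_le
  let i₀ : Fin n := ⟨0, by omega⟩
  refine ⟨ENNReal.ofReal (|κ i₀| * |R|) * C, ENNReal.mul_ne_top ENNReal.ofReal_ne_top hC, ?_⟩
  -- the estimate passes to limits, so functions with compact support suffice
  have hclosed : IsClosed {p : LForm n U 0 × LForm n U 1 |
      ‖∫ y in chartSet x₀ (U : Set M), chartForm p.1.form x₀ y 0‖ₑ ≤
        ENNReal.ofReal (|κ i₀| * |R|) * C * ‖p.2‖ₑ} := by
    refine isClosed_le ?_ ?_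
    · exact continuous_enorm.comp
        ((continuous_integral_chartForm_zero hUc hUx).comp continuous_fst)
    · exact (ENNReal.continuous_const_mul
        (ENNReal.mul_ne_top ENNReal.ofReal_ne_top hC)).comp (continuous_enorm.comp continuous_snd)
  intro p hp
  refine closure_minimal ?_ hclosed hp.2
  rintro ⟨u, du⟩ ⟨hw, v, hvc, hvs, hvU, hv⟩
  simp only [mem_ofPred_eq]
  -- a cut-off function equal to one on the support
  set s := chartSet (n := n) x₀ (tsupport v) with hs
  have hsc : IsCompact s := isCompact_chartSet hvs (hvU.trans hUx')
  have hΩ : IsOpen (chartSet (n := n) x₀ (U : Set M)) := isOpen_chartSet x₀ U.isOpen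
  obtain ⟨t, htc, hst, htΩ⟩ := exists_compact_between hsc hΩ (chartSet_mono hvU)
  obtain ⟨χ, hχ1, hχ0, hχb⟩ := exists_contMDiffMap_one_nhds_of_subset_interior (n := (⊤ : ℕ∞))
    (I := 𝓘(ℝ, EuclideanSpace ℝ (Fin n))) hsc.isClosed hst
  have hχsm : ContDiff ℝ ∞ χ := χ.contMDiff.contDiff
  set ψ : EuclideanSpace ℝ (Fin n) → ℝ := fun y => χ y * y i₀ with hψ
  have hcoord : ContDiff ℝ ∞ fun y : EuclideanSpace ℝ (Fin n) => y i₀ :=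
    (EuclideanSpace.proj (𝕜 := ℝ) i₀ : EuclideanSpace ℝ (Fin n) →L[ℝ] ℝ).contDiff
  have hψsm : ContDiff ℝ ∞ ψ := hχsm.mul hcoord
  have hψt : tsupport ψ ⊆ t := by
    refine closure_minimal (fun y hy => ?_) htc.isClosed
    by_contra hcon
    exact hy (by simp [hψ, hχ0 y hcon])
  have hψc : HasCompactSupport ψ := htc.of_isClosed_subset (isClosed_tsupport _) hψt
  have hid := hκ U hUx' u.form du.form hw ψ hψsm hψc (hψt.trans htΩ) i₀
  have hleft : ∫ y in chartSet x₀ (U : Set M), chartForm u.form x₀ y 0 *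
      fderiv ℝ ψ y (EuclideanSpace.basisFun (Fin n) ℝ i₀) =
      ∫ y in chartSet x₀ (U : Set M), chartForm u.form x₀ y 0 := by
    refine setIntegral_congr_fun (measurableSet_chartSet x₀ hUm) fun y hy => ?_
    by_cases hys : y ∈ s
    · have h1 : ψ =ᶠ[𝓝 y] fun y => y i₀ := by
        filter_upwards [hχ1.filter_mono (nhds_le_nhdsSet hys)] with z hz
        simp [hψ, hz]
      have h2 : fderiv ℝ (fun y : EuclideanSpace ℝ (Fin n) => y i₀) y =
          (EuclideanSpace.proj (𝕜 := ℝ) i₀ : EuclideanSpace ℝ (Fin n) →L[ℝ] ℝ) :=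
        (EuclideanSpace.proj (𝕜 := ℝ) i₀ : EuclideanSpace ℝ (Fin n) →L[ℝ] ℝ).fderiv
      rw [h1.fderiv_eq, h2]
      simp
    · have h1 : chartForm u.form x₀ y 0 = 0 := by
        have h2 : chartForm u.form x₀ y 0 =
            v ((chartAt (EuclideanSpace ℝ (Fin n)) x₀).symm y) := by
          rw [hv]; rfl
        rw [h2]
        exact image_eq_zero_of_notMem_tsupport fun hmem => hys ⟨hy.1, hmem⟩
      rw [h1, zero_mul]
  rw [hleft] at hid
  rw [hid, enorm_neg]
  refine (enorm_integral_le_lintegral_enorm _).trans ?_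
  have hpt : ∀ y ∈ chartSet x₀ (U : Set M), ‖(κ i₀ * chartForm du.form x₀ y
      fun _ => EuclideanSpace.basisFun (Fin n) ℝ i₀) * ψ y‖ₑ ≤
      ENNReal.ofReal (|κ i₀| * |R|) * ‖chartForm du.form x₀ y
        fun _ => EuclideanSpace.basisFun (Fin n) ℝ i₀‖ₑ := by
    intro y hy
    have hψb : |ψ y| ≤ |R| := by
      rw [hψ, abs_mul, abs_of_nonneg (hχb y).1]
      refine (mul_le_of_le_one_left (abs_nonneg _) (hχb y).2).trans ?_
      exact ((PiLp.norm_apply_le y i₀).trans (hR y (chartSet_mono subset_closure hy))).trans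
        (le_abs_self R)
    rw [← ofReal_norm, ← ofReal_norm, ← ENNReal.ofReal_mul (by positivity)]
    apply ENNReal.ofReal_le_ofReal
    rw [norm_mul, norm_mul, Real.norm_eq_abs, Real.norm_eq_abs (ψ y)]
    rw [mul_right_comm]
    gcongr
  refine (setLIntegral_mono' (measurableSet_chartSet x₀ hUm) hpt).trans ?_
  rw [lintegral_const_mul' _ _ ENNReal.ofReal_ne_top, mul_assoc]
  gcongr
  exact hCb du i₀

end Capacity

/-! ### Cut-off functions of conformally polar sets -/

section Polar

variable {n : ℕ} {M : Type*} [TopologicalSpace M] [ChartedSpace (EuclideanSpace ℝ (Fin n)) M]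
  [RiemannianBundle (fun x : M => TangentSpace (𝓡 n) x)]
  [IsManifold (𝓡 n) ∞ M] [IsContMDiffRiemannianBundle (𝓡 n) ∞ (EuclideanSpace ℝ (Fin n))
    (fun x : M => TangentSpace (𝓡 n) x)]

/-- Every point has relatively compact neighbourhoods `U₁ ⊆ U₂` in the domain of its chart, as in the
definition of conformally polar sets: the distance from `U₁` to the complement of `U₂` is positive. -/
theorem exists_nhds_pair [T2Space M] (x₀ : M) : ∃ U₁ U₂ : Opens M, x₀ ∈ U₁ ∧ U₁ ≤ U₂ ∧
    IsCompact (closure (U₁ : Set M)) ∧ IsCompact (closure (U₂ : Set M)) ∧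
    closure (U₂ : Set M) ⊆ (chartAt (EuclideanSpace ℝ (Fin n)) x₀).source ∧
    0 < (⨅ x ∈ U₁, ⨅ y ∉ U₂, Manifold.riemannianEDist (𝓡 n) x y) := by
  have : LocallyCompactSpace M := ChartedSpace.locallyCompactSpace (EuclideanSpace ℝ (Fin n)) M
  have : IsManifold (𝓡 n) 1 M := IsManifold.of_le (n := ∞) (by simp)
  have hc : IsContinuousRiemannianBundle (EuclideanSpace ℝ (Fin n))
      (fun x : M => TangentSpace (𝓡 n) x) := by
    obtain ⟨g, hg, h⟩ := IsContMDiffRiemannianBundle.exists_contMDiff (IB := 𝓡 n) (n := ∞)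
      (F := EuclideanSpace ℝ (Fin n)) (E := fun x : M => TangentSpace (𝓡 n) x)
    exact ⟨g, hg.continuous, h⟩
  obtain ⟨V, hVo, hV, hVs, hVc⟩ := exists_open_between_and_isCompact_closure
    (isCompact_singleton (x := x₀)) (chartAt (EuclideanSpace ℝ (Fin n)) x₀).open_source
    (singleton_subset_iff.2 (mem_chart_source _ x₀))
  obtain ⟨c, hc0, hcV⟩ := setOfPred_riemannianEDist_lt_subset_nhds' (𝓡 n)
    (hVo.mem_nhds (singleton_subset_iff.1 hV))
  have hc2 : 0 < c / 2 := ENNReal.half_pos hc0.ne'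
  obtain ⟨W, hW, hWo, hxW⟩ := eventually_nhds_iff.1
    (eventually_riemannianEDist_lt (𝓡 n) x₀ hc2)
  refine ⟨⟨W ∩ V, hWo.inter hVo⟩, ⟨V, hVo⟩, ⟨hxW, singleton_subset_iff.1 hV⟩, fun x hx => hx.2,
    hVc.of_isClosed_subset isClosed_closure (closure_mono inter_subset_right), hVc, hVs,
    hc2.trans_le (le_iInf₂ fun x hx => le_iInf₂ fun y hy => ?_)⟩
  by_contra hcon
  push Not at hcon
  refine hy (hcV (show Manifold.riemannianEDist (𝓡 n) x₀ y < c from ?_))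
  calc Manifold.riemannianEDist (𝓡 n) x₀ y ≤
        Manifold.riemannianEDist (𝓡 n) x₀ x + Manifold.riemannianEDist (𝓡 n) x y :=
        Manifold.riemannianEDist_triangle
    _ < c / 2 + c / 2 := ENNReal.add_lt_add (hW x hx.1) hcon
    _ = c := ENNReal.add_halves c

variable [MeasurableSpace M] [BorelSpace M] [SecondCountableTopology M] [T2Space M]

/-- Integrals over a compact subset of a chart domain are controlled by integrals over its image. -/
theorem exists_lintegral_le_chartSet {x₀ : M} {K : Set M} (hK : IsCompact K)
    (hKx : K ⊆ (chartAt (EuclideanSpace ℝ (Fin n)) x₀).source) :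
    ∃ C : ℝ≥0∞, C ≠ ⊤ ∧ ∀ f : EuclideanSpace ℝ (Fin n) → ℝ≥0∞, Measurable f →
      ∫⁻ p in K, f (chartAt (EuclideanSpace ℝ (Fin n)) x₀ p) ∂(vol n M) ≤
        C * ∫⁻ y in chartSet x₀ K, f y := by
  obtain ⟨_, C, -, -, hb⟩ := exists_volDensity_bounds (n := n) hK hKx
  refine ⟨ENNReal.ofReal C, ENNReal.ofReal_ne_top, fun f hf => ?_⟩
  have hm : AEMeasurable (fun p => f (chartAt (EuclideanSpace ℝ (Fin n)) x₀ p))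
      ((vol n M).restrict K) :=
    hf.comp_aemeasurable (((chartAt (EuclideanSpace ℝ (Fin n)) x₀).continuousOn.mono
      hKx).aemeasurable hK.measurableSet)
  rw [lintegral_vol_eq hK.measurableSet hKx hm, ← lintegral_const_mul' _ _ ENNReal.ofReal_ne_top]
  refine setLIntegral_mono' (measurableSet_chartSet x₀ hK.measurableSet) fun y hy => ?_
  rw [(chartAt (EuclideanSpace ℝ (Fin n)) x₀).right_inv hy.1]
  gcongr
  exact (hb y hy).2

/-- Near every point there are smooth cut-off functions, equal to `1` near the conformally polar set
`S`, which are small in `L¹` and have a small gradient in `Lⁿ`. -/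
theorem IsConformallyPolar.exists_cutoff (hn : 1 ≤ n) {S : Set M} (hS : IsClosed S)
    (hpolar : IsConformallyPolar n S) (x₀ : M) : ∃ U₁ : Opens M, x₀ ∈ U₁ ∧
    (U₁ : Set M) ⊆ (chartAt (EuclideanSpace ℝ (Fin n)) x₀).source ∧
    ∀ K : Set M, IsCompact K → K ⊆ U₁ → ∀ ε : ℝ≥0∞, 0 < ε →
      ∃ ψ : EuclideanSpace ℝ (Fin n) → ℝ, ContDiff ℝ ∞ ψ ∧ (∀ y, 0 ≤ ψ y ∧ ψ y ≤ 1) ∧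
        (∃ N : Opens M, S ∩ K ⊆ N ∧ ∀ p ∈ N, ψ (chartAt (EuclideanSpace ℝ (Fin n)) x₀ p) = 1) ∧
        ∫⁻ p in K, ‖ψ (chartAt (EuclideanSpace ℝ (Fin n)) x₀ p)‖ₑ ∂(vol n M) ≤ ε ∧
        ∫⁻ p in K, ‖fderiv ℝ ψ (chartAt (EuclideanSpace ℝ (Fin n)) x₀ p)‖ₑ ^ n ∂(vol n M) ≤ ε := by
  obtain ⟨U₁, U₂, hx₀, h12, hU₁c, hU₂c, hU₂x, hdist⟩ := exists_nhds_pair (n := n) x₀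
  have hU₂x' := subset_closure.trans hU₂x
  have hU₁x : (U₁ : Set M) ⊆ (chartAt (EuclideanSpace ℝ (Fin n)) x₀).source :=
    (SetLike.coe_subset_coe.2 h12).trans hU₂x'
  refine ⟨U₁, hx₀, hU₁x, fun K hK hKU ε hε => ?_⟩
  have hcap := hpolar U₁ U₂ h12 hU₁c hU₂c hdist
  have hKx := hKU.trans hU₁x
  have hU₂m : MeasurableSet (U₂ : Set M) := U₂.isOpen.measurableSet
  obtain ⟨κ, hκ⟩ := exists_weak_partial_derivative hn x₀
  obtain ⟨CP, hCP, hP⟩ := exists_integral_le_of_mem_royden₀ hU₂c hU₂x hn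
  obtain ⟨CG, hCG, hG⟩ := exists_lintegral_coeff_pow_le hU₂c hU₂x hn
  obtain ⟨CM, hCM, hM⟩ := exists_smooth_cutoff hn
  obtain ⟨CK, hCK, hKb⟩ := exists_lintegral_le_chartSet (n := n) hK hKx
  set A : ℝ≥0∞ := CK * (4 * CP) with hA
  set B : ℝ≥0∞ := CK * (CM * ∑ i, (‖κ i‖ₑ ^ n * CG)) with hB
  have hAtop : A ≠ ⊤ := ENNReal.mul_ne_top hCK (ENNReal.mul_ne_top (by simp) hCP)
  have hBtop : B ≠ ⊤ := ENNReal.mul_ne_top hCK (ENNReal.mul_ne_top hCM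
    (ENNReal.sum_ne_top.2 fun i _ => ENNReal.mul_ne_top
      (ENNReal.pow_ne_top (by simp)) hCG))
  -- the final bounds are `A t` and `B tⁿ` for an admissible function with differential of norm `≤ t`
  obtain ⟨t, ht0, htA, htB⟩ : ∃ t : ℝ≥0∞, 0 < t ∧ A * t ≤ ε ∧ B * t ^ n ≤ ε := by
    have h1 : Tendsto (fun t : ℝ≥0∞ => A * t) (𝓝[>] 0) (𝓝 0) := by
      have := (ENNReal.continuous_const_mul hAtop).tendsto 0
      rw [mul_zero] at this
      exact this.mono_left nhdsWithin_le_nhds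
    have h2 : Tendsto (fun t : ℝ≥0∞ => B * t ^ n) (𝓝[>] 0) (𝓝 0) := by
      have := ((ENNReal.continuous_const_mul hBtop).comp (ENNReal.continuous_pow n)).tendsto 0
      simp only [Function.comp, zero_pow (show n ≠ 0 by omega), mul_zero] at this
      exact this.mono_left nhdsWithin_le_nhds
    obtain ⟨t, ⟨h3, h4⟩, h5⟩ := (((h1.eventually (gt_mem_nhds hε)).and
      (h2.eventually (gt_mem_nhds hε))).and self_mem_nhdsWithin).exists
    exact ⟨t, h5, le_of_lt h3, le_of_lt h4⟩
  have htn : (0 : ℝ≥0∞) < t ^ n := ENNReal.pow_pos ht0 n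
  rw [← hcap] at htn
  obtain ⟨p, hp⟩ := iInf_lt_iff.1 htn
  obtain ⟨⟨hroy, hpos, W, hFW, hW1⟩, hpt⟩ := iInf_lt_iff.1 hp
  rw [← enorm_pow_eq_lintegral hn] at hpt
  have hpt' : ‖p.2‖ₑ ≤ t := by
    by_contra hcon
    push Not at hcon
    exact absurd hpt (not_lt.2 (pow_le_pow_left' hcon.le n))
  set Ω := chartSet (n := n) x₀ (U₂ : Set M) with hΩ
  have hΩo : IsOpen Ω := isOpen_chartSet x₀ U₂.isOpen
  have hKs := isCompact_chartSet (n := n) hK hKx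
  have hSK : IsCompact (S ∩ K) := hK.inter_left hS
  have hSKx : S ∩ K ⊆ (chartAt (EuclideanSpace ℝ (Fin n)) x₀).source :=
    inter_subset_right.trans hKx
  have hfpos : ∀ᵐ y ∂volume.restrict Ω, 0 ≤ chartForm p.1.form x₀ y 0 := by
    filter_upwards [ae_chartSet_of_ae hU₂m hU₂x' hpos] with y hy
    rwa [chartForm_apply_zero]
  have hf1 : ∀ᵐ y ∂volume.restrict (Ω ∩ chartSet (n := n) x₀ (W : Set M)),
      1 ≤ chartForm p.1.form x₀ y 0 := by
    have h1 := ae_chartSet_of_ae (hU₂m.inter W.isOpen.measurableSet)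
      (inter_subset_left.trans hU₂x') hW1
    have h2 : chartSet (n := n) x₀ ((U₂ : Set M) ∩ (W : Set M)) =
        Ω ∩ chartSet (n := n) x₀ (W : Set M) := by
      ext y
      simp only [hΩ, chartSet, mem_inter_iff, mem_preimage]
      tauto
    rw [h2] at h1
    filter_upwards [h1] with y hy
    rwa [chartForm_apply_zero]
  -- mollify and truncate the admissible function, read in the chart
  obtain ⟨ψ, hψ, hψb, ⟨N, hNo, hKN, hN1⟩, hψ1, hψ2⟩ := hM Ω (chartSet x₀ (W : Set M))
    (chartSet x₀ K) (chartSet x₀ (S ∩ K)) (fun y => chartForm p.1.form x₀ y 0)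
    (fun i y => κ i * chartForm p.2.form x₀ y fun _ => EuclideanSpace.basisFun (Fin n) ℝ i)
    hΩo (isOpen_chartSet x₀ W.isOpen) hKs
    (chartSet_mono (hKU.trans (SetLike.coe_subset_coe.2 h12))) (isCompact_chartSet hSK hSKx)
    (subset_inter (chartSet_mono (inter_subset_right.trans
      (hKU.trans (SetLike.coe_subset_coe.2 h12))))
      (chartSet_mono ((inter_subset_inter_right S hKU).trans hFW)))
    (integrableOn_chartForm_zero hU₂c hU₂x p.1)
    (fun i => (integrableOn_chartForm_one hU₂c hU₂x hn p.2 i).const_mul _)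
    (fun ψ hψ hψc hψs i => hκ U₂ hU₂x' _ _ hroy.1 ψ hψ hψc hψs i) hfpos hf1
  have hψm : Measurable fun y => ‖ψ y‖ₑ := hψ.continuous.measurable.enorm
  have hψm' : Measurable fun y => ‖fderiv ℝ ψ y‖ₑ ^ n :=
    (hψ.continuous_fderiv (by simp)).measurable.enorm.pow_const n
  refine ⟨ψ, hψ, hψb, ⟨⟨(chartAt (EuclideanSpace ℝ (Fin n)) x₀).source ∩
    chartAt (EuclideanSpace ℝ (Fin n)) x₀ ⁻¹' N,
      (chartAt (EuclideanSpace ℝ (Fin n)) x₀).isOpen_inter_preimage hNo⟩, ?_, fun q hq => hN1 _ hq.2⟩,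
    ?_, ?_⟩
  · intro q hq
    refine ⟨hSKx hq, hKN ?_⟩
    rw [chartSet_eq_image hSKx]
    exact mem_image_of_mem _ hq
  · refine (hKb _ hψm).trans ?_
    -- as `u ≥ 0`, its `L¹`-norm is its integral
    have hint : ∫⁻ y in Ω, ‖chartForm p.1.form x₀ y 0‖ₑ ≤ CP * ‖p.2‖ₑ := by
      refine le_trans (le_of_eq ?_) (hP p hroy)
      rw [Real.enorm_of_nonneg (integral_nonneg_of_ae hfpos),
        ofReal_integral_eq_lintegral_ofReal (integrableOn_chartForm_zero hU₂c hU₂x p.1) hfpos]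
      refine lintegral_congr_ae ?_
      filter_upwards [hfpos] with y hy
      rw [Real.enorm_of_nonneg hy]
    calc CK * ∫⁻ y in chartSet x₀ K, ‖ψ y‖ₑ
        ≤ CK * (4 * (CP * t)) := by
          gcongr
          refine hψ1.trans ?_
          gcongr
          refine hint.trans ?_
          gcongr
      _ = A * t := by rw [hA]; ring
      _ ≤ ε := htA
  · refine (hKb _ hψm').trans ?_
    calc CK * ∫⁻ y in chartSet x₀ K, ‖fderiv ℝ ψ y‖ₑ ^ n
        ≤ CK * (CM * ∑ i, (‖κ i‖ₑ ^ n * CG) * t ^ n) := by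
          gcongr
          refine hψ2.trans ?_
          gcongr with i
          simp only [enorm_mul, mul_pow]
          rw [lintegral_const_mul' _ _ (ENNReal.pow_ne_top (by simp)), mul_assoc]
          gcongr
          refine (hG p.2 i).trans ?_
          gcongr
      _ = B * t ^ n := by rw [hB, ← Finset.sum_mul]; ring
      _ ≤ ε := htB

/-- Closed conformally polar sets are null sets. -/
theorem IsConformallyPolar.vol_eq_zero (hn : 1 ≤ n) {S : Set M} (hS : IsClosed S)
    (hpolar : IsConformallyPolar n S) : vol n M S = 0 := by
  have : LocallyCompactSpace M := ChartedSpace.locallyCompactSpace (EuclideanSpace ℝ (Fin n)) M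
  refine measure_null_of_locally_null S fun x _ => ?_
  obtain ⟨U₁, hx, hU₁, hcut⟩ := hpolar.exists_cutoff hn hS x
  obtain ⟨K, hKx, hKU, hK⟩ := local_compact_nhds (U₁.isOpen.mem_nhds hx)
  refine ⟨S ∩ K, inter_mem_nhdsWithin S hKx, ?_⟩
  refine le_antisymm (le_of_forall_gt_imp_ge_of_dense fun ε hε => ?_) zero_le
  obtain ⟨ψ, hψ, hψb, ⟨N, hSN, hN⟩, h1, -⟩ := hcut K hK hKU ε hε
  calc vol n M (S ∩ K) = ∫⁻ _ in S ∩ K, 1 ∂(vol n M) := by simp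
    _ ≤ ∫⁻ p in S ∩ K, ‖ψ (chartAt (EuclideanSpace ℝ (Fin n)) x p)‖ₑ ∂(vol n M) := by
        refine setLIntegral_mono' (hS.inter hK.isClosed).measurableSet fun p hp => ?_
        rw [hN p (hSN hp)]
        simp
    _ ≤ ∫⁻ p in K, ‖ψ (chartAt (EuclideanSpace ℝ (Fin n)) x p)‖ₑ ∂(vol n M) :=
        lintegral_mono_set inter_subset_right
    _ ≤ ε := h1

end Polar

/-! ### Removability of conformally polar sets -/

section Limits

variable {X : Type*} [MeasurableSpace X] {μ : Measure X}

/-- Convergence in `L¹` at a summable rate implies convergence almost everywhere. -/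
theorem ae_tendsto_zero_of_lintegral_le {g : ℕ → X → ℝ≥0∞} (hg : ∀ j, AEMeasurable (g j) μ)
    (h : ∀ j, ∫⁻ x, g j x ∂μ ≤ 2⁻¹ ^ j) : ∀ᵐ x ∂μ, Tendsto (fun j => g j x) atTop (𝓝 0) := by
  have h1 : ∫⁻ x, ∑' j, g j x ∂μ ≠ ⊤ := by
    rw [lintegral_tsum hg]
    refine ne_top_of_le_ne_top ?_ (ENNReal.tsum_le_tsum h)
    rw [ENNReal.tsum_geometric]
    simp
  filter_upwards [ae_lt_top' (AEMeasurable.tsum hg) h1] with x hx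
  exact ENNReal.tendsto_atTop_zero_of_tsum_ne_top hx.ne

/-- An identity between integrals survives the removal of cut-off functions `1 - ψ j`, when
`ψ j → 0` and the error terms made by the gradients `D j` of the cut-off functions tend to zero
in `L¹`. -/
theorem integral_eq_of_tendsto_cutoff {A B a b : X → ℝ} {c : ℝ} {ψ D B' : ℕ → X → ℝ}
    (hψm : ∀ j, AEStronglyMeasurable (ψ j) μ) (hψ : ∀ j x, 0 ≤ ψ j x ∧ ψ j x ≤ 1)
    (hψ0 : ∀ᵐ x ∂μ, Tendsto (fun j => ψ j x) atTop (𝓝 0))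
    (hD0 : ∀ᵐ x ∂μ, Tendsto (fun j => D j x) atTop (𝓝 0))
    (ha : Integrable a μ) (hb : Integrable b μ)
    (hA : ∀ᵐ x ∂μ, |A x| ≤ a x) (hB : ∀ᵐ x ∂μ, |B x| ≤ b x)
    (hA' : ∀ j, Integrable (fun x => (1 - ψ j x) * A x) μ) (hB' : ∀ j, Integrable (B' j) μ)
    (hBB' : ∀ j, ∀ᵐ x ∂μ, |B' j x - (1 - ψ j x) * B x| ≤ b x * D j x)
    (hbD : Tendsto (fun j => ∫⁻ x, ‖b x * D j x‖ₑ ∂μ) atTop (𝓝 0))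
    (heq : ∀ j, ∫ x, (1 - ψ j x) * A x ∂μ = c * ∫ x, B' j x ∂μ) :
    Integrable A μ ∧ Integrable B μ ∧ ∫ x, A x ∂μ = c * ∫ x, B x ∂μ := by
  have hlim : ∀ F : X → ℝ, ∀ᵐ x ∂μ, Tendsto (fun j => (1 - ψ j x) * F x) atTop (𝓝 (F x)) := by
    intro F
    filter_upwards [hψ0] with x hx
    simpa using (hx.const_sub 1).mul_const (F x)
  have hbd : ∀ F : X → ℝ, ∀ j x, |(1 - ψ j x) * F x| ≤ |F x| := by
    intro F j x
    rw [abs_mul, abs_of_nonneg (by linarith [(hψ j x).2])]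
    exact mul_le_of_le_one_left (abs_nonneg _) (by linarith [(hψ j x).1])
  have hAi : Integrable A μ :=
    ha.mono' (aestronglyMeasurable_of_tendsto_ae atTop (fun j => (hA' j).1) (hlim A)) hA
  have hB'lim : ∀ᵐ x ∂μ, Tendsto (fun j => B' j x) atTop (𝓝 (B x)) := by
    filter_upwards [hlim B, hD0, ae_all_iff.2 hBB'] with x h1 h2 h3
    have h4 : Tendsto (fun j => B' j x - (1 - ψ j x) * B x) atTop (𝓝 0) :=
      squeeze_zero_norm h3 (by simpa using h2.const_mul (b x))
    simpa using h4.add h1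
  have hBi : Integrable B μ :=
    hb.mono' (aestronglyMeasurable_of_tendsto_ae atTop (fun j => (hB' j).1) hB'lim) hB
  have hAlim : Tendsto (fun j => ∫ x, (1 - ψ j x) * A x ∂μ) atTop (𝓝 (∫ x, A x ∂μ)) :=
    tendsto_integral_of_dominated_convergence (fun x => |A x|) (fun j => (hA' j).1) hAi.abs
      (fun j => ae_of_all _ (hbd A j)) (hlim A)
  have hBψ : ∀ j, Integrable (fun x => (1 - ψ j x) * B x) μ := fun j =>
    hBi.abs.mono' ((aestronglyMeasurable_const.sub (hψm j)).mul hBi.1) (ae_of_all _ (hbd B j))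
  have hBlim : Tendsto (fun j => ∫ x, (1 - ψ j x) * B x ∂μ) atTop (𝓝 (∫ x, B x ∂μ)) :=
    tendsto_integral_of_dominated_convergence (fun x => |B x|) (fun j => (hBψ j).1) hBi.abs
      (fun j => ae_of_all _ (hbd B j)) (hlim B)
  have herr : Tendsto (fun j => ∫ x, (B' j x - (1 - ψ j x) * B x) ∂μ) atTop (𝓝 0) := by
    have := tendsto_integral_of_L1 (μ := μ) (fun _ => (0 : ℝ)) aestronglyMeasurable_const
      (Eventually.of_forall fun j => (hB' j).sub (hBψ j)) (l := atTop) ?_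
    · simpa using this
    · refine tendsto_of_tendsto_of_tendsto_of_le_of_le tendsto_const_nhds hbD
        (fun _ => zero_le) fun j => lintegral_mono_ae ?_
      filter_upwards [hBB' j] with x hx
      rw [enorm_le_iff_norm_le]
      simpa using hx.trans (le_abs_self _)
  refine ⟨hAi, hBi, tendsto_nhds_unique hAlim ?_⟩
  simp only [heq]
  refine Tendsto.const_mul c ?_
  have := herr.add hBlim
  simp only [zero_add] at this
  refine this.congr fun j => ?_
  rw [integral_sub (hB' j) (hBψ j), sub_add_cancel]

/-- If `g j → 0` in `L^n`, then `b * g j → 0` in `L¹` for each `b` in `L^{n/k}`, `k < n`. -/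
theorem tendsto_lintegral_mul_of_lintegral_pow_le [IsFiniteMeasure μ] {n k : ℕ} (hk : k + 1 ≤ n)
    {b : X → ℝ} (hbm : AEStronglyMeasurable b μ) (hb : eLpNorm b (confExp n k) μ < ⊤)
    {g : ℕ → X → ℝ} (hg : ∀ j, AEStronglyMeasurable (g j) μ)
    (h : ∀ j, ∫⁻ x, ‖g j x‖ₑ ^ n ∂μ ≤ 2⁻¹ ^ j) :
    Tendsto (fun j => ∫⁻ x, ‖b x * g j x‖ₑ ∂μ) atTop (𝓝 0) := by
  have hn0 : (n : ℝ≥0∞) ≠ 0 := by exact_mod_cast (by omega : n ≠ 0)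
  have hr : 1 ≤ confExp n (k + 1) := one_le_confExp hk
  -- `k/n + 1/n = (k+1)/n`
  have : ENNReal.HolderTriple (confExp n k) n (confExp n (k + 1)) := by
    constructor
    have hinv : ∀ j : ℕ, (confExp n j)⁻¹ = (j : ℝ≥0∞) / n := by
      intro j
      unfold confExp
      split_ifs with hj
      · simp [hj]
      · rw [ENNReal.inv_div (Or.inl (by simp)) (Or.inl (by exact_mod_cast hj))]
    rw [hinv, hinv, ← one_div, ENNReal.div_add_div_same]
    simp
  have hgn : Tendsto (fun j => eLpNorm (g j) n μ) atTop (𝓝 0) := by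
    have h1 : Tendsto (fun j : ℕ => ((2⁻¹ : ℝ≥0∞) ^ j) ^ (1 / (n : ℝ))) atTop (𝓝 0) := by
      have h2 := (ENNReal.tendsto_pow_atTop_nhds_zero_of_lt_one
        (r := 2⁻¹) (by norm_num)).ennrpow_const (1 / (n : ℝ))
      rwa [ENNReal.zero_rpow_of_pos (by
        have : 0 < n := by omega
        positivity)] at h2
    refine tendsto_of_tendsto_of_tendsto_of_le_of_le tendsto_const_nhds h1 (fun _ => zero_le)
      fun j => ?_
    dsimp only
    rw [eLpNorm_eq_lintegral_rpow_enorm_toReal hn0 (by simp)]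
    simp only [ENNReal.toReal_natCast, ENNReal.rpow_natCast]
    gcongr
    exact h j
  have hCtop : μ univ ^ (1 / (1 : ℝ≥0∞).toReal - 1 / (confExp n (k + 1)).toReal) ≠ ⊤ := by
    refine ENNReal.rpow_ne_top_of_nonneg ?_ (measure_ne_top _ _)
    rcases eq_or_ne (confExp n (k + 1)) ⊤ with htop | htop
    · simp [htop]
    · have := (ENNReal.toReal_le_toReal (by simp) htop).2 hr
      rw [sub_nonneg]
      gcongr
      simp
  have hlim : Tendsto (fun j => eLpNorm b (confExp n k) μ * eLpNorm (g j) n μ *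
      μ univ ^ (1 / (1 : ℝ≥0∞).toReal - 1 / (confExp n (k + 1)).toReal)) atTop (𝓝 0) := by
    have h1 := ENNReal.Tendsto.mul_const (ENNReal.Tendsto.const_mul hgn
      (Or.inr hb.ne)) (Or.inr hCtop)
    simpa using h1
  refine tendsto_of_tendsto_of_tendsto_of_le_of_le tendsto_const_nhds hlim (fun _ => zero_le)
    fun j => ?_
  have h1 := eLpNorm_le_eLpNorm_mul_rpow_measure_univ (μ := μ) hr (hbm.smul (hg j))
  have h2 : eLpNorm (b • g j) (confExp n (k + 1)) μ ≤ eLpNorm b (confExp n k) μ *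
    eLpNorm (g j) n μ := eLpNorm_smul_le_mul_eLpNorm (hg j) hbm
  have h3 : ∫⁻ x, ‖b x * g j x‖ₑ ∂μ = eLpNorm (b • g j) 1 μ := by
    rw [eLpNorm_one_eq_lintegral_enorm]
    rfl
  rw [h3]
  exact h1.trans (mul_le_mul_left h2 _)

end Limits

section Removability

variable {n : ℕ} {M : Type*} [TopologicalSpace M] [ChartedSpace (EuclideanSpace ℝ (Fin n)) M]
  [RiemannianBundle (fun x : M => TangentSpace (𝓡 n) x)]
  [IsManifold (𝓡 n) ∞ M] [IsContMDiffRiemannianBundle (𝓡 n) ∞ (EuclideanSpace ℝ (Fin n))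
    (fun x : M => TangentSpace (𝓡 n) x)]
  [MeasurableSpace M] [BorelSpace M] [SecondCountableTopology M] [T2Space M]

theorem vol_lt_top_of_subset_source {x₀ : M} {K : Set M} (hK : IsCompact K)
    (hKx : K ⊆ (chartAt (EuclideanSpace ℝ (Fin n)) x₀).source) : vol n M K < ⊤ := by
  obtain ⟨C, hC, h⟩ := exists_lintegral_le_chartSet (n := n) hK hKx
  have := h (fun _ => 1) measurable_const
  simp only [lintegral_one, Measure.restrict_apply_univ] at this
  exact this.trans_lt (ENNReal.mul_lt_top hC.lt_top (isCompact_chartSet hK hKx).measure_lt_top)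

theorem topDensity_eq_zero_of_right (τ : FormField n M n) {j m : ℕ} (h : j + m = n)
    (φ : FormField n M j) (η : FormField n M m) {x : M} (hx : η x = 0) :
    topDensity τ h (fun x => wedge (φ x) (η x)) x = 0 := by
  simp [topDensity, hx, wedge_zero_right]

/-- The identity `∫_V θ ∧ β = (-1)^{k+1} ∫_V φ ∧ dβ`, with the existence of both integrals, for one
form `β`. -/
def WeakIdentity {k m : ℕ} (V : Opens M) (τ : FormField n M n) (h : k + 1 + m = n)
    (φ : FormField n M k) (θ : FormField n M (k + 1)) (β : FormField n M m) : Prop :=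
  IntegrableOn (topDensity τ h fun x => wedge (θ x) (β x)) (V : Set M) (vol n M) ∧
  IntegrableOn (topDensity τ (show k + (m + 1) = n by omega)
    fun x => wedge (φ x) (extD β x)) (V : Set M) (vol n M) ∧
  ∫ x in (V : Set M), topDensity τ h (fun x => wedge (θ x) (β x)) x ∂(vol n M) =
    (-1) ^ (k + 1) * ∫ x in (V : Set M), topDensity τ (show k + (m + 1) = n by omega)
      (fun x => wedge (φ x) (extD β x)) x ∂(vol n M)

/-- Only the support of `β` matters. -/
theorem weakIdentity_iff_of_support {k m : ℕ} {V : Opens M} (τ : FormField n M n)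
    (h : k + 1 + m = n) (φ : FormField n M k) (θ : FormField n M (k + 1)) {β : FormField n M m}
    {K : Set M} (hK : IsClosed K) (hKV : K ⊆ V) (hβ : ∀ p ∉ K, β p = 0) :
    WeakIdentity V τ h φ θ β ↔
      (IntegrableOn (topDensity τ h fun x => wedge (θ x) (β x)) K (vol n M) ∧
      IntegrableOn (topDensity τ (show k + (m + 1) = n by omega)
        fun x => wedge (φ x) (extD β x)) K (vol n M) ∧
      ∫ x in K, topDensity τ h (fun x => wedge (θ x) (β x)) x ∂(vol n M) =
        (-1) ^ (k + 1) * ∫ x in K, topDensity τ (show k + (m + 1) = n by omega)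
          (fun x => wedge (φ x) (extD β x)) x ∂(vol n M)) := by
  have key : ∀ F : M → ℝ, (∀ p ∉ K, F p = 0) →
      (IntegrableOn F (V : Set M) (vol n M) ↔ IntegrableOn F K (vol n M)) ∧
      ∫ x in (V : Set M), F x ∂(vol n M) = ∫ x in K, F x ∂(vol n M) := fun F hF =>
    ⟨⟨fun h => h.mono_set hKV, fun h => h.of_forall_sdiff_eq_zero V.isOpen.measurableSet
      fun x hx => hF x hx.2⟩, setIntegral_eq_of_subset_of_forall_sdiff_eq_zero
        V.isOpen.measurableSet hKV fun x hx => hF x hx.2⟩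
  obtain ⟨h1, h2⟩ := key (topDensity τ h fun x => wedge (θ x) (β x))
    fun p hp => topDensity_eq_zero_of_right τ h θ β (hβ p hp)
  obtain ⟨h3, h4⟩ := key (topDensity τ (show k + (m + 1) = n by omega)
    fun x => wedge (φ x) (extD β x))
    fun p hp => topDensity_eq_zero_of_right τ _ φ (extD β) (extD_eq_zero_of_notMem hK hβ hp)
  rw [WeakIdentity, h1, h2, h3, h4]

theorem WeakIdentity.add {k m : ℕ} {V : Opens M} {τ : FormField n M n}
    {h : k + 1 + m = n} {φ : FormField n M k} {θ : FormField n M (k + 1)} {β β' : FormField n M m}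
    (hβ : IsSmoothForm β) (hβ' : IsSmoothForm β') (h1 : WeakIdentity V τ h φ θ β)
    (h2 : WeakIdentity V τ h φ θ β') : WeakIdentity V τ h φ θ (β + β') := by
  obtain ⟨a1, b1, c1⟩ := h1
  obtain ⟨a2, b2, c2⟩ := h2
  rw [WeakIdentity, extD_add hβ hβ', topDensity_add_right, topDensity_add_right]
  refine ⟨a1.add a2, b1.add b2, ?_⟩
  simp only [Pi.add_apply]
  rw [integral_add a1 a2, integral_add b1 b2, c1, c2]
  ring

theorem WeakIdentity.zero {k m : ℕ} (V : Opens M) (τ : FormField n M n)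
    (h : k + 1 + m = n) (φ : FormField n M k) (θ : FormField n M (k + 1)) :
    WeakIdentity V τ h φ θ 0 :=
  (weakIdentity_iff_of_support τ h φ θ isClosed_empty (empty_subset _) fun _ _ => rfl).2 (by simp)

/-- The weak differential on `Sᶜ` is a weak differential across `S` for the test forms supported in a
compact set `K` on which there are cut-off functions of `S` with small gradient. -/
theorem weakIdentity_of_cutoff {S : Set M} (hS : IsClosed S) (hvol : vol n M S = 0) {x₀ : M}
    {K : Set M} (hK : IsCompact K) (hKx : K ⊆ (chartAt (EuclideanSpace ℝ (Fin n)) x₀).source)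
    (hcut : ∀ ε : ℝ≥0∞, 0 < ε →
      ∃ ψ : EuclideanSpace ℝ (Fin n) → ℝ, ContDiff ℝ ∞ ψ ∧ (∀ y, 0 ≤ ψ y ∧ ψ y ≤ 1) ∧
        (∃ N : Opens M, S ∩ K ⊆ N ∧ ∀ p ∈ N, ψ (chartAt (EuclideanSpace ℝ (Fin n)) x₀ p) = 1) ∧
        ∫⁻ p in K, ‖ψ (chartAt (EuclideanSpace ℝ (Fin n)) x₀ p)‖ₑ ∂(vol n M) ≤ ε ∧
        ∫⁻ p in K, ‖fderiv ℝ ψ (chartAt (EuclideanSpace ℝ (Fin n)) x₀ p)‖ₑ ^ n ∂(vol n M) ≤ ε)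
    {k m : ℕ} {φ : FormField n M k} {θ : FormField n M (k + 1)}
    (hφm : MeasurableFormOn ((⊤ : Opens M) : Set M) φ) (hφ : lNorm (⊤ : Opens M) φ < ⊤)
    (hθm : MeasurableFormOn ((⊤ : Opens M) : Set M) θ) (hθ : lNorm (⊤ : Opens M) θ < ⊤)
    (hd : HasWeakD (⟨Sᶜ, hS.isOpen_compl⟩ : Opens M) φ θ) {V : Opens M} {τ : FormField n M n}
    (hτ : IsOrientation V τ) (h : k + 1 + m = n) {β : FormField n M m} (hβ : IsSmoothForm β)
    (hKV : K ⊆ V) (hβK : ∀ p ∉ K, β p = 0) : WeakIdentity V τ h φ θ β := by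
  have hn : 1 ≤ n := by omega
  have hnk : k + (m + 1) = n := by omega
  have : IsFiniteMeasure ((vol n M).restrict K) :=
    ⟨by simpa using vol_lt_top_of_subset_source hK hKx⟩
  have hcK := (chartAt (EuclideanSpace ℝ (Fin n)) x₀).continuousOn.mono hKx
  have hKm := hK.measurableSet
  choose ψ hψ hψb hψN hψ1 hψ2 using fun j : ℕ => hcut (2⁻¹ ^ j) (ENNReal.pow_pos (by simp) j)
  -- the truncated test forms, which vanish near `S`
  set η : ℕ → FormField n M m := fun j p =>
    (1 - ψ j (chartAt (EuclideanSpace ℝ (Fin n)) x₀ p)) • β p with hη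
  have hψ' : ∀ j, ContDiff ℝ ∞ fun y => 1 - ψ j y := fun j => contDiff_const.sub (hψ j)
  have hηs : ∀ j, IsSmoothForm (η j) := fun j => hβ.fun_smul hK.isClosed hβK fun p hp =>
    ((hψ' j).contMDiff.contMDiffAt).comp p (contMDiffAt_of_mem_maximalAtlas
      (IsManifold.chart_mem_maximalAtlas x₀) (hKx hp))
  have hηt : ∀ j, WeakIdentity (V ⊓ ⟨Sᶜ, hS.isOpen_compl⟩) τ h φ θ (η j) := by
    intro j
    obtain ⟨N, hSN, hN⟩ := hψN j
    refine hd _ inf_le_right τ ⟨fun x I => (hτ.1 x I).mono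
      (inter_subset_inter_left _ inter_subset_left), fun x hx => hτ.2 x hx.1⟩ m h (η j)
      ⟨hηs j, K \ N, hK.diff N.isOpen, fun p hp => ⟨hKV hp.1, fun hpS => hp.2 (hSN ⟨hpS, hp.1⟩)⟩,
        fun p hp => ?_⟩
    by_cases hpN : p ∈ N
    · simp [hη, hN p hpN]
    · simp [hη, hβK p fun hpK => hp ⟨hpK, hpN⟩]
  have hηV : ∀ j, WeakIdentity V τ h φ θ (η j) := by
    intro j
    have hr : (vol n M).restrict ((V ⊓ ⟨Sᶜ, hS.isOpen_compl⟩ : Opens M) : Set M) =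
        (vol n M).restrict (V : Set M) := by
      refine Measure.restrict_congr_set ?_
      exact inter_ae_eq_left_of_ae_eq_univ (ae_eq_univ.2 (by simpa using hvol))
    have := hηt j
    unfold WeakIdentity IntegrableOn at this
    rwa [hr] at this
  have hηK := fun j => (weakIdentity_iff_of_support τ h φ θ hK.isClosed hKV
    (β := η j) fun p hp => by simp [hη, hβK p hp]).1 (hηV j)
  rw [weakIdentity_iff_of_support τ h φ θ hK.isClosed hKV hβK]
  obtain ⟨C₁, hC₁0, hC₁⟩ := hβ.exists_formNorm_le_of_subset_source hK hKx
  obtain ⟨C₂, hC₂0, hC₂⟩ := hβ.extD.exists_formNorm_le_of_subset_source hK hKx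
  obtain ⟨C₃, hC₃0, hC₃⟩ := exists_formNorm_extD_smul_sub_le hβ hK hKx
  set c₁ : ℝ := (k + 1 + m).factorial * (√((k + 1).factorial : ℝ) * √(m.factorial : ℝ)) with hc₁
  set c₂ : ℝ := (k + (m + 1)).factorial * (√(k.factorial : ℝ) * √((m + 1).factorial : ℝ)) with hc₂
  have hc₁0 : 0 ≤ c₁ := by positivity
  have hc₂0 : 0 ≤ c₂ := by positivity
  -- the error terms `d((1 - ψ j) β) - (1 - ψ j) dβ`
  set R : ℕ → FormField n M (m + 1) := fun j p => extD (η j) p -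
    (1 - ψ j (chartAt (EuclideanSpace ℝ (Fin n)) x₀ p)) • extD β p with hR
  have hRle : ∀ j, ∀ p ∈ K, formNorm (R j p) ≤
      C₃ * ‖fderiv ℝ (ψ j) (chartAt (EuclideanSpace ℝ (Fin n)) x₀ p)‖ := by
    intro j p hp
    have h1 := hC₃ (fun y => 1 - ψ j y) (hψ' j) (hηs j) p hp
    rwa [fderiv_const_sub, norm_neg] at h1
  have hηd : ∀ j p, topDensity τ hnk (fun x => wedge (φ x) (extD (η j) x)) p =
      (1 - ψ j (chartAt (EuclideanSpace ℝ (Fin n)) x₀ p)) *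
        topDensity τ hnk (fun x => wedge (φ x) (extD β x)) p +
      topDensity τ hnk (fun x => wedge (φ x) (R j x)) p := by
    intro j p
    have h1 : extD (η j) = (fun p => (1 - ψ j (chartAt (EuclideanSpace ℝ (Fin n)) x₀ p)) •
        extD β p) + R j := by
      funext q
      simp [hR]
    rw [h1, topDensity_add_right, Pi.add_apply, topDensity_fun_smul_right]
  -- the norms of the forms, on the compact set `K` of finite volume
  have hres : ∀ {j : ℕ} {α : FormField n M j}, MeasurableFormOn ((⊤ : Opens M) : Set M) α →
      lNorm (⊤ : Opens M) α < ⊤ →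
      AEStronglyMeasurable (fun p => formNorm (α p)) ((vol n M).restrict K) ∧
      eLpNorm (fun p => formNorm (α p)) (confExp n j) ((vol n M).restrict K) < ⊤ := fun hα hα' =>
    ⟨(hα.aemeasurable_formNorm.mono_measure
      (Measure.restrict_mono (subset_univ _) le_rfl)).aestronglyMeasurable,
      (eLpNorm_mono_measure _ (Measure.restrict_mono (subset_univ _) le_rfl)).trans_lt hα'⟩
  have hint : ∀ {j : ℕ} {α : FormField n M j}, j ≤ n →
      MeasurableFormOn ((⊤ : Opens M) : Set M) α → lNorm (⊤ : Opens M) α < ⊤ →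
      Integrable (fun p => formNorm (α p)) ((vol n M).restrict K) := fun hj hα hα' =>
    MemLp.integrable (one_le_confExp hj) ⟨(hres hα hα').1, (hres hα hα').2⟩
  obtain ⟨hφm', hφ'⟩ := hres hφm hφ
  have hψm : ∀ j, AEStronglyMeasurable
      (fun p => ψ j (chartAt (EuclideanSpace ℝ (Fin n)) x₀ p)) ((vol n M).restrict K) := fun j =>
    ((hψ j).continuous.comp_continuousOn hcK).aestronglyMeasurable hKm
  have hDm : ∀ j, AEStronglyMeasurable
      (fun p => ‖fderiv ℝ (ψ j) (chartAt (EuclideanSpace ℝ (Fin n)) x₀ p)‖)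
      ((vol n M).restrict K) := fun j =>
    (((hψ j).continuous_fderiv (by simp)).norm.comp_continuousOn hcK).aestronglyMeasurable hKm
  set C : ℝ := c₂ * (C₂ + C₃) with hC
  refine integral_eq_of_tendsto_cutoff (a := fun p => c₁ * C₁ * formNorm (θ p))
    (b := fun p => C * formNorm (φ p))
    (ψ := fun j p => ψ j (chartAt (EuclideanSpace ℝ (Fin n)) x₀ p))
    (D := fun j p => ‖fderiv ℝ (ψ j) (chartAt (EuclideanSpace ℝ (Fin n)) x₀ p)‖)
    (B' := fun j => topDensity τ hnk fun x => wedge (φ x) (extD (η j) x))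
    hψm (fun j p => hψb j _) ?_ ?_ ((hint (by omega) hθm hθ).const_mul _)
    ((hint (by omega) hφm hφ).const_mul _) ?_ ?_ ?_ (fun j => (hηK j).2.1) ?_ ?_ ?_
  · filter_upwards [ae_tendsto_zero_of_lintegral_le (fun j => (hψm j).enorm) hψ1] with p hp
    exact tendsto_zero_iff_enorm_tendsto_zero.2 hp
  · have hm : ∀ j, AEMeasurable (fun p =>
        ‖fderiv ℝ (ψ j) (chartAt (EuclideanSpace ℝ (Fin n)) x₀ p)‖ₑ ^ n)
        ((vol n M).restrict K) := fun j => by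
      simpa using (hDm j).enorm.pow_const n
    filter_upwards [ae_tendsto_zero_of_lintegral_le hm hψ2] with p hp
    have h1 := hp.ennrpow_const (1 / (n : ℝ))
    rw [ENNReal.zero_rpow_of_pos (by
      have : 0 < n := by omega
      positivity)] at h1
    rw [tendsto_zero_iff_enorm_tendsto_zero]
    refine h1.congr fun j => ?_
    rw [one_div, ENNReal.pow_rpow_inv_natCast (by omega), enorm_norm]
  · filter_upwards [ae_restrict_mem hKm] with p hp
    calc _ ≤ c₁ * (formNorm (θ p) * formNorm (β p)) :=
          abs_topDensity_wedge_le h θ β (hτ.2 p (hKV hp))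
      _ ≤ c₁ * (formNorm (θ p) * C₁) := by
          gcongr
          · exact formNorm_nonneg _
          · exact hC₁ p hp
      _ = _ := by ring
  · filter_upwards [ae_restrict_mem hKm] with p hp
    calc _ ≤ c₂ * (formNorm (φ p) * formNorm (extD β p)) :=
          abs_topDensity_wedge_le hnk φ (extD β) (hτ.2 p (hKV hp))
      _ ≤ c₂ * (formNorm (φ p) * (C₂ + C₃)) := by
          gcongr
          · exact formNorm_nonneg _
          · exact (hC₂ p hp).trans (le_add_of_nonneg_right hC₃0)
      _ = _ := by rw [hC]; ring
  · intro j
    refine (hηK j).1.congr (ae_of_all _ fun p => ?_)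
    exact topDensity_fun_smul_right τ h θ _ β p
  · intro j
    filter_upwards [ae_restrict_mem hKm] with p hp
    rw [hηd, add_sub_cancel_left]
    calc _ ≤ c₂ * (formNorm (φ p) * formNorm (R j p)) :=
          abs_topDensity_wedge_le hnk φ (R j) (hτ.2 p (hKV hp))
      _ ≤ c₂ * (formNorm (φ p) * ((C₂ + C₃) *
            ‖fderiv ℝ (ψ j) (chartAt (EuclideanSpace ℝ (Fin n)) x₀ p)‖)) := by
          gcongr
          · exact formNorm_nonneg _
          · refine (hRle j p hp).trans ?_
            gcongr
            exact le_add_of_nonneg_left hC₂0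
      _ = _ := by rw [hC]; ring
  · refine tendsto_lintegral_mul_of_lintegral_pow_le (n := n) (k := k) (by omega)
      (hφm'.const_mul C) ?_ hDm fun j => ?_
    · have h1 := eLpNorm_const_smul C (fun p => formNorm (φ p)) (confExp n k) ((vol n M).restrict K)
      exact h1.trans_lt (ENNReal.mul_lt_top (by simp) hφ')
    · simpa using hψ2 j
  · intro j
    rw [← (hηK j).2.2]
    exact integral_congr_ae (ae_of_all _ fun p => (topDensity_fun_smul_right τ h θ
      (fun p => 1 - ψ j (chartAt (EuclideanSpace ℝ (Fin n)) x₀ p)) β p).symm)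

/-- Closed conformally polar sets are removable for the weak exterior differential: a partition of
unity cuts a test form into finitely many pieces supported where cut-off functions exist. -/
theorem HasWeakD.of_compl (hn : 1 ≤ n) {S : Set M} (hS : IsClosed S)
    (hpolar : IsConformallyPolar n S) {k : ℕ} {φ : FormField n M k} {θ : FormField n M (k + 1)}
    (hφm : MeasurableFormOn ((⊤ : Opens M) : Set M) φ) (hφ : lNorm (⊤ : Opens M) φ < ⊤)
    (hθm : MeasurableFormOn ((⊤ : Opens M) : Set M) θ) (hθ : lNorm (⊤ : Opens M) θ < ⊤)
    (hd : HasWeakD (⟨Sᶜ, hS.isOpen_compl⟩ : Opens M) φ θ) : HasWeakD (⊤ : Opens M) φ θ := by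
  rintro V - τ hτ m h β ⟨hβ, K, hK, hKV, hβK⟩
  have : LocallyCompactSpace M := ChartedSpace.locallyCompactSpace (EuclideanSpace ℝ (Fin n)) M
  have : SigmaCompactSpace M := sigmaCompactSpace_of_locallyCompact_secondCountable
  choose U hxU hUx hcut using hpolar.exists_cutoff hn hS
  obtain ⟨χ, hχ⟩ := SmoothPartitionOfUnity.exists_isSubordinate (𝓡 n) isClosed_univ
    (fun x => (U x : Set M)) (fun x => (U x).isOpen) (fun x _ => mem_iUnion_of_mem x (hxU x))
  have hfin := χ.locallyFinite.finite_nonempty_inter_compact hK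
  have hpieces : ∀ F : Finset M, IsSmoothForm (∑ x ∈ F, fun p => χ x p • β p) ∧
      WeakIdentity V τ h φ θ (∑ x ∈ F, fun p => χ x p • β p) := by
    classical
    intro F
    induction F using Finset.induction_on with
    | empty =>
      rw [Finset.sum_empty]
      exact ⟨fun x => contDiffOn_const (c := 0), WeakIdentity.zero V τ h φ θ⟩
    | insert x F hx ih =>
      rw [Finset.sum_insert hx]
      have hs : IsSmoothForm fun p => χ x p • β p :=
        hβ.fun_smul hK.isClosed hβK fun p _ => (χ x).contMDiff.contMDiffAt
      refine ⟨hs.add ih.1, WeakIdentity.add hs ih.1 ?_ ih.2⟩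
      have hKx : K ∩ tsupport (χ x) ⊆ U x := inter_subset_right.trans (hχ x)
      have hKc : IsCompact (K ∩ tsupport (χ x)) := hK.inter_right (isClosed_tsupport _)
      refine weakIdentity_of_cutoff hS (hpolar.vol_eq_zero hn hS) hKc (hKx.trans (hUx x))
        (hcut x _ hKc hKx) hφm hφ hθm hθ hd hτ h hs (inter_subset_left.trans hKV) fun p hp => ?_
      by_cases hpK : p ∈ K
      · rw [image_eq_zero_of_notMem_tsupport fun hpx => hp ⟨hpK, hpx⟩, zero_smul]
      · rw [hβK p hpK, smul_zero]
  have hsum : (∑ x ∈ hfin.toFinset, fun p => χ x p • β p : FormField n M m) = β := by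
    funext p
    rw [Finset.sum_apply, ← Finset.sum_smul]
    by_cases hpK : p ∈ K
    · have h1 := χ.sum_eq_one (mem_univ p)
      rw [finsum_eq_sum_of_support_subset (s := hfin.toFinset)] at h1
      · rw [h1, one_smul]
      · intro x hx
        simp only [Finite.coe_toFinset]
        exact ⟨p, hx, hpK⟩
    · rw [hβK p hpK, smul_zero]
  have := (hpieces hfin.toFinset).2
  rwa [hsum] at this

end Removability

/-! ### Restriction of forms to the complement -/

section Quotients

variable {A B : Type*} [AddCommGroup A] [Module ℝ A] [AddCommGroup B] [Module ℝ B]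

theorem bijective_mapQ {p : Submodule ℝ A} {q : Submodule ℝ B} {f : A →ₗ[ℝ] B}
    (hf : Function.Surjective f) (h : p ≤ q.comap f) (h' : q.comap f ≤ p) :
    Function.Bijective (p.mapQ q f h) := by
  constructor
  · rw [injective_iff_map_eq_zero]
    intro c hc
    obtain ⟨x, rfl⟩ := p.mkQ_surjective c
    rw [Submodule.mkQ_apply, Submodule.mapQ_apply, Submodule.Quotient.mk_eq_zero] at hc
    exact (Submodule.Quotient.mk_eq_zero p).2 (h' hc)
  · intro c
    obtain ⟨y, rfl⟩ := q.mkQ_surjective c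
    obtain ⟨x, rfl⟩ := hf y
    exact ⟨p.mkQ x, p.mapQ_apply q f x⟩

end Quotients

/-- A surjective linear isometry induces an isometry of quotients, if it matches the subspaces. The
subspaces need not be closed. -/
theorem norm_mapQ_eq {A B : Type*} [SeminormedAddCommGroup A] [Module ℝ A]
    [SeminormedAddCommGroup B] [Module ℝ B] {p : Submodule ℝ A} {q : Submodule ℝ B} {f : A →ₗ[ℝ] B}
    (hf : Function.Surjective f) (hn : ∀ x, ‖f x‖ = ‖x‖) (h : p ≤ q.comap f) (h' : q.comap f ≤ p)
    (c : A ⧸ p) : ‖p.mapQ q f h c‖ = ‖c‖ := by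
  refine le_antisymm ?_ ?_
  · refine le_of_forall_pos_lt_add fun ε hε => ?_
    obtain ⟨x, rfl, hx⟩ := Submodule.Quotient.norm_mk_lt c hε
    rw [Submodule.mapQ_apply]
    exact ((Submodule.Quotient.norm_mk_le q _).trans_eq (hn x)).trans_lt hx
  · refine le_of_forall_pos_lt_add fun ε hε => ?_
    obtain ⟨y, hy, hy'⟩ := Submodule.Quotient.norm_mk_lt (p.mapQ q f h c) hε
    obtain ⟨x, rfl⟩ := hf y
    have hx : Submodule.Quotient.mk x = c := (bijective_mapQ hf h h').1 hy
    subst hx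
    refine ((Submodule.Quotient.norm_mk_le p x).trans_eq (hn x).symm).trans_lt ?_
    exact hy'

section Restriction

variable {n : ℕ} {M : Type*} [TopologicalSpace M] [ChartedSpace (EuclideanSpace ℝ (Fin n)) M]
  [RiemannianBundle (fun x : M => TangentSpace (𝓡 n) x)]
  [IsManifold (𝓡 n) ∞ M] [IsContMDiffRiemannianBundle (𝓡 n) ∞ (EuclideanSpace ℝ (Fin n))
    (fun x : M => TangentSpace (𝓡 n) x)]
  [MeasurableSpace M] [BorelSpace M] [SecondCountableTopology M] [T2Space M]
  {S : Set M} (hS : IsClosed S) {k : ℕ}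

theorem lNorm_compl (hvol : vol n M S = 0) (α : FormField n M k) :
    lNorm (⟨Sᶜ, hS.isOpen_compl⟩ : Opens M) α = lNorm (⊤ : Opens M) α := by
  unfold lNorm
  congr 1
  exact Measure.restrict_congr_set (ae_eq_univ.2 (by simpa using hvol))

theorem MeasurableFormOn.of_compl (hvol : vol n M S = 0) {α : FormField n M k}
    (hα : MeasurableFormOn Sᶜ α) : MeasurableFormOn ((⊤ : Opens M) : Set M) α := by
  intro x I
  have h : (vol n M).restrict (Sᶜ ∩ (chartAt (EuclideanSpace ℝ (Fin n)) x).source) =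
      (vol n M).restrict (((⊤ : Opens M) : Set M) ∩
        (chartAt (EuclideanSpace ℝ (Fin n)) x).source) :=
    Measure.restrict_congr_set (EventuallyEq.inter (ae_eq_univ.2 (by simpa using hvol))
      (ae_eq_refl _))
  rw [← h]
  exact hα x I

theorem norm_res_compl (hvol : vol n M S = 0) (α : LForm n (⊤ : Opens M) k) :
    ‖LForm.res (le_top : (⟨Sᶜ, hS.isOpen_compl⟩ : Opens M) ≤ ⊤) k α‖ = ‖α‖ := by
  rw [LForm.norm_def, LForm.norm_def, LForm.form_res, lNorm_compl hS hvol]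

theorem surjective_res_compl (hvol : vol n M S = 0) : Function.Surjective
    (LForm.res (n := n) (le_top : (⟨Sᶜ, hS.isOpen_compl⟩ : Opens M) ≤ ⊤) k) := fun α =>
  ⟨LForm.mk α.form (α.measurable_form.of_compl hvol)
    ((lNorm_compl hS hvol _).symm.trans_lt α.lNorm_form_lt_top),
    LForm.ext (by rw [LForm.form_res, LForm.form_mk])⟩

theorem res_compl_mem_closedForms_iff (hn : 1 ≤ n) (hpolar : IsConformallyPolar n S)
    {α : LForm n (⊤ : Opens M) k} :
    LForm.res (le_top : (⟨Sᶜ, hS.isOpen_compl⟩ : Opens M) ≤ ⊤) k α ∈ closedForms n _ k ↔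
      α ∈ closedForms n ⊤ k := by
  refine ⟨fun h => ?_, res_mem_closedForms n le_top k α⟩
  rw [mem_closedForms, LForm.form_res] at h
  exact h.of_compl hn hS hpolar α.measurable_form α.lNorm_form_lt_top
    (0 : LForm n (⊤ : Opens M) (k + 1)).measurable_form
    (0 : LForm n (⊤ : Opens M) (k + 1)).lNorm_form_lt_top

theorem res_compl_mem_exactForms_iff (hn : 1 ≤ n) (hpolar : IsConformallyPolar n S)
    {α : LForm n (⊤ : Opens M) k} :
    LForm.res (le_top : (⟨Sᶜ, hS.isOpen_compl⟩ : Opens M) ≤ ⊤) k α ∈ exactForms n _ k ↔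
      α ∈ exactForms n ⊤ k := by
  have hvol := hpolar.vol_eq_zero hn hS
  refine ⟨fun h => ?_, res_mem_exactForms n le_top k α⟩
  cases k with
  | zero => rwa [mem_exactForms_zero, norm_res_compl hS hvol, ← mem_exactForms_zero] at h
  | succ k =>
    rw [mem_exactForms_succ] at h
    obtain ⟨β', hβ⟩ := h
    obtain ⟨β, rfl⟩ := surjective_res_compl hS hvol β'
    rw [LForm.form_res, LForm.form_res] at hβ
    exact (mem_exactForms_succ n k).2 ⟨β, hβ.of_compl hn hS hpolar β.measurable_form
      β.lNorm_form_lt_top α.measurable_form α.lNorm_form_lt_top⟩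

theorem res_compl_mem_closureExactForms_iff (hn : 1 ≤ n) (hpolar : IsConformallyPolar n S)
    {α : LForm n (⊤ : Opens M) k} :
    LForm.res (le_top : (⟨Sᶜ, hS.isOpen_compl⟩ : Opens M) ≤ ⊤) k α ∈ closureExactForms n _ k ↔
      α ∈ closureExactForms n ⊤ k := by
  have hvol := hpolar.vol_eq_zero hn hS
  refine ⟨fun h => ?_, res_mem_closureExactForms n le_top k α⟩
  -- approximating exact forms on the complement lift isometrically to exact forms
  refine SeminormedAddCommGroup.mem_closure_iff.2 fun ε hε => ?_
  obtain ⟨β', hβ', hε'⟩ := SeminormedAddCommGroup.mem_closure_iff.1 h ε hε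
  obtain ⟨β, rfl⟩ := surjective_res_compl hS hvol β'
  refine ⟨β, (res_compl_mem_exactForms_iff hS hn hpolar).1 hβ', ?_⟩
  rwa [← map_sub, norm_res_compl hS hvol] at hε'

end Restriction

end ConfDeRham

theorem mainTheorem12 (n : ℕ) (hn : 1 ≤ n) (M : Type*) [TopologicalSpace M] [T2Space M]
    [SecondCountableTopology M] [ChartedSpace (EuclideanSpace ℝ (Fin n)) M]
    [IsManifold (𝓡 n) ∞ M] [RiemannianBundle (fun x : M => TangentSpace (𝓡 n) x)]
    [IsContMDiffRiemannianBundle (𝓡 n) ∞ (EuclideanSpace ℝ (Fin n))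
      (fun x : M => TangentSpace (𝓡 n) x)]
    [MeasurableSpace M] [BorelSpace M]
    (S : Set M) (hS : IsClosed S) (hpolar : ConfDeRham.IsConformallyPolar n S) (k : ℕ) :
    Function.Bijective (ConfDeRham.resConfCohomology n
      (le_top : (⟨Sᶜ, hS.isOpen_compl⟩ : Opens M) ≤ ⊤) k) ∧
    (Function.Bijective (ConfDeRham.resRedConfCohomology n
        (le_top : (⟨Sᶜ, hS.isOpen_compl⟩ : Opens M) ≤ ⊤) k) ∧
      ∀ c : ConfDeRham.RedConfCohomology n (⊤ : Opens M) k,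
        ‖ConfDeRham.resRedConfCohomology n
          (le_top : (⟨Sᶜ, hS.isOpen_compl⟩ : Opens M) ≤ ⊤) k c‖ = ‖c‖) ∧
    Function.Bijective (ConfDeRham.resConfTorsion n
      (le_top : (⟨Sᶜ, hS.isOpen_compl⟩ : Opens M) ≤ ⊤) k) := by
  have hvol := hpolar.vol_eq_zero hn hS
  have hZ : Function.Surjective ((ConfDeRham.LForm.res (n := n)
      (le_top : (⟨Sᶜ, hS.isOpen_compl⟩ : Opens M) ≤ ⊤) k).restrict
        (ConfDeRham.res_mem_closedForms n le_top k)) := by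
    rintro ⟨α', hα'⟩
    obtain ⟨α, rfl⟩ := ConfDeRham.surjective_res_compl hS hvol α'
    exact ⟨⟨α, (ConfDeRham.res_compl_mem_closedForms_iff hS hn hpolar).1 hα'⟩, rfl⟩
  have hB : Function.Surjective ((ConfDeRham.LForm.res (n := n)
      (le_top : (⟨Sᶜ, hS.isOpen_compl⟩ : Opens M) ≤ ⊤) k).restrict
        (ConfDeRham.res_mem_closureExactForms n le_top k)) := by
    rintro ⟨α', hα'⟩
    obtain ⟨α, rfl⟩ := ConfDeRham.surjective_res_compl hS hvol α'
    exact ⟨⟨α, (ConfDeRham.res_compl_mem_closureExactForms_iff hS hn hpolar).1 hα'⟩, rfl⟩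
  refine ⟨ConfDeRham.bijective_mapQ hZ _ fun α hα => ?_,
    ⟨ConfDeRham.bijective_mapQ hZ _ fun α hα => ?_, fun c => ?_⟩,
    ConfDeRham.bijective_mapQ hB _ fun α hα => ?_⟩
  · exact (ConfDeRham.res_compl_mem_exactForms_iff hS hn hpolar).1 hα
  · exact (ConfDeRham.res_compl_mem_closureExactForms_iff hS hn hpolar).1 hα
  · exact ConfDeRham.norm_mapQ_eq hZ (fun α => ConfDeRham.norm_res_compl hS hvol α.1) _
      (fun α hα => (ConfDeRham.res_compl_mem_closureExactForms_iff hS hn hpolar).1 hα) c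
  · exact (ConfDeRham.res_compl_mem_exactForms_iff hS hn hpolar).1 hα
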